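/- **Model.** Two sets of Compound TCP flows with window sizes $w_1(t),w_2(t)>0$, round trip times $\tau_1,\tau_2>0$, protocol parameters $\alpha,\beta>0$, $k<2$, and an exogenous parameter $\kappa>0$ evolve by $$\dot w_j(t)=\kappa\,\frac{w_j(t-\tau_j)}{\tau_j}\Big(\alpha\,w_j(t)^{k-1}(1-L_j)-\beta\,w_j(t)\,L_j\Big),\qquad j=1,2,$$ where $L_j$ is the Drop-Tail loss probability seen by set $j$, evaluated at the delayed windows $v_i=w_i(t-\tau_i)$. With $S=v_1/\tau_1+v_2/\tau_2$, capacities $C,C_1,C_2>0$ and integer buffer sizes $B,B_1,B_2\ge1$: * Case I: $L_1=L_2=(S/C)^B$; * Case II: $L_1=L_2=(S/C_1)^{B_1}+(S/C_2)^{B_2}$; * Case III: $L_j=\big(v_j/(C_j\tau_j)\big)^{B_j}+(S/C)^B$. For a delay equation with right-hand side $F$, an equilibrium is called *linearly stable* if all characteristic roots of the linearisation there have negative real part; *Lyapunov stability* and *local asymptotic stability* refer to the nonlinear equation, with continuous initial histories uniformly close to the equilibrium. **Scenario 2** (Cases I, II, III). The delay of the second set is neglected: $w_2(t-\tau_2)$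 is replaced by $w_2(t)$. Let $(w_1^*,w_2^*)$ be an equilibrium with positive entries, let $L_j^*$ and $S^*=w_1^*/\tau_1+w_2^*/\tau_2$ be the values there, and put $$\mathcal M_j=\frac{\alpha(2-k)}{\tau_j}(w_j^*)^{k-1}(1-L_j^*),\quad \mathcal N_j=\big(\alpha (w_j^*)^{k-1}+\beta w_j^*\big)\Big(E_j+\frac{w_j^*}{\tau_j^2}\,\sigma\Big),\quad \mathcal P_j=\big(\alpha (w_j^*)^{k-1}+\beta w_j^*\big)\frac{w_j^*}{\tau_1\tau_2}\,\sigma,$$ where $\sigma=\frac{B}{C^B}(S^*)^{B-1}$ in Cases I and III, $\sigma=\sum_{i=1,2}\frac{B_i}{C_i^{B_i}}(S^*)^{B_i-1}$ in Case II, $E_j=0$ in Cases I and II, and $E_j=\frac{B_j}{\tau_j}\big(\frac{w_j^*}{C_j\tau_j}\big)^{B_j}$ in Case III. Then the linearised system is $$\dot u_1(t)=-\kappa\big(\mathcal M_1u_1(t)+\mathcal N_1u_1(t-\tau_1)+\mathcal P_1u_2(t)\big),\qquad \dot u_2(t)=-\kappa\big((\mathcal M_2+\mathcal N_2)u_2(t)+\mathcal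 P_2u_1(t-\tau_1)\big),$$ and its characteristic equation is $$\lambda^2+\kappa a\lambda+\kappa b\lambda e^{-\lambda\tau_1}+\kappa^2c+\kappa^2d\,e^{-\lambda\tau_1}=0,$$ $$a=\mathcal M_1+\mathcal M_2+\mathcal N_2,\quad b=\mathcal N_1,\quad c=\mathcal M_1(\mathcal M_2+\mathcal N_2),\quad d=\mathcal N_1(\mathcal M_2+\mathcal N_2)-\mathcal P_1\mathcal P_2 .$$ Put $D=2c-a^2+b^2$, $\Delta=D^2-4(c^2-d^2)$, and suppose *Condition 1*: there is exactly one positive value of $\omega^2=\kappa^2x$, i.e. the equation $x^2-Dx+(c^2-d^2)=0$ has exactly one positive solution $x$. (This holds in particular if $D>0$ and $\Delta=0$, or if $D>0$ and $c^2<d^2$.) Let $$A=\sqrt{\tfrac12D+\tfrac12\sqrt{\Delta}},\qquad \kappa_c=\frac1{A\tau_1}\arccos\Big(\frac{A^2(d-ab)-cd}{b^2A^2+d^2}\Big).$$ Then: 1. if $\kappa<\kappa_c$, the equilibrium is linearly stable and locally asymptotically stable; 2. if $\kappa=\kappa_c$, then $\lambda=i\kappa A$ is a characteristic root, so the equilibrium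 is not linearly stable; 3. if moreover $\Delta\neq0$ (the positive solution $x$ is simple), then the equilibrium is linearly stable if and only if $\kappa<\kappa_c$, and for every $\kappa>\kappa_c$ it is not Lyapunov stable for the nonlinear system. **Scenario 1.** All parameters coincide: $\tau_1=\tau_2=\tau>0$, $C_1=C_2=C>0$, $B_1=B_2=B\ge1$. Consider * Cases I and II, reduced to a single set of flows: $\dot w(t)=\kappa\frac{w(t-\tau)}{\tau}\big(\alpha w(t)^{k-1}(1-L)-\beta w(t)L\big)$ with $L=m\big(\frac{w(t-\tau)}{C\tau}\big)^B$, $m=1$ in Case I, $m=2$ in Case II, and an equilibrium $w^*>0$ with loss $L^*=m\big(\frac{w^*}{C\tau}\big)^B$; * Case III, the two-flow system (with both delays equal to $\tau$) and an equilibrium $(w^*,w^*)$, $w^*>0$, with loss $L^*=(1+2^B)\big(\frac{w^*}{C\tau}\big)^B$. Assume $(2-k)(1-L^*)\le B$, so that the expressions below are defined. Then, in each case, the equilibrium is linearly stable if and only if $$\kappa\,\alpha\,(w^*)^{k-1}\sqrt{B^2-\big((k-2)(1-L^*)\big)^2}<\arccos\Big(\frac{(k-2)(1-L^*)}{B}\Big).$$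 If this inequality holds, the equilibrium is locally asymptotically stable; if the reverse strict inequality holds, it is not Lyapunov stable. -/

import Mathlib

open Set Filter Topology

noncomputable section

/-! Delay differential equations with one constant delay: `x'(t) = F (x t) (x (t - τ))`. -/

section Delay

variable {E : Type*} [NormedAddCommGroup E] [NormedSpace ℝ E]

/-- `x` is a solution on `[-τ, ∞)` of `x'(t) = F (x t) (x (t - τ))`, `t > 0`, with initial
history `φ` on `[-τ, 0]`. -/
def IsDDESolution (F : E → E → E) (τ : ℝ) (φ x : ℝ → E) : Prop :=
  ContinuousOn x (Ici (-τ)) ∧ EqOn x φ (Icc (-τ) 0) ∧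
    ∀ t : ℝ, 0 < t → HasDerivAt x (F (x t) (x (t - τ))) t

/-- `φ` is a continuous history on `[-τ, 0]` that is uniformly within `δ` of the constant `e`. -/
def IsNearHistory (τ : ℝ) (e : E) (δ : ℝ) (φ : ℝ → E) : Prop :=
  ContinuousOn φ (Icc (-τ) 0) ∧ ∀ θ ∈ Icc (-τ) 0, ‖φ θ - e‖ < δ

/-- Stability in the sense of Lyapunov of the constant solution `e`. -/
def LyapunovStable (F : E → E → E) (τ : ℝ) (e : E) : Prop :=
  ∀ ε > 0, ∃ δ > 0, ∀ φ : ℝ → E, IsNearHistory τ e δ φ →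
    (∃ x, IsDDESolution F τ φ x) ∧
      ∀ x, IsDDESolution F τ φ x → ∀ t : ℝ, 0 ≤ t → ‖x t - e‖ < ε

/-- Local asymptotic stability of the constant solution `e`: it is stable and attracts all
solutions whose history is close to `e`. -/
def LocallyAsymptoticallyStable (F : E → E → E) (τ : ℝ) (e : E) : Prop :=
  LyapunovStable F τ e ∧
    ∃ δ > 0, ∀ φ : ℝ → E, IsNearHistory τ e δ φ →
      ∀ x, IsDDESolution F τ φ x → Tendsto x atTop (𝓝 e)

/-- `z` is a characteristic root of the linearisation `u'(t) = A u(t) + B u(t - τ)` at `e`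
(`A`, `B` the partial derivatives of `F` at `(e, e)`): there is a nonzero complex vector `v + i w`
with `z (v + i w) = A (v + i w) + exp (-z τ) B (v + i w)`, that is, `exp (z t) (v + i w)` solves
the linearised equation. The two equations are the real and the imaginary part. -/
def IsCharacteristicRoot (F : E → E → E) (τ : ℝ) (e : E) (z : ℂ) : Prop :=
  let A := fderiv ℝ (fun x => F x e) e
  let B := fderiv ℝ (fun y => F e y) e
  let s : ℂ := Complex.exp (-z * τ)
  ∃ v w : E, (v ≠ 0 ∨ w ≠ 0) ∧
    z.re • v - z.im • w = A v + (s.re • B v - s.im • B w) ∧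
    z.im • v + z.re • w = A w + (s.im • B v + s.re • B w)

/-- All characteristic roots of the linearisation at `e` lie in the open left half plane. -/
def LinearlyStable (F : E → E → E) (τ : ℝ) (e : E) : Prop :=
  ∀ z : ℂ, IsCharacteristicRoot F τ e z → z.re < 0

end Delay

/-! The fluid models. -/

/-- Case I: one core router. Case II: an edge router followed by a core router.
Case III: one edge router for each flow set, followed by a core router. -/
inductive Topology3
  | caseI
  | caseII
  | caseIII

/-- Round trip times, link capacities and buffer sizes. Case I uses `C`, `B` only, Case II uses
`C₁`, `B₁`, `C₂`, `B₂` only. -/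
structure Network where
  τ₁ : ℝ
  τ₂ : ℝ
  C : ℝ
  C₁ : ℝ
  C₂ : ℝ
  B : ℕ
  B₁ : ℕ
  B₂ : ℕ

structure Network.Positive (n : Network) : Prop where
  τ₁ : 0 < n.τ₁
  τ₂ : 0 < n.τ₂
  C : 0 < n.C
  C₁ : 0 < n.C₁
  C₂ : 0 < n.C₂
  B : 0 < n.B
  B₁ : 0 < n.B₁
  B₂ : 0 < n.B₂

/-- Small-buffer Drop-Tail loss probability at a router of capacity `C` and buffer size `B` that
receives traffic at rate `r`. -/
def dropTailLoss (C : ℝ) (B : ℕ) (r : ℝ) : ℝ := (r / C) ^ B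

namespace Network

variable (n : Network)

def rate (w₁ w₂ : ℝ) : ℝ := w₁ / n.τ₁ + w₂ / n.τ₂

/-- Total loss probability seen by the first set of flows. -/
def loss₁ (T : Topology3) (w₁ w₂ : ℝ) : ℝ :=
  match T with
  | .caseI => dropTailLoss n.C n.B (n.rate w₁ w₂)
  | .caseII => dropTailLoss n.C₁ n.B₁ (n.rate w₁ w₂) + dropTailLoss n.C₂ n.B₂ (n.rate w₁ w₂)
  | .caseIII => dropTailLoss n.C₁ n.B₁ (w₁ / n.τ₁) + dropTailLoss n.C n.B (n.rate w₁ w₂)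

/-- Total loss probability seen by the second set of flows. -/
def loss₂ (T : Topology3) (w₁ w₂ : ℝ) : ℝ :=
  match T with
  | .caseI => dropTailLoss n.C n.B (n.rate w₁ w₂)
  | .caseII => dropTailLoss n.C₁ n.B₁ (n.rate w₁ w₂) + dropTailLoss n.C₂ n.B₂ (n.rate w₁ w₂)
  | .caseIII => dropTailLoss n.C₂ n.B₂ (w₂ / n.τ₂) + dropTailLoss n.C n.B (n.rate w₁ w₂)

end Network

/-- Right-hand side of the fluid equation of one set of Compound TCP flows: current window `w`,
delayed window `wd`, loss probability `L`, increase `α w ^ (k - 1)`, decrease `β w`. -/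
def windowRate (κ α β k τ w wd L : ℝ) : ℝ :=
  κ * (wd / τ) * (α * w ^ (k - 1) * (1 - L) - β * w * L)

/-- The two-flow model; `w₁ w₂` are the current and `v₁ v₂` the delayed windows. -/
def twoFlowRate (κ α β k : ℝ) (n : Network) (T : Topology3) (w₁ w₂ v₁ v₂ : ℝ) : ℝ × ℝ :=
  (windowRate κ α β k n.τ₁ w₁ v₁ (n.loss₁ T v₁ v₂),
    windowRate κ α β k n.τ₂ w₂ v₂ (n.loss₂ T v₁ v₂))

/-- Scenario 2: the delay of the second set of flows is neglected, `w₂(t - τ₂) = w₂(t)`; `x` is the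
state at time `t` and `y` the state at time `t - τ₁`. -/
def scenario2Field (κ α β k : ℝ) (n : Network) (T : Topology3) (x y : ℝ × ℝ) : ℝ × ℝ :=
  twoFlowRate κ α β k n T x.1 x.2 y.1 x.2

/-- Scenario 1: all round trip times, capacities and buffer sizes coincide. -/
def uniformNetwork (τ C : ℝ) (B : ℕ) : Network := ⟨τ, τ, C, C, C, B, B, B⟩

/-- Scenario 1, both sets of flows; `x` is the state at time `t` and `y` the state at
time `t - τ`. -/
def scenario1Field (κ α β k τ C : ℝ) (B : ℕ) (T : Topology3) (x y : ℝ × ℝ) : ℝ × ℝ :=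
  twoFlowRate κ α β k (uniformNetwork τ C B) T x.1 x.2 y.1 y.2

/-- Scenario 1, reduced to a single set of flows that passes through `m` identical routers. -/
def singleFlowField (κ α β k τ C : ℝ) (B m : ℕ) (x y : ℝ) : ℝ :=
  windowRate κ α β k τ x y (m * dropTailLoss C B (y / τ))

/-- Coefficients of the linearised two-flow system. -/
structure LinCoeffs where
  M₁ : ℝ
  M₂ : ℝ
  N₁ : ℝ
  N₂ : ℝ
  P₁ : ℝ
  P₂ : ℝ

namespace Network

variable (n : Network)

/-- Derivative, with respect to the total rate `S`, of the loss at the routers shared by both sets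
of flows. -/
def sharedSlope (T : Topology3) (S : ℝ) : ℝ :=
  match T with
  | .caseI => n.B / n.C ^ n.B * S ^ (n.B - 1)
  | .caseII => n.B₁ / n.C₁ ^ n.B₁ * S ^ (n.B₁ - 1) + n.B₂ / n.C₂ ^ n.B₂ * S ^ (n.B₂ - 1)
  | .caseIII => n.B / n.C ^ n.B * S ^ (n.B - 1)

/-- Contribution to `N_j` of the private edge router of a set of flows (Case III only). -/
def edgeTerm (T : Topology3) (C τ : ℝ) (B : ℕ) (w : ℝ) : ℝ :=
  match T with
  | .caseI => 0
  | .caseII => 0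
  | .caseIII => B / τ * (w / (C * τ)) ^ B

/-- The coefficients `M_j`, `N_j`, `P_j` at the equilibrium `(w₁, w₂)`. -/
def coeffs (α β k : ℝ) (T : Topology3) (w₁ w₂ : ℝ) : LinCoeffs where
  M₁ := -(α / n.τ₁) * (k - 2) * w₁ ^ (k - 1) * (1 - n.loss₁ T w₁ w₂)
  M₂ := -(α / n.τ₂) * (k - 2) * w₂ ^ (k - 1) * (1 - n.loss₂ T w₁ w₂)
  N₁ := (α * w₁ ^ (k - 1) + β * w₁) *
    (edgeTerm T n.C₁ n.τ₁ n.B₁ w₁ + w₁ / n.τ₁ ^ 2 * n.sharedSlope T (n.rate w₁ w₂))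
  N₂ := (α * w₂ ^ (k - 1) + β * w₂) *
    (edgeTerm T n.C₂ n.τ₂ n.B₂ w₂ + w₂ / n.τ₂ ^ 2 * n.sharedSlope T (n.rate w₁ w₂))
  P₁ := (α * w₁ ^ (k - 1) + β * w₁) *
    (w₁ / (n.τ₁ * n.τ₂) * n.sharedSlope T (n.rate w₁ w₂))
  P₂ := (α * w₂ ^ (k - 1) + β * w₂) *
    (w₂ / (n.τ₁ * n.τ₂) * n.sharedSlope T (n.rate w₁ w₂))

end Network

namespace LinCoeffs

variable (f : LinCoeffs)

/-- Right-hand side of the linearised system; `x` is the perturbation at time `t` and `y` the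
perturbation at time `t - τ₁`. -/
def field (κ : ℝ) (x y : ℝ × ℝ) : ℝ × ℝ :=
  (-κ * (f.M₁ * x.1 + f.N₁ * y.1 + f.P₁ * x.2),
    -κ * ((f.M₂ + f.N₂) * x.2 + f.P₂ * y.1))

def a : ℝ := f.M₁ + f.M₂ + f.N₂

def b : ℝ := f.N₁

def c : ℝ := f.M₁ * (f.M₂ + f.N₂)

def d : ℝ := f.N₁ * (f.M₂ + f.N₂) - f.P₁ * f.P₂

/-- The characteristic function. -/
def charFun (κ τ : ℝ) (z : ℂ) : ℂ :=
  z ^ 2 + κ * f.a * z + κ * f.b * z * Complex.exp (-z * τ) + κ ^ 2 * f.c +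
    κ ^ 2 * f.d * Complex.exp (-z * τ)

/-- The quantity `2c - a² + b²`. -/
def D : ℝ := 2 * f.c - f.a ^ 2 + f.b ^ 2

/-- The discriminant `(2c - a² + b²)² - 4 (c² - d²)`. -/
def disc : ℝ := f.D ^ 2 - 4 * (f.c ^ 2 - f.d ^ 2)

/-- Condition 1: there is exactly one positive value of `ω²`. Here `ω² = κ² x`, where
`x² - (2c - a² + b²) x + (c² - d²) = 0` is the equation obtained from `charFun (i ω) = 0` by
taking moduli. -/
def Condition1 : Prop := ∃! x : ℝ, 0 < x ∧ x ^ 2 - f.D * x + (f.c ^ 2 - f.d ^ 2) = 0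

/-- Crossover frequency for `κ = 1`; in general it is `κ A`. -/
def A : ℝ := √(f.D / 2 + √f.disc / 2)

/-- The critical value of `κ`. -/
def κc (τ : ℝ) : ℝ :=
  1 / (f.A * τ) *
    Real.arccos ((f.A ^ 2 * (f.d - f.a * f.b) - f.c * f.d) / (f.b ^ 2 * f.A ^ 2 + f.d ^ 2))

end LinCoeffs

/-- Left-hand side of the single-delay stability condition; `L` is the total loss probability at
equilibrium. -/
def singleDelayLhs (κ α k : ℝ) (B : ℕ) (w L : ℝ) : ℝ :=
  κ * α * w ^ (k - 1) * √((B : ℝ) ^ 2 - ((k - 2) * (1 - L)) ^ 2)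

/-- Right-hand side of the single-delay stability condition. -/
def singleDelayRhs (k : ℝ) (B : ℕ) (L : ℝ) : ℝ := Real.arccos ((k - 2) * (1 - L) / B)

end

/-! Two things have to be shown: where the characteristic roots lie, and that they decide the fate
of the nonlinear equation.

Roots. With `s = z / κ` the characteristic function becomes `p s + q s * exp (-s h)`, `h = κ τ`, so
the gain `κ` acts as a delay (`charFun_eq`, `linear_eq_quasiPoly`). For `h = 0` no root lies in the
closed right half plane. For all `h ≥ 0` the roots there stay in a fixed ball, and roots persist
under small changes of `h`, so an unstable root can only appear through the imaginary axis. On the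
axis `|p| = |q|`, which singles out one frequency `A`; the phase then gives `A h = θ` modulo `2 π`.
Hence all roots are stable for `h < θ / A` (`HasSingleCrossing.re_neg_of_lt`). The direction in
which roots pass through `i A` does not depend on `h`; if it is to the right, unstable roots can
never return, and every `h > θ / A` is unstable (`HasSingleCrossing.exists_re_pos_of_lt`). In
Scenario 2 the crossing speed has the sign of `A² √disc`, and the arccosine is the correct angle
because the sine of the crossing angle is positive (`crossing_im_pos`). In Scenario 1 the
characteristic function is linear plus a delayed constant, or in Case III a product of two such
functions, of which the one with the larger delayed coefficient decides.

Nonlinear equation. The monodromy operator advances a history of the linearised equation by one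
delay. Its nonzero spectrum consists of values `exp (z τ)` with `z` a characteristic root
(`exists_eigenpair_of_mem_spectrum`), and Gelfand's formula turns the spectral radius into growth of
its powers. Consecutive segments of a nonlinear solution follow this operator up to a quadratic
error (`exists_segments`). One discrete shadowing estimate (`exists_norm_sub_pow_le`) then yields
decay when the spectral radius is below `1`, and escape along a dominant eigenvector when it exceeds
`1`. -/

/-! ### Roots of quasipolynomials as the delay varies. -/

open ComplexConjugate in
/-- If `g (s₀, h₀) = 0` and `g` has partial derivatives `a`, `b` with `0 < Re (-b * conj a)`, then the
zeros of `g (·, h)` near `s₀` move to the right as `h` increases through `h₀`. -/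
theorem eventually_re_sign_of_hasFDerivAt {g : ℂ × ℝ → ℂ} {L : ℂ × ℝ →L[ℝ] ℂ} {x₀ : ℂ × ℝ} {a b : ℂ}
    (hg : HasFDerivAt g L x₀) (h0 : g x₀ = 0) (hL : ∀ σ t, L (σ, t) = a * σ + b * (t : ℂ))
    (hab : 0 < (-b * conj a).re) :
    ∀ᶠ x in 𝓝 x₀, g x = 0 →
      (x.2 < x₀.2 → x.1.re < x₀.1.re) ∧ (x₀.2 < x.2 → x₀.1.re < x.1.re) := by
  have ha : 0 < ‖a‖ := by
    rw [norm_pos_iff]; rintro rfl; simp at hab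
  set ρ := (-b * conj a).re with hρ
  -- Differentiability gives `a σ + b t = o(|σ| + |t|)` for the increments `σ`, `t`. The bound `c ≤
  -- ‖a‖ / 2` allows `σ` to be absorbed, so `‖σ‖ ≤ C |t|`. The second bound on `c` makes the error
  -- in `‖a‖² Re σ ≈ ρ t` at most `ρ |t| / 4`.
  set C := 2 * ‖b‖ / ‖a‖ + 1 with hC
  have hCpos : 0 < C := by positivity
  set c := min (‖a‖ / 2) (ρ / (4 * ‖a‖ * (C + 1))) with hc
  have hcpos : 0 < c := by
    apply lt_min <;> positivity
  have h1 := hg.isLittleO.def hcpos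
  filter_upwards [h1] with x hx hgx
  obtain ⟨σ, hσ⟩ : ∃ σ, σ = x.1 - x₀.1 := ⟨_, rfl⟩
  obtain ⟨t, ht⟩ : ∃ t, t = x.2 - x₀.2 := ⟨_, rfl⟩
  have hxx : x - x₀ = (σ, t) := by rw [hσ, ht]; rfl
  rw [hgx, h0, hxx, hL] at hx
  have hx' : ‖a * σ + b * (t : ℂ)‖ ≤ c * (‖σ‖ + |t|) := by
    have h2 : ‖(σ, t)‖ ≤ ‖σ‖ + |t| := by
      rw [Prod.norm_def]
      exact max_le (by simp) (by simp)
    have : ‖a * σ + b * (t : ℂ)‖ = ‖(0 : ℂ) - 0 - (a * σ + b * (t : ℂ))‖ := by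
      rw [sub_zero, zero_sub, norm_neg]
    rw [this]
    exact hx.trans (by gcongr)
  have hσt : ‖σ‖ ≤ C * |t| := by
    have h3 : ‖a‖ * ‖σ‖ ≤ ‖a * σ + b * (t : ℂ)‖ + ‖b‖ * |t| := by
      have : a * σ = (a * σ + b * (t : ℂ)) - b * (t : ℂ) := by ring
      calc ‖a‖ * ‖σ‖ = ‖a * σ‖ := by simp
        _ ≤ _ := by
          rw [this]
          refine (norm_sub_le _ _).trans ?_
          simp
    have h4 : c * (‖σ‖ + |t|) ≤ ‖a‖ / 2 * (‖σ‖ + |t|) := by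
      gcongr; exact min_le_left _ _
    have h5 : ‖a‖ * ‖σ‖ ≤ ‖a‖ * (C * |t|) := by
      have : ‖a‖ * (C * |t|) = 2 * ‖b‖ * |t| + ‖a‖ * |t| := by
        rw [hC]; field_simp
      rw [this]; linarith
    exact le_of_mul_le_mul_left h5 ha
  have hmain : |‖a‖ ^ 2 * σ.re - ρ * t| ≤ ρ / 4 * |t| := by
    have h6 : ‖a‖ ^ 2 * σ.re - ρ * t = (conj a * (a * σ + b * (t : ℂ))).re := by
      have : conj a * (a * σ + b * (t : ℂ)) = (‖a‖ ^ 2 : ℝ) * σ - (-b * conj a) * t := by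
        have := Complex.conj_mul' a
        push_cast
        rw [← this]; ring
      rw [this, Complex.sub_re, Complex.re_ofReal_mul, Complex.re_mul_ofReal]
    rw [h6]
    calc _ ≤ ‖conj a * (a * σ + b * (t : ℂ))‖ := Complex.abs_re_le_norm _
      _ = ‖a‖ * ‖a * σ + b * (t : ℂ)‖ := by simp
      _ ≤ ‖a‖ * (c * (C * |t| + |t|)) := by gcongr; exact hx'.trans (by gcongr)
      _ ≤ ‖a‖ * (ρ / (4 * ‖a‖ * (C + 1)) * (C * |t| + |t|)) := by
        gcongr; exact min_le_right _ _
      _ = ρ / 4 * |t| := by field_simp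
  have hre : x.1.re = x₀.1.re + σ.re := by rw [hσ]; simp
  rw [abs_le] at hmain
  constructor
  · intro hlt
    have htneg : t < 0 := by rw [ht]; linarith
    rw [abs_of_neg htneg] at hmain
    have : ρ * t < 0 := mul_neg_of_pos_of_neg hab htneg
    have : ‖a‖ ^ 2 * σ.re < 0 := by linarith
    have : σ.re < 0 := by
      by_contra hcon
      push Not at hcon
      have := mul_nonneg (sq_nonneg ‖a‖) hcon
      linarith
    linarith
  · intro hlt
    have htpos : 0 < t := by rw [ht]; linarith
    rw [abs_of_pos htpos] at hmain
    have : 0 < ρ * t := mul_pos hab htpos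
    have : 0 < ‖a‖ ^ 2 * σ.re := by linarith
    have : 0 < σ.re := pos_of_mul_pos_right this (sq_nonneg _)
    linarith

/-- The quasipolynomial `p s + q s * exp (-s h)` of a linear equation with delay `h`. -/
noncomputable def quasiPoly (p q : ℂ → ℂ) (h : ℝ) (s : ℂ) : ℂ := p s + q s * Complex.exp (-s * h)

open ComplexConjugate in
/-- The quasipolynomials `p + q exp (-h ·)` have no roots in the closed right half plane for `h = 0`,
and for `h ≥ 0` the only roots they may have on the imaginary axis are `± i A`; this happens for
`A h = θ` modulo `2 π`. -/
structure HasSingleCrossing (p q : ℂ → ℂ) (R A θ : ℝ) : Prop where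
  differentiable_p : Differentiable ℂ p
  differentiable_q : Differentiable ℂ q
  conj_p : ∀ s, p (conj s) = conj (p s)
  conj_q : ∀ s, q (conj s) = conj (q s)
  bound : ∀ s : ℂ, 0 ≤ s.re → ‖p s‖ ≤ ‖q s‖ → ‖s‖ ≤ R
  zero_delay : ∀ s : ℂ, 0 ≤ s.re → p s + q s ≠ 0
  axis : ∀ h y : ℝ, 0 ≤ y → quasiPoly p q h (y * Complex.I) = 0 → y = A
  A_pos : 0 < A
  θ_pos : 0 < θ
  θ_lt : θ < 2 * Real.pi
  q_ne : q (A * Complex.I) ≠ 0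
  root : p (A * Complex.I) + q (A * Complex.I) * Complex.exp (-(θ * Complex.I)) = 0

namespace HasSingleCrossing

open ComplexConjugate

variable {p q : ℂ → ℂ} {R A θ : ℝ}

/-- In the closed right half plane `|exp (-s h)| ≤ 1`, so a root satisfies `‖p s‖ ≤ ‖q s‖`. The
bound is uniform in `h`, which prevents roots from coming in from infinity. -/
theorem norm_le (H : HasSingleCrossing p q R A θ) {h : ℝ} {s : ℂ} (hh : 0 ≤ h) (hs : 0 ≤ s.re)
    (h0 : quasiPoly p q h s = 0) : ‖s‖ ≤ R := by
  apply H.bound s hs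
  have h1 : p s = -(q s * Complex.exp (-s * h)) := eq_neg_of_add_eq_zero_left h0
  rw [h1, norm_neg, norm_mul, Complex.norm_exp]
  apply mul_le_of_le_one_right (norm_nonneg _)
  rw [Real.exp_le_one_iff]
  simp only [Complex.mul_re, Complex.neg_re, Complex.ofReal_re, Complex.neg_im, Complex.ofReal_im,
    mul_zero, sub_zero]
  nlinarith

theorem quasiPoly_conj (H : HasSingleCrossing p q R A θ) (h : ℝ) (s : ℂ) :
    quasiPoly p q h (conj s) = conj (quasiPoly p q h s) := by
  simp only [quasiPoly, map_add, map_mul, H.conj_p, H.conj_q, ← Complex.exp_conj, map_neg,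
    Complex.conj_ofReal]

theorem continuous (H : HasSingleCrossing p q R A θ) :
    Continuous (fun x : ℂ × ℝ => quasiPoly p q x.2 x.1) := by
  have h1 := H.differentiable_p.continuous
  have h2 := H.differentiable_q.continuous
  unfold quasiPoly
  fun_prop

theorem differentiable (H : HasSingleCrossing p q R A θ) (h : ℝ) :
    Differentiable ℂ (quasiPoly p q h) := by
  have h1 := H.differentiable_p
  have h2 := H.differentiable_q
  unfold quasiPoly
  fun_prop

/-- The relation `root` eliminates `p (i A)`, so only the phases have to agree. -/
theorem quasiPoly_axis (H : HasSingleCrossing p q R A θ) {h : ℝ} :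
    quasiPoly p q h (A * Complex.I) = 0 ↔
      Complex.exp (-(θ * Complex.I)) = Complex.exp (-(A * Complex.I) * h) := by
  have h1 : p (A * Complex.I) = -(q (A * Complex.I) * Complex.exp (-(θ * Complex.I))) :=
    eq_neg_of_add_eq_zero_left H.root
  have h2 : quasiPoly p q h (A * Complex.I) = q (A * Complex.I) *
      (Complex.exp (-(A * Complex.I) * h) - Complex.exp (-(θ * Complex.I))) := by
    rw [quasiPoly, h1]; ring
  rw [h2, mul_eq_zero, or_iff_right H.q_ne, sub_eq_zero, eq_comm]

theorem quasiPoly_crossing (H : HasSingleCrossing p q R A θ) :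
    quasiPoly p q (θ / A) (A * Complex.I) = 0 := by
  rw [H.quasiPoly_axis]
  congr 1
  have : (A : ℂ) ≠ 0 := by exact_mod_cast H.A_pos.ne'
  push_cast
  field_simp

/-- A root on the imaginary axis with nonnegative imaginary part is `i A`. -/
theorem eq_of_re_eq_zero (H : HasSingleCrossing p q R A θ) {h : ℝ} {s : ℂ} (hre : s.re = 0)
    (him : 0 ≤ s.im) (h0 : quasiPoly p q h s = 0) : s = A * Complex.I := by
  have hs : s = (s.im : ℂ) * Complex.I := by
    apply Complex.ext <;> simp [hre]
  rw [hs] at h0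
  rw [hs, H.axis h s.im him h0]

/-- No root on the imaginary axis for `h < θ / A`. -/
theorem re_ne_zero (H : HasSingleCrossing p q R A θ) {h : ℝ} {s : ℂ} (hh : 0 ≤ h) (hlt : h < θ / A)
    (h0 : quasiPoly p q h s = 0) : s.re ≠ 0 := by
  intro hre
  wlog him : 0 ≤ s.im generalizing s
  · exact this (s := conj s) (by rw [H.quasiPoly_conj, h0, map_zero]) (by simpa using hre)
      (by simp only [Complex.conj_im]; linarith)
  rw [H.eq_of_re_eq_zero hre him h0, H.quasiPoly_axis, Complex.exp_eq_exp_iff_exists_int] at h0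
  obtain ⟨n, hn⟩ := h0
  have hn' := congrArg Complex.im hn
  simp only [Complex.neg_im, Complex.mul_im, Complex.ofReal_re, Complex.I_im, mul_one,
    Complex.ofReal_im, Complex.I_re, mul_zero, add_zero, Complex.neg_re, Complex.mul_re, zero_mul,
    sub_zero, Complex.add_im, Complex.intCast_re, Complex.re_ofNat, Complex.im_ofNat,
    Complex.intCast_im, sub_self, neg_zero, zero_add] at hn'
  -- The phases give `2 π n = A h - θ`, which lies strictly between `-2 π` and `0`.
  have h1 : A * h < θ := by rw [lt_div_iff₀ H.A_pos] at hlt; linarith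
  have h2 : 0 ≤ A * h := mul_nonneg H.A_pos.le hh
  have h3 := H.θ_lt
  have hpi := Real.pi_pos
  have h4 : (n : ℝ) * (2 * Real.pi) < 0 := by linarith
  have h5 : -(2 * Real.pi) < (n : ℝ) * (2 * Real.pi) := by linarith
  have h6 : (n : ℝ) < 0 := by nlinarith
  have h7 : (-1 : ℝ) < n := by nlinarith
  have h8 : n < 0 := by exact_mod_cast h6
  have h9 : -1 < n := by exact_mod_cast h7
  omega

/-- Roots persist under small changes of the delay. -/
theorem eventually_exists_root (H : HasSingleCrossing p q R A θ) {h₀ : ℝ} {s₀ : ℂ} (hh : 0 ≤ h₀)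
    (h0 : quasiPoly p q h₀ s₀ = 0) {ε : ℝ} (hε : 0 < ε) :
    ∀ᶠ h in 𝓝 h₀, ∃ s, ‖s - s₀‖ < ε ∧ quasiPoly p q h s = 0 := by
  have han : ∀ h, AnalyticOnNhd ℂ (quasiPoly p q h) univ := fun h =>
    (H.differentiable h).differentiableOn.analyticOnNhd isOpen_univ
  obtain ⟨r, hr, hrε, hne⟩ : ∃ r, 0 < r ∧ r < ε ∧
      ∀ z ∈ Metric.sphere s₀ r, quasiPoly p q h₀ z ≠ 0 := by
    -- Zeros of an analytic function are isolated unless it vanishes identically, and the latter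
    -- would contradict the bound `R` on roots in the right half plane.
    rcases (han h₀ s₀ (mem_univ _)).eventually_eq_zero_or_eventually_ne_zero with h1 | h1
    · exfalso
      have h2 : EqOn (quasiPoly p q h₀) 0 univ :=
        (han h₀).eqOn_zero_of_preconnected_of_eventuallyEq_zero isPreconnected_univ (mem_univ _) h1
      have hR : ‖((|R| + 1 : ℝ) : ℂ)‖ ≤ R :=
        H.norm_le hh (by rw [Complex.ofReal_re]; positivity) (h2 (mem_univ _))
      rw [Complex.norm_real, Real.norm_eq_abs] at hR
      have := le_abs_self (|R| + 1)
      have := le_abs_self R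
      linarith
    · rw [eventually_nhdsWithin_iff, Metric.eventually_nhds_iff] at h1
      obtain ⟨δ, hδ, h1⟩ := h1
      refine ⟨min δ ε / 2, by positivity, ?_, fun z hz => h1 ?_ ?_⟩
      · linarith [min_le_right δ ε, lt_min hδ hε]
      · rw [Metric.mem_sphere] at hz
        rw [hz]
        linarith [min_le_left δ ε, lt_min hδ hε]
      · rintro rfl
        rw [Metric.mem_sphere, dist_self] at hz
        have := lt_min hδ hε
        linarith
  have hcont : Continuous (quasiPoly p q h₀) := (H.differentiable h₀).continuous
  have hK := isCompact_sphere s₀ r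
  obtain ⟨m, hm, hmle⟩ : ∃ m > 0, ∀ z ∈ Metric.sphere s₀ r, m < ‖quasiPoly p q h₀ z‖ := by
    have hne' : (Metric.sphere s₀ r).Nonempty := (NormedSpace.sphere_nonempty).2 hr.le
    obtain ⟨z₁, hz₁, hmin⟩ := hK.exists_isMinOn hne' hcont.norm.continuousOn
    refine ⟨‖quasiPoly p q h₀ z₁‖ / 2, ?_, fun z hz => ?_⟩
    · have := norm_pos_iff.2 (hne z₁ hz₁); positivity
    · have h3 := norm_pos_iff.2 (hne z₁ hz₁)
      have h4 : ‖quasiPoly p q h₀ z₁‖ ≤ ‖quasiPoly p q h₀ z‖ := hmin hz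
      linarith
  have hc1 : Continuous fun x : ℝ × ℂ => ‖quasiPoly p q x.1 x.2 - quasiPoly p q x.1 s₀‖ :=
    ((H.continuous.comp continuous_swap).sub
      (H.continuous.comp (continuous_const.prodMk continuous_fst))).norm
  have e1 : ∀ᶠ h in 𝓝 h₀, ∀ z ∈ Metric.sphere s₀ r,
      m < ‖quasiPoly p q h z - quasiPoly p q h s₀‖ := by
    apply hK.eventually_forall_of_forall_eventually
    intro z hz
    have := hc1.continuousAt (x := (h₀, z))
    apply this.eventually (lt_mem_nhds _)
    simp only [h0, sub_zero]
    exact hmle z hz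
  have hc2 : Continuous fun h : ℝ => ‖quasiPoly p q h s₀‖ :=
    (H.continuous.comp (continuous_const.prodMk continuous_id)).norm
  have e2 : ∀ᶠ h in 𝓝 h₀, ‖quasiPoly p q h s₀‖ < m / 2 := by
    apply hc2.continuousAt.eventually (gt_mem_nhds _)
    simp only [h0, norm_zero]; positivity
  filter_upwards [e1, e2] with h h1 h2
  -- Quantitative open mapping theorem: the values on the sphere differ from the central value by at
  -- least `m`, so the image of the closed ball contains the ball of radius `m / 2` about the
  -- central value, and hence `0`. The remaining side goal is that the function is not constant near
  -- `s₀`.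
  have hsub := DiffContOnCl.ball_subset_image_closedBall (f := quasiPoly p q h) (z₀ := s₀)
    (ε := m) (H.differentiable h).diffContOnCl hr (fun z hz => (h1 z hz).le) ?_
  · obtain ⟨s, hs, hs0⟩ := hsub (show (0 : ℂ) ∈ _ by
      rw [Metric.mem_ball, dist_comm, dist_zero_right]; exact h2)
    refine ⟨s, ?_, hs0⟩
    rw [Metric.mem_closedBall, dist_eq_norm] at hs
    linarith
  · intro hcon
    simp only [not_not] at hcon
    have h3 : EqOn (quasiPoly p q h) (fun _ => quasiPoly p q h s₀) univ :=
      (han h).eqOn_of_preconnected_of_eventuallyEq analyticOnNhd_const isPreconnected_univ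
        (mem_univ s₀) hcon
    obtain ⟨z, hz⟩ : (Metric.sphere s₀ r).Nonempty := (NormedSpace.sphere_nonempty).2 hr.le
    have h4 := h1 z hz
    rw [h3 (mem_univ z), sub_self, norm_zero] at h4
    linarith

theorem isCompact_roots (H : HasSingleCrossing p q R A θ) {a b : ℝ} (ha : 0 ≤ a) :
    IsCompact {x : ℂ × ℝ | 0 ≤ x.1.re ∧ x.2 ∈ Icc a b ∧ quasiPoly p q x.2 x.1 = 0} := by
  refine IsCompact.of_isClosed_subset
    ((isCompact_closedBall (0 : ℂ) R).prod (isCompact_Icc (a := a) (b := b))) ?_ ?_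
  · exact (isClosed_le continuous_const (Complex.continuous_re.comp continuous_fst)).inter
      ((isClosed_Icc.preimage continuous_snd).inter (isClosed_eq H.continuous continuous_const))
  · rintro x ⟨h1, h2, h3⟩
    exact ⟨by simpa using H.norm_le (ha.trans h2.1) h1 h3, h2⟩

/-- Stability for delays below the first crossing. -/
theorem re_neg_of_lt (H : HasSingleCrossing p q R A θ) {h : ℝ} (hh : 0 ≤ h) (hlt : h < θ / A)
    {s : ℂ} (h0 : quasiPoly p q h s = 0) : s.re < 0 := by
  by_contra hcon
  push Not at hcon
  have hK := H.isCompact_roots (a := 0) (b := h) le_rfl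
  have hK' := hK.image continuous_snd
  have hmem : h ∈ Prod.snd '' {x : ℂ × ℝ | 0 ≤ x.1.re ∧ x.2 ∈ Icc 0 h ∧ quasiPoly p q x.2 x.1 = 0} :=
    ⟨(s, h), ⟨hcon, ⟨hh, le_rfl⟩, h0⟩, rfl⟩
  -- The smallest delay `h₁` with a root in the closed right half plane. Its root `s₁` is off the
  -- axis, so it persists for slightly smaller delays, contradicting minimality.
  obtain ⟨_, ⟨⟨s₁, h₁⟩, ⟨hs₁, hI, hr⟩, rfl⟩, hleast⟩ := hK'.exists_isLeast ⟨h, hmem⟩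
  simp only at hs₁ hI hr hleast
  have hlt₁ := hI.2.trans_lt hlt
  have hpos : 0 < s₁.re := lt_of_le_of_ne hs₁ (H.re_ne_zero hI.1 hlt₁ hr).symm
  have hne : 0 < h₁ := by
    refine lt_of_le_of_ne hI.1 fun h2 => ?_
    rw [← h2] at hr
    apply H.zero_delay s₁ hs₁
    simpa [quasiPoly] using hr
  have h3 := H.eventually_exists_root hI.1 hr hpos
  have h4 : ∀ᶠ h' in 𝓝[<] h₁, (∃ s, ‖s - s₁‖ < s₁.re ∧ quasiPoly p q h' s = 0) ∧
      h' ∈ Ioo 0 h₁ :=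
    (h3.filter_mono nhdsWithin_le_nhds).and (Ioo_mem_nhdsLT hne)
  obtain ⟨h', ⟨s', hs', hr'⟩, hI'⟩ := h4.exists
  have h5 : 0 ≤ s'.re := by
    have := (Complex.abs_re_le_norm (s' - s₁)).trans_lt hs'
    rw [abs_lt, Complex.sub_re] at this
    linarith [this.1]
  have := hleast ⟨(s', h'), ⟨h5, ⟨hI'.1.le, hI'.2.le.trans hI.2⟩, hr'⟩, rfl⟩
  simp only at this
  exact absurd hI'.2 (not_lt.2 this)

/-- Roots near `i A` move to the right as the delay increases. -/
theorem eventually_sign (H : HasSingleCrossing p q R A θ) {p' q' : ℂ}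
    (hp : HasDerivAt p p' (A * Complex.I)) (hq : HasDerivAt q q' (A * Complex.I))
    (htr : 0 < (-(A * Complex.I) * p (A * Complex.I) * conj (p' + q' *
      Complex.exp (-(θ * Complex.I)))).re)
    {h : ℝ} (h0 : quasiPoly p q h (A * Complex.I) = 0) :
    ∀ᶠ x : ℂ × ℝ in 𝓝 ((A * Complex.I : ℂ), h), quasiPoly p q x.2 x.1 = 0 →
      (x.2 < h → x.1.re < 0) ∧ (h < x.2 → 0 < x.1.re) := by
  set s₀ : ℂ := A * Complex.I with hs₀
  set E := Complex.exp (-(θ * Complex.I)) with hE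
  have hE' : Complex.exp (-s₀ * h) = E := (H.quasiPoly_axis.1 h0).symm
  have hE'' : Complex.exp (-(s₀ * h)) = E := by rw [← neg_mul, hE']
  have hroot := H.root
  rw [← hE, ← hs₀] at hroot
  have d1 : HasFDerivAt (fun x : ℂ × ℝ => p x.1) _ (s₀, h) :=
    (hp.hasFDerivAt.restrictScalars ℝ).comp (s₀, h) (hasFDerivAt_fst (𝕜 := ℝ))
  have d2 : HasFDerivAt (fun x : ℂ × ℝ => q x.1) _ (s₀, h) :=
    (hq.hasFDerivAt.restrictScalars ℝ).comp (s₀, h) (hasFDerivAt_fst (𝕜 := ℝ))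
  have d3 : HasFDerivAt (fun x : ℂ × ℝ => ((x.2 : ℝ) : ℂ)) _ (s₀, h) :=
    Complex.ofRealCLM.hasFDerivAt.comp (s₀, h) (hasFDerivAt_snd (𝕜 := ℝ))
  have d4 : HasFDerivAt (fun x : ℂ × ℝ => -x.1) _ (s₀, h) := (hasFDerivAt_fst (𝕜 := ℝ)).neg
  have d5 := d1.add (d2.mul (d4.mul d3).cexp)
  have key := eventually_re_sign_of_hasFDerivAt (g := fun x => quasiPoly p q x.2 x.1)
    (a := p' + q' * E - h * (q s₀ * E)) (b := -s₀ * (q s₀ * E)) d5 h0 ?_ ?_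
  · have hre : s₀.re = 0 := by simp [hs₀]
    simpa only [hre] using key
  · intro σ t
    simp [hE'']
    ring
  · have hqE : q s₀ * E = -p s₀ := by linear_combination hroot
    rw [hqE]
    -- The delay enters the crossing direction only through `-i A h ‖p s₀‖²`, which is purely
    -- imaginary. The sign is therefore the same at every crossing.
    have hc : -(-s₀ * -p s₀) * conj (p' + q' * E - h * -p s₀) =
        -s₀ * p s₀ * conj (p' + q' * E) + ((-(A * h * ‖p s₀‖ ^ 2) : ℝ) : ℂ) * Complex.I := by
      have h1 := Complex.mul_conj' (p s₀)
      simp only [map_add, map_sub, map_mul, map_neg, Complex.conj_ofReal]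
      push_cast
      rw [← h1, hs₀]
      ring
    rw [hc, Complex.add_re, Complex.re_ofReal_mul, Complex.I_re, mul_zero, add_zero]
    exact htr

/-- Instability for all delays beyond the first crossing. -/
theorem exists_re_pos_of_lt (H : HasSingleCrossing p q R A θ) {p' q' : ℂ}
    (hp : HasDerivAt p p' (A * Complex.I)) (hq : HasDerivAt q q' (A * Complex.I))
    (htr : 0 < (-(A * Complex.I) * p (A * Complex.I) * conj (p' + q' *
      Complex.exp (-(θ * Complex.I)))).re)
    {h : ℝ} (hlt : θ / A < h) : ∃ s : ℂ, 0 < s.re ∧ quasiPoly p q h s = 0 := by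
  by_contra hcon
  set h₀ := θ / A with hh₀
  have h₀pos : 0 < h₀ := div_pos H.θ_pos H.A_pos
  set U : Set ℝ := {h | ∃ s : ℂ, 0 < s.re ∧ quasiPoly p q h s = 0} with hU
  have hUopen : ∀ h₁ ∈ U, 0 ≤ h₁ → ∀ᶠ h' in 𝓝 h₁, h' ∈ U := by
    rintro h₁ ⟨s, hs, hr⟩ hh₁
    filter_upwards [H.eventually_exists_root hh₁ hr hs] with h' ⟨s', hs', hr'⟩
    refine ⟨s', ?_, hr'⟩
    have := (Complex.abs_re_le_norm (s' - s)).trans_lt hs'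
    rw [abs_lt, Complex.sub_re] at this
    linarith [this.1]
  obtain ⟨h₁, hh₁, hh₁U⟩ : ∃ h₁ ∈ Ioo h₀ h, h₁ ∈ U := by
    have h1 := H.eventually_sign hp hq htr H.quasiPoly_crossing
    rw [← hh₀, nhds_prod_eq] at h1
    obtain ⟨u, hu, v, hv, huv⟩ := Filter.mem_prod_iff.1 h1
    obtain ⟨ε, hε, hball⟩ := Metric.mem_nhds_iff.1 hu
    have h2 := H.eventually_exists_root h₀pos.le H.quasiPoly_crossing hε
    have h3 : ∀ᶠ h' in 𝓝[>] h₀, ((∃ s, ‖s - A * Complex.I‖ < ε ∧ quasiPoly p q h' s = 0) ∧ h' ∈ v) ∧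
        h' ∈ Ioo h₀ h :=
      ((h2.and hv).filter_mono nhdsWithin_le_nhds).and (Ioo_mem_nhdsGT hlt)
    obtain ⟨h', ⟨⟨s, hs, hr⟩, hv'⟩, hI⟩ := h3.exists
    refine ⟨h', hI, s, ?_, hr⟩
    have hm : (s, h') ∈ u ×ˢ v := ⟨hball (by rwa [Metric.mem_ball, dist_eq_norm]), hv'⟩
    exact (huv hm hr).2 hI.1
  set T : Set ℝ := {h' | h' ∈ Ioo h₀ h ∧ h' ∈ U} with hT
  have hTne : T.Nonempty := ⟨h₁, hh₁, hh₁U⟩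
  have hTbdd : BddAbove T := ⟨h, fun x hx => hx.1.2.le⟩
  set h₂ := sSup T with hh₂
  have h₁₂ : h₁ ≤ h₂ := le_csSup hTbdd ⟨hh₁, hh₁U⟩
  have h₂h : h₂ ≤ h := csSup_le hTne fun x hx => hx.1.2.le
  -- Delays with an unstable root form an open set, so the supremum `h₂` of those in the interval
  -- cannot belong to it.
  have h₂U : h₂ ∉ U := by
    intro h₂U
    rcases h₂h.eq_or_lt with heq | hlt₂
    · exact hcon (heq ▸ h₂U)
    · have h3 : ∀ᶠ h' in 𝓝[>] h₂, h' ∈ U ∧ h' ∈ Ioo h₂ h :=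
        ((hUopen h₂ h₂U (by linarith [hh₁.1])).filter_mono nhdsWithin_le_nhds).and
          (Ioo_mem_nhdsGT hlt₂)
      obtain ⟨h', hU', hI'⟩ := h3.exists
      have : h' ≤ h₂ := le_csSup hTbdd ⟨⟨by linarith [hh₁.1, hI'.1], hI'.2⟩, hU'⟩
      exact absurd hI'.1 (not_lt.2 this)
  -- Unstable roots at delays increasing to `h₂` accumulate, by compactness, at a root for `h₂` with
  -- nonnegative real part. As `h₂ ∉ U` it lies on the axis, hence is `i A`. But roots near `i A` at
  -- delays below `h₂` have negative real part.
  obtain ⟨u, -, hu, huT⟩ := exists_seq_tendsto_sSup hTne hTbdd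
  rw [← hh₂] at hu
  have hroots : ∀ n, ∃ s : ℂ, 0 < s.re ∧ 0 ≤ s.im ∧ quasiPoly p q (u n) s = 0 := by
    intro n
    obtain ⟨s, hs, hr⟩ := (huT n).2
    rcases le_total 0 s.im with him | him
    · exact ⟨s, hs, him, hr⟩
    · exact ⟨conj s, by simpa using hs, by simpa using him, by
        rw [H.quasiPoly_conj, hr, map_zero]⟩
  choose s hs him hr using hroots
  have hmemK : ∀ n, (s n, u n) ∈
      {x : ℂ × ℝ | 0 ≤ x.1.re ∧ x.2 ∈ Icc 0 h ∧ quasiPoly p q x.2 x.1 = 0} := fun n =>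
    ⟨(hs n).le, ⟨h₀pos.le.trans (huT n).1.1.le, (huT n).1.2.le⟩, hr n⟩
  obtain ⟨⟨s', h'⟩, hK', φ, hφ, hlim⟩ := (H.isCompact_roots (b := h) le_rfl).tendsto_subseq hmemK
  have hlim2 : Tendsto (fun n => u (φ n)) atTop (𝓝 h') :=
    (continuous_snd.tendsto _).comp hlim
  have hlim1 : Tendsto (fun n => s (φ n)) atTop (𝓝 s') :=
    (continuous_fst.tendsto _).comp hlim
  have hh' : h' = h₂ := tendsto_nhds_unique hlim2 (hu.comp hφ.tendsto_atTop)
  subst hh'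
  have him' : 0 ≤ s'.im := ge_of_tendsto' ((Complex.continuous_im.tendsto _).comp hlim1)
    fun n => him _
  have hre' : s'.re = 0 := by
    by_contra hne
    exact h₂U ⟨s', lt_of_le_of_ne hK'.1 (Ne.symm hne), hK'.2.2⟩
  have hs' := H.eq_of_re_eq_zero hre' him' hK'.2.2
  subst hs'
  have hev := hlim.eventually (H.eventually_sign hp hq htr hK'.2.2)
  obtain ⟨n, hn⟩ := hev.exists
  have h5 : u (φ n) < h₂ := lt_of_le_of_ne (le_csSup hTbdd (huT _)) fun heq =>
    h₂U (heq ▸ (huT (φ n)).2)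
  exact absurd ((hn (hr _)).1 h5) (not_lt.2 (hs _).le)

end HasSingleCrossing

/-! ### Complexification of real delay equations. -/

/-- Data exhibiting the complex normed space `V` as a complexification of the real normed
space `E`. -/
structure Complexification (E V : Type*) [NormedAddCommGroup E] [NormedSpace ℝ E]
    [NormedAddCommGroup V] [NormedSpace ℂ V] where
  ι : E →L[ℝ] V
  re : V →L[ℝ] E
  im : V →L[ℝ] E
  re_ι : ∀ x, re (ι x) = x
  im_ι : ∀ x, im (ι x) = 0
  re_I_smul : ∀ v, re (Complex.I • v) = -im v
  im_I_smul : ∀ v, im (Complex.I • v) = re v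
  ι_re_add : ∀ v, ι (re v) + Complex.I • ι (im v) = v
  norm_ι : ∀ x, ‖ι x‖ = ‖x‖
  norm_re : ∀ v, ‖re v‖ ≤ ‖v‖

namespace Complexification

variable {E V : Type*} [NormedAddCommGroup E] [NormedSpace ℝ E]
    [NormedAddCommGroup V] [NormedSpace ℂ V] (c : Complexification E V)

/-- The complex linear extension of a real linear map. -/
noncomputable def map (A : E →L[ℝ] E) : V →L[ℂ] V where
  toFun v := c.ι (A (c.re v)) + Complex.I • c.ι (A (c.im v))
  map_add' v w := by simp only [map_add, smul_add]; abel
  map_smul' z v := by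
    have hI : Complex.I * Complex.I = -1 := Complex.I_mul_I
    have hz : ∀ w : V, z • w = z.re • w + z.im • (Complex.I • w) := fun w => by
      conv_lhs => rw [← Complex.re_add_im z]
      rw [add_smul, mul_smul, Complex.coe_smul, Complex.coe_smul]
    have hc : ∀ (r : ℝ) (w : V), Complex.I • r • w = r • Complex.I • w := fun r w =>
      smul_comm _ _ _
    have hII : ∀ w : V, Complex.I • Complex.I • w = -w := fun w => by
      rw [smul_smul, hI, neg_smul, one_smul]
    rw [RingHom.id_apply, hz v, hz (_ + _)]
    simp only [map_add, map_smul, c.re_I_smul, c.im_I_smul, map_neg, smul_add, smul_neg, hc, hII]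
    abel
  cont := by fun_prop

theorem map_apply (A : E →L[ℝ] E) (v : V) :
    c.map A v = c.ι (A (c.re v)) + Complex.I • c.ι (A (c.im v)) := rfl

theorem map_ι (A : E →L[ℝ] E) (x : E) : c.map A (c.ι x) = c.ι (A x) := by
  simp [map_apply, c.re_ι, c.im_ι]

theorem re_map (A : E →L[ℝ] E) (v : V) : c.re (c.map A v) = A (c.re v) := by
  simp [map_apply, c.re_ι, c.im_ι, c.re_I_smul]

theorem im_map (A : E →L[ℝ] E) (v : V) : c.im (c.map A v) = A (c.im v) := by
  simp [map_apply, c.re_ι, c.im_ι, c.im_I_smul]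

theorem re_smul (z : ℂ) (v : V) : c.re (z • v) = z.re • c.re v - z.im • c.im v := by
  conv_lhs => rw [← Complex.re_add_im z, add_smul, mul_smul, Complex.coe_smul, Complex.coe_smul,
    map_add, map_smul, map_smul, c.re_I_smul, smul_neg, ← sub_eq_add_neg]

theorem im_smul (z : ℂ) (v : V) : c.im (z • v) = z.im • c.re v + z.re • c.im v := by
  conv_lhs => rw [← Complex.re_add_im z, add_smul, mul_smul, Complex.coe_smul, Complex.coe_smul,
    map_add, map_smul, map_smul, c.im_I_smul, add_comm]

theorem ext_iff {v w : V} : v = w ↔ c.re v = c.re w ∧ c.im v = c.im w := by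
  constructor
  · rintro rfl; exact ⟨rfl, rfl⟩
  · rintro ⟨h1, h2⟩
    rw [← c.ι_re_add v, h1, h2, c.ι_re_add]

theorem norm_le_re_add_im (v : V) : ‖v‖ ≤ ‖c.re v‖ + ‖c.im v‖ := by
  conv_lhs => rw [← c.ι_re_add v]
  refine (norm_add_le _ _).trans ?_
  rw [norm_smul, Complex.norm_I, one_mul, c.norm_ι, c.norm_ι]

/-- The characteristic equation in complex form. -/
theorem isCharacteristicRoot_iff {F : E → E → E} {τ : ℝ} {e : E} {L : E × E →L[ℝ] E}
    (hF : HasFDerivAt (fun p : E × E => F p.1 p.2) L (e, e)) (z : ℂ) :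
    IsCharacteristicRoot F τ e z ↔ ∃ v : V, v ≠ 0 ∧
      z • v = c.map (L.comp (.inl ℝ E E)) v +
        Complex.exp (-z * τ) • c.map (L.comp (.inr ℝ E E)) v := by
  have hA : fderiv ℝ (fun x => F x e) e = L.comp (.inl ℝ E E) :=
    (HasFDerivAt.comp (g := fun p : E × E => F p.1 p.2) (f := fun x => (x, e)) e hF
      (hasFDerivAt_prodMk_left e e)).fderiv
  have hB : fderiv ℝ (fun y => F e y) e = L.comp (.inr ℝ E E) :=
    (HasFDerivAt.comp (g := fun p : E × E => F p.1 p.2) (f := fun y => (e, y)) e hF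
      (hasFDerivAt_prodMk_right e e)).fderiv
  simp only [IsCharacteristicRoot, hA, hB]
  have key : ∀ v : V, z • v = c.map (L.comp (.inl ℝ E E)) v +
        Complex.exp (-z * τ) • c.map (L.comp (.inr ℝ E E)) v ↔ _ := fun v => c.ext_iff
  simp only [key, c.re_smul, c.im_smul, map_add, c.re_map, c.im_map]
  constructor
  · rintro ⟨v, w, hne, h1, h2⟩
    have hr : c.re (c.ι v + Complex.I • c.ι w) = v := by simp [c.re_ι, c.im_ι, c.re_I_smul]
    have hi : c.im (c.ι v + Complex.I • c.ι w) = w := by simp [c.re_ι, c.im_ι, c.im_I_smul]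
    refine ⟨c.ι v + Complex.I • c.ι w, ?_, ?_, ?_⟩
    · intro h0
      rw [h0] at hr hi
      simp only [map_zero] at hr hi
      rcases hne with h | h
      · exact h hr.symm
      · exact h hi.symm
    · rw [hr, hi]; exact h1
    · rw [hr, hi]; exact h2
  · rintro ⟨v, hv, h1, h2⟩
    refine ⟨c.re v, c.im v, ?_, h1, h2⟩
    by_contra hcon
    push Not at hcon
    apply hv
    rw [c.ext_iff, hcon.1, hcon.2, map_zero, map_zero]
    exact ⟨rfl, rfl⟩

end Complexification

/-- `ℂ` as the complexification of `ℝ`. -/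
noncomputable def Complexification.real : Complexification ℝ ℂ where
  ι := Complex.ofRealCLM
  re := Complex.reCLM
  im := Complex.imCLM
  re_ι := by simp
  im_ι := by simp
  re_I_smul := by simp
  im_I_smul := by simp
  ι_re_add v := by
    simp only [Complex.ofRealCLM_apply, Complex.reCLM_apply, Complex.imCLM_apply, smul_eq_mul]
    rw [mul_comm, Complex.re_add_im]
  norm_ι := by simp
  norm_re := Complex.abs_re_le_norm

/-- `ℂ × ℂ` as the complexification of `ℝ × ℝ`. -/
noncomputable def Complexification.realProd : Complexification (ℝ × ℝ) (ℂ × ℂ) where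
  ι := Complex.ofRealCLM.prodMap Complex.ofRealCLM
  re := Complex.reCLM.prodMap Complex.reCLM
  im := Complex.imCLM.prodMap Complex.imCLM
  re_ι := by simp
  im_ι := by simp
  re_I_smul := by simp
  im_I_smul := by simp
  ι_re_add v := by
    ext : 1
    · exact Complexification.real.ι_re_add v.1
    · exact Complexification.real.ι_re_add v.2
  norm_ι := by simp [Prod.norm_def]
  norm_re v := max_le_max (Complex.abs_re_le_norm v.1) (Complex.abs_re_le_norm v.2)

/-! ### Linear differential equations: Gronwall bounds and variation of constants. -/

/-- Lets the size of the history, or its square, be pulled out of Gronwall estimates. -/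
theorem gronwallBound_mul (c δ K ε x : ℝ) :
    gronwallBound (c * δ) K (c * ε) x = c * gronwallBound δ K ε x := by
  unfold gronwallBound
  split_ifs <;> ring

theorem gronwallBound_nonneg {δ K ε x : ℝ} (hδ : 0 ≤ δ) (hK : 0 ≤ K) (hε : 0 ≤ ε) (hx : 0 ≤ x) :
    0 ≤ gronwallBound δ K ε x := by
  have h := gronwallBound_mono hδ hε hK hx
  rw [gronwallBound_x0] at h
  exact hδ.trans h

section Duhamel

variable {V : Type*} [NormedAddCommGroup V] [NormedSpace ℂ V]

/-- Variation of constants: the solution of `u' = A u + g`, `u 0 = y`. -/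
noncomputable def duhamel (A : V →L[ℂ] V) (g : ℝ → V) (y : V) (t : ℝ) : V :=
  NormedSpace.exp (t • A) (y + ∫ s in (0 : ℝ)..t, NormedSpace.exp (s • -A) (g s))

theorem duhamel_zero (A : V →L[ℂ] V) (g : ℝ → V) (y : V) : duhamel A g y 0 = y := by
  simp [duhamel]

theorem hasDerivAt_clm_apply {f : ℝ → V →L[ℂ] V} {f' : V →L[ℂ] V} {y : ℝ → V} {y' : V} {t : ℝ}
    (hf : HasDerivAt f f' t) (hy : HasDerivAt y y' t) :
    HasDerivAt (fun s => f s (y s)) (f' (y t) + f t y') t := by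
  have h := ((isBoundedBilinearMap_apply (𝕜 := ℂ) (E := V) (F := V)).hasFDerivAt
    (f t, y t)).restrictScalars ℝ |>.comp_hasDerivAt t (hf.prodMk hy)
  simp at h
  rw [add_comm]
  exact h

theorem eqOn_of_linear_ode (A : V →L[ℂ] V) {g u v : ℝ → V} {a b : ℝ}
    (hu : ContinuousOn u (Icc a b))
    (hu' : ∀ t ∈ Ico a b, HasDerivWithinAt u (A (u t) + g t) (Ici t) t)
    (hv : ContinuousOn v (Icc a b))
    (hv' : ∀ t ∈ Ico a b, HasDerivWithinAt v (A (v t) + g t) (Ici t) t)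
    (h0 : u a = v a) : EqOn u v (Icc a b) :=
  ODE_solution_unique (v := fun t x => A x + g t) (K := ‖A‖₊)
    (fun t => LipschitzWith.of_dist_le_mul fun x y => by
      rw [dist_add_right]; exact A.lipschitz.dist_le_mul x y) hu hu' hv hv' h0

variable [CompleteSpace V]

theorem continuous_exp_smul (A : V →L[ℂ] V) :
    Continuous fun s : ℝ => NormedSpace.exp (s • A) :=
  continuous_iff_continuousAt.2 fun t => (hasDerivAt_exp_smul_const A t).continuousAt

/-- Since `exp (t A)` stands outside the integral, the product rule and the fundamental theorem of
calculus suffice; the integrand does not depend on `t`. -/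
theorem hasDerivAt_duhamel (A : V →L[ℂ] V) {g : ℝ → V} (hg : Continuous g) (y : V) (t : ℝ) :
    HasDerivAt (duhamel A g y) (A (duhamel A g y t) + g t) t := by
  have hc : Continuous fun s : ℝ => NormedSpace.exp (s • -A) (g s) :=
    (isBoundedBilinearMap_apply (𝕜 := ℂ) (E := V) (F := V)).continuous.comp
      ((continuous_exp_smul (-A)).prodMk hg)
  have h1 : HasDerivAt (fun t => y + ∫ s in (0 : ℝ)..t, NormedSpace.exp (s • -A) (g s))
      (NormedSpace.exp (t • -A) (g t)) t :=
    (hc.integral_hasStrictDerivAt 0 t).hasDerivAt.const_add y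
  have h2 := hasDerivAt_clm_apply (hasDerivAt_exp_smul_const' A t) h1
  have h3 : NormedSpace.exp (t • A) * NormedSpace.exp (t • -A) = 1 := by
    rw [smul_neg, ← NormedSpace.exp_add_of_commute_of_mem_ball (𝕂 := ℂ)]
    · rw [add_neg_cancel, NormedSpace.exp_zero]
    · exact (Commute.refl _).neg_right
    · rw [NormedSpace.expSeries_radius_eq_top]; simp
    · rw [NormedSpace.expSeries_radius_eq_top]; simp
  have h4 : NormedSpace.exp (t • A) (NormedSpace.exp (t • -A) (g t)) = g t :=
    congrArg (fun T : V →L[ℂ] V => T (g t)) h3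
  rw [h4] at h2
  exact h2

theorem continuous_duhamel (A : V →L[ℂ] V) {g : ℝ → V} (hg : Continuous g) (y : V) :
    Continuous (duhamel A g y) :=
  continuous_iff_continuousAt.2 fun t => (hasDerivAt_duhamel A hg y t).continuousAt

/-- Both sides solve `u' = A u` with initial value `v`. -/
theorem exp_smul_apply_of_eigenvector {A : V →L[ℂ] V} {z : ℂ} {v : V} (h : A v = z • v) {t : ℝ}
    (ht : 0 ≤ t) : NormedSpace.exp (t • A) v = Complex.exp (z * t) • v := by
  have h1 : duhamel A (fun _ => 0) v t = NormedSpace.exp (t • A) v := by simp [duhamel]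
  rw [← h1]
  have hd : ∀ s : ℝ, HasDerivAt (fun s : ℝ => Complex.exp (z * s) • v)
      (A (Complex.exp (z * s) • v) + 0) s := by
    intro s
    have h2 : HasDerivAt (fun s : ℝ => Complex.exp (z * s)) (Complex.exp (z * s) * (z * 1)) s :=
      ((Complex.ofRealCLM.hasDerivAt (x := s)).const_mul z).cexp
    convert h2.smul_const v using 1
    rw [add_zero, map_smul, h, smul_smul, mul_one]
  have hD := fun s => hasDerivAt_duhamel A (continuous_const (y := (0 : V))) v s
  refine eqOn_of_linear_ode A (g := fun _ => 0) (a := 0) (b := t)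
    (fun s _ => (hD s).continuousAt.continuousWithinAt)
    (fun s _ => (hD s).hasDerivWithinAt)
    (fun s _ => (hd s).continuousAt.continuousWithinAt)
    (fun s _ => (hd s).hasDerivWithinAt) ?_ ⟨ht, le_rfl⟩
  simp [duhamel_zero]

end Duhamel

/-! ### The monodromy operator and its spectrum. -/

section Monodromy

theorem continuous_extend {V : Type*} [TopologicalSpace V] {τ : ℝ} (hτ : 0 ≤ τ) (φ : C(Icc 0 τ, V)) : Continuous fun t : ℝ => φ (projIcc 0 τ hτ t) :=
  φ.continuous.comp continuous_projIcc

variable {V : Type*} [NormedAddCommGroup V] [NormedSpace ℂ V]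
  (A B : V →L[ℂ] V) {τ : ℝ} (hτ : 0 ≤ τ)

/-- The solution at times in `[0, τ]` of `u'(t) = A u(t) + B u(t - τ)` with history `φ`; here
`φ s = u (s - τ)`. -/
noncomputable def delaySolution (φ : C(Icc 0 τ, V)) : ℝ → V :=
  duhamel A (fun s => B (φ (projIcc 0 τ hτ s))) (φ ⟨τ, hτ, le_rfl⟩)

theorem delaySolution_zero (φ : C(Icc 0 τ, V)) :
    delaySolution A B hτ φ 0 = φ ⟨τ, hτ, le_rfl⟩ := duhamel_zero _ _ _

variable [CompleteSpace V]

theorem hasDerivAt_delaySolution (φ : C(Icc 0 τ, V)) (t : ℝ) :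
    HasDerivAt (delaySolution A B hτ φ)
      (A (delaySolution A B hτ φ t) + B (φ (projIcc 0 τ hτ t))) t :=
  hasDerivAt_duhamel A (B.continuous.comp (continuous_extend hτ φ)) _ t

theorem continuous_delaySolution (φ : C(Icc 0 τ, V)) : Continuous (delaySolution A B hτ φ) :=
  continuous_iff_continuousAt.2 fun t => (hasDerivAt_delaySolution A B hτ φ t).continuousAt

/-- Uniqueness is the tool for all identities of the monodromy operator: linearity, its action on
exponentials, and its commutation with real parts. -/
theorem delaySolution_eq {φ : C(Icc 0 τ, V)} {u : ℝ → V}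
    (hu : ContinuousOn u (Icc 0 τ))
    (hu' : ∀ t ∈ Ico 0 τ, HasDerivWithinAt u (A (u t) + B (φ (projIcc 0 τ hτ t))) (Ici t) t)
    (h0 : u 0 = φ ⟨τ, hτ, le_rfl⟩) : EqOn (delaySolution A B hτ φ) u (Icc 0 τ) :=
  eqOn_of_linear_ode A (continuous_delaySolution A B hτ φ).continuousOn
    (fun t _ => (hasDerivAt_delaySolution A B hτ φ t).hasDerivWithinAt) hu hu'
    (by rw [delaySolution_zero, h0])

theorem norm_delaySolution_le (φ : C(Icc 0 τ, V)) {t : ℝ} (ht : t ∈ Icc 0 τ) :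
    ‖delaySolution A B hτ φ t‖ ≤ gronwallBound 1 ‖A‖ ‖B‖ τ * ‖φ‖ := by
  have h := norm_le_gronwallBound_of_norm_deriv_right_le (f := delaySolution A B hτ φ)
    (δ := ‖φ‖ * 1) (K := ‖A‖) (ε := ‖φ‖ * ‖B‖) (a := 0) (b := τ)
    (continuous_delaySolution A B hτ φ).continuousOn
    (fun t _ => (hasDerivAt_delaySolution A B hτ φ t).hasDerivWithinAt)
    (by rw [delaySolution_zero, mul_one]; exact φ.norm_coe_le_norm _)
    (fun t _ => (norm_add_le _ _).trans (add_le_add (A.le_opNorm _)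
      ((B.le_opNorm _).trans (by rw [mul_comm]; gcongr; exact φ.norm_coe_le_norm _)))) t ht
  rw [sub_zero, gronwallBound_mul, mul_comm] at h
  refine h.trans ?_
  gcongr
  exact gronwallBound_mono zero_le_one (norm_nonneg _) (norm_nonneg _) ht.2

/-- The time-`τ` map of `u'(t) = A u(t) + B u(t - τ)` on the space of histories. -/
noncomputable def monodromy : C(Icc 0 τ, V) →L[ℂ] C(Icc 0 τ, V) :=
  LinearMap.mkContinuous
    { toFun := fun φ => ⟨fun t => delaySolution A B hτ φ t,
        (continuous_delaySolution A B hτ φ).comp continuous_subtype_val⟩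
      map_add' := fun φ ψ => by
        ext ⟨t, ht⟩
        refine delaySolution_eq A B hτ (u := fun t => delaySolution A B hτ φ t +
          delaySolution A B hτ ψ t) ((continuous_delaySolution A B hτ φ).add
          (continuous_delaySolution A B hτ ψ)).continuousOn (fun t _ => ?_) ?_ ht
        · refine ((hasDerivAt_delaySolution A B hτ φ t).fun_add
            (hasDerivAt_delaySolution A B hτ ψ t)).hasDerivWithinAt.congr_deriv ?_
          rw [ContinuousMap.add_apply, map_add, map_add]
          abel
        · simp only [delaySolution_zero, ContinuousMap.add_apply]
      map_smul' := fun z φ => by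
        ext ⟨t, ht⟩
        refine delaySolution_eq A B hτ (u := fun t => z • delaySolution A B hτ φ t)
          ((continuous_delaySolution A B hτ φ).const_smul z).continuousOn (fun t _ => ?_) ?_ ht
        · refine ((hasDerivAt_delaySolution A B hτ φ t).fun_const_smul z).hasDerivWithinAt.congr_deriv
            ?_
          rw [ContinuousMap.smul_apply, map_smul, map_smul, smul_add]
        · simp only [delaySolution_zero, ContinuousMap.smul_apply] }
    (gronwallBound 1 ‖A‖ ‖B‖ τ) fun φ => by
      refine (ContinuousMap.norm_le _ ?_).2 fun t => norm_delaySolution_le A B hτ φ t.2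
      exact mul_nonneg (gronwallBound_nonneg zero_le_one (norm_nonneg _) (norm_nonneg _) hτ)
        (norm_nonneg _)

theorem monodromy_apply (φ : C(Icc 0 τ, V)) (t : Icc 0 τ) :
    monodromy A B hτ φ t = delaySolution A B hτ φ t := rfl

/-- `z` is a characteristic value of `u'(t) = A u(t) + B u(t - τ)` with eigenvector `v`. -/
def IsDelayEigenpair (τ : ℝ) (z : ℂ) (v : V) : Prop :=
  v ≠ 0 ∧ z • v = A v + Complex.exp (-z * τ) • B v

/-- The history `s ↦ exp (z s) v`. -/
noncomputable def expHistory (τ : ℝ) (z : ℂ) (v : V) : C(Icc 0 τ, V) :=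
  ⟨fun s => Complex.exp (z * (s : ℝ)) • v, by fun_prop⟩

/-- The function `exp (z t) v` solves the equation on the whole line, and a shift by `τ` multiplies
it by `exp (z τ)`. -/
theorem monodromy_expHistory {z : ℂ} {v : V} (h : IsDelayEigenpair A B τ z v) :
    monodromy A B hτ (expHistory τ z v) = Complex.exp (z * τ) • expHistory τ z v := by
  have hd : ∀ s : ℝ, HasDerivAt (fun s : ℝ => Complex.exp (z * τ) • Complex.exp (z * s) • v)
      (Complex.exp (z * τ) • (Complex.exp (z * s) * (z * 1)) • v) s := fun s =>
    (((Complex.ofRealCLM.hasDerivAt (x := s)).const_mul z).cexp.smul_const v).const_smul _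
  ext ⟨t, ht⟩
  refine delaySolution_eq A B hτ (fun s _ => (hd s).continuousAt.continuousWithinAt)
    (fun s hs => ?_) ?_ ht
  · convert (hd s).hasDerivWithinAt using 1
    rw [projIcc_of_mem hτ ⟨hs.1, hs.2.le⟩]
    have h2 := h.2
    simp only [expHistory, ContinuousMap.coe_mk, map_smul]
    have h3 : Complex.exp (z * τ) * Complex.exp (-z * τ) = 1 := by
      rw [← Complex.exp_add]; simp
    rw [mul_one, mul_smul, h2]
    simp only [smul_add, smul_smul]
    congr 2
    calc Complex.exp (z * s) = Complex.exp (z * s) * 1 := (mul_one _).symm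
      _ = _ := by rw [← h3]; ring
  · simp [expHistory]

/-- Spectral mapping in finite dimension: `M` commutes with `exp (t M)`, so it preserves the
`μ`-eigenspace of the exponential and has an eigenvector there. -/
theorem exists_eigenpair_of_exp {W : Type*} [NormedAddCommGroup W] [NormedSpace ℂ W]
    [FiniteDimensional ℂ W] [CompleteSpace W] {M : W →L[ℂ] W} {μ : ℂ} {w : W} {t : ℝ} (ht : 0 ≤ t)
    (hw : w ≠ 0) (h : NormedSpace.exp (t • M) w = μ • w) :
    ∃ (z : ℂ) (v : W), v ≠ 0 ∧ M v = z • v ∧ Complex.exp (z * t) = μ := by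
  set f : Module.End ℂ W := ((NormedSpace.exp (t • M) : W →L[ℂ] W) : W →ₗ[ℂ] W)
  set K := Module.End.eigenspace f μ
  have hcomm : ∀ x, NormedSpace.exp (t • M) (M x) = M (NormedSpace.exp (t • M) x) := by
    intro x
    have h1 : Commute (NormedSpace.exp (t • M)) M := ((Commute.refl M).smul_left t).exp_left
    exact congrArg (fun T : W →L[ℂ] W => T x) h1.eq
  have hmaps : ∀ x ∈ K, (M : W →ₗ[ℂ] W) x ∈ K := by
    intro x hx
    rw [Module.End.mem_eigenspace_iff] at hx ⊢
    have : f x = NormedSpace.exp (t • M) x := rfl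
    show NormedSpace.exp (t • M) (M x) = μ • M x
    rw [hcomm, ← this, hx, map_smul]
  have : Nontrivial K := ⟨⟨⟨w, Module.End.mem_eigenspace_iff.2 h⟩, 0, fun h0 => hw
    (congrArg Subtype.val h0)⟩⟩
  obtain ⟨z, hz⟩ := Module.End.exists_eigenvalue ((M : W →ₗ[ℂ] W).restrict hmaps)
  obtain ⟨v, hv⟩ := hz.exists_hasEigenvector
  have hv0 : (v : W) ≠ 0 := fun h0 => hv.2 (Subtype.ext h0)
  have hMv : M v = z • (v : W) := congrArg Subtype.val hv.apply_eq_smul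
  refine ⟨z, v, hv0, hMv, ?_⟩
  have h1 := exp_smul_apply_of_eigenvector hMv ht
  have h2 : NormedSpace.exp (t • M) (v : W) = μ • (v : W) :=
    Module.End.mem_eigenspace_iff.1 v.2
  rw [h2] at h1
  exact (smul_left_injective ℂ hv0 h1).symm

/-- Every nonzero spectral value of the monodromy operator comes from a characteristic value. -/
theorem exists_eigenpair_of_mem_spectrum [FiniteDimensional ℂ V] {μ : ℂ} (hμ : μ ≠ 0)
    (h : μ ∈ spectrum ℂ (monodromy A B hτ)) :
    ∃ z v, IsDelayEigenpair A B τ z v ∧ Complex.exp (z * τ) = μ := by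
  by_contra hcon
  -- For an eigenhistory the delayed value is `μ⁻¹` times the current one, so the delay equation
  -- becomes `u' = M u`, with boundary condition `exp (τ M) (u 0) = μ u 0`. If no characteristic
  -- root belongs to `μ`, this forces `u 0 = 0`.
  set M : V →L[ℂ] V := A + μ⁻¹ • B with hM
  have hinj : ∀ w, NormedSpace.exp (τ • M) w = μ • w → w = 0 := by
    intro w hw
    by_contra hw0
    obtain ⟨z, v, hv, hz, he⟩ := exists_eigenpair_of_exp hτ hw0 hw
    refine hcon ⟨z, v, ⟨hv, ?_⟩, he⟩
    rw [← hz, neg_mul, Complex.exp_neg, he, hM]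
    rfl
  rw [spectrum.mem_iff] at h
  apply h
  rw [ContinuousLinearMap.isUnit_iff_bijective]
  have happ : ∀ φ, (algebraMap ℂ (C(Icc 0 τ, V) →L[ℂ] C(Icc 0 τ, V)) μ - monodromy A B hτ) φ =
      μ • φ - monodromy A B hτ φ := fun φ => by
    rw [sub_apply, Algebra.algebraMap_eq_smul_one]; rfl
  constructor
  · rw [injective_iff_map_eq_zero]
    intro φ hφ
    rw [happ, sub_eq_zero] at hφ
    have hφ' : ∀ t (ht : t ∈ Icc 0 τ), φ ⟨t, ht⟩ = μ⁻¹ • delaySolution A B hτ φ t := fun t ht => by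
      have := congrArg (fun f : C(Icc 0 τ, V) => f ⟨t, ht⟩) hφ
      simp only [ContinuousMap.smul_apply, monodromy_apply] at this
      rw [← this, smul_smul, inv_mul_cancel₀ hμ, one_smul]
    set u := delaySolution A B hτ φ with hu
    have hD := fun s => hasDerivAt_duhamel M (continuous_const (y := (0 : V))) (u 0) s
    have heq : EqOn u (duhamel M (fun _ => 0) (u 0)) (Icc 0 τ) := by
      refine eqOn_of_linear_ode M (g := fun _ => 0)
        (continuous_delaySolution A B hτ φ).continuousOn (fun t ht => ?_)
        (fun s _ => (hD s).continuousAt.continuousWithinAt)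
        (fun s _ => (hD s).hasDerivWithinAt) (duhamel_zero _ _ _).symm
      convert (hasDerivAt_delaySolution A B hτ φ t).hasDerivWithinAt using 1
      have hB := hφ' t ⟨ht.1, ht.2.le⟩
      rw [projIcc_of_mem hτ ⟨ht.1, ht.2.le⟩, hB, hM]
      simp [hu]
    have hdu : ∀ y t, duhamel M (fun _ => 0) y t = NormedSpace.exp (t • M) y := fun y t => by
      simp [duhamel]
    have h0 : u 0 = 0 := by
      apply hinj
      rw [← hdu, ← heq ⟨hτ, le_rfl⟩]
      have h1 := delaySolution_zero A B hτ φ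
      have h2 := hφ' τ ⟨hτ, le_rfl⟩
      rw [h2, ← hu] at h1
      rw [h1, smul_smul, mul_inv_cancel₀ hμ, one_smul]
    ext ⟨t, ht⟩
    rw [hφ', heq ht, hdu, h0, map_zero, smul_zero]
    rfl
  · intro ψ
    have hsurj : Function.Surjective
        ((μ • ContinuousLinearMap.id ℂ V - NormedSpace.exp (τ • M) : V →L[ℂ] V) : V →ₗ[ℂ] V) := by
      rw [← LinearMap.injective_iff_surjective, injective_iff_map_eq_zero]
      intro w hw
      apply hinj
      have : μ • w - NormedSpace.exp (τ • M) w = 0 := hw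
      exact (sub_eq_zero.1 this).symm
    -- To solve `μ φ - T φ = ψ`, put `y = T φ`, so `φ = μ⁻¹ (y + ψ)` and `y' = M y + g`. The
    -- condition `y 0 = φ τ` is a linear equation for `y 0` with operator `μ - exp (τ M)`, which is
    -- injective and hence surjective in finite dimension.
    set g : ℝ → V := fun s => μ⁻¹ • B (ψ (projIcc 0 τ hτ s)) with hg
    have hgc : Continuous g := (B.continuous.comp (continuous_extend hτ ψ)).const_smul _
    obtain ⟨y₀, hy₀⟩ := hsurj (duhamel M g 0 τ + ψ ⟨τ, hτ, le_rfl⟩)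
    have hy₀' : μ • y₀ - NormedSpace.exp (τ • M) y₀ = duhamel M g 0 τ + ψ ⟨τ, hτ, le_rfl⟩ := hy₀
    set y := duhamel M g y₀ with hy
    have hyc : Continuous y := continuous_duhamel M hgc y₀
    have hyτ : μ • y₀ = y τ + ψ ⟨τ, hτ, le_rfl⟩ := by
      rw [sub_eq_iff_eq_add] at hy₀'
      rw [hy₀', hy, duhamel, duhamel, zero_add, map_add]
      abel
    set φ : C(Icc 0 τ, V) := ⟨fun t => μ⁻¹ • (y t + ψ t), by fun_prop⟩ with hφ
    have hφa : ∀ t, φ t = μ⁻¹ • (y t + ψ t) := fun _ => rfl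
    have hTφ : EqOn (delaySolution A B hτ φ) y (Icc 0 τ) := by
      refine delaySolution_eq A B hτ hyc.continuousOn (fun t ht => ?_) ?_
      · convert (hasDerivAt_duhamel M hgc y₀ t).hasDerivWithinAt using 1
        rw [hφa, projIcc_of_mem hτ ⟨ht.1, ht.2.le⟩, ← hy, hM, hg]
        simp only [projIcc_of_mem hτ (⟨ht.1, ht.2.le⟩ : t ∈ Icc 0 τ), map_smul, map_add, smul_add,
          add_apply, smul_apply]
        abel
      · rw [hφa, ← hyτ, smul_smul, inv_mul_cancel₀ hμ, one_smul, hy, duhamel_zero]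
    refine ⟨φ, ?_⟩
    rw [happ]
    ext ⟨t, ht⟩
    rw [ContinuousMap.sub_apply, ContinuousMap.smul_apply, monodromy_apply, hTφ ht, hφa, smul_smul,
      mul_inv_cancel₀ hμ, one_smul]
    simp

end Monodromy

/-! ### Discrete dynamics: powers of operators and quadratic perturbations. -/

section Iteration

/-- Gelfand's formula covers all large `n`; the finitely many remaining powers are absorbed into the
constant. -/
theorem exists_norm_pow_le {R : Type*} [NormedRing R] [NormedAlgebra ℂ R] [CompleteSpace R]
    (T : R) {ρ : ℝ} (hρ : 0 < ρ) (h : spectralRadius ℂ T < ENNReal.ofReal ρ) :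
    ∃ C > 0, ∀ n, ‖T ^ n‖ ≤ C * ρ ^ n := by
  have h1 := (spectrum.pow_nnnorm_pow_one_div_tendsto_nhds_spectralRadius T).eventually
    (gt_mem_nhds h)
  obtain ⟨N, hN⟩ := eventually_atTop.1 h1
  have hbig : ∀ n, N ≤ n → 0 < n → ‖T ^ n‖ ≤ ρ ^ n := by
    intro n hn hn0
    have h2 := hN n hn
    have hn' : (0 : ℝ) < n := by exact_mod_cast hn0
    have h3 : (‖T ^ n‖₊ : ENNReal) < ENNReal.ofReal ρ ^ (n : ℝ) := by
      have := ENNReal.rpow_lt_rpow h2 hn'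
      rwa [← ENNReal.rpow_mul, one_div, inv_mul_cancel₀ hn'.ne', ENNReal.rpow_one] at this
    rw [ENNReal.rpow_natCast, ← ENNReal.ofReal_pow hρ.le] at h3
    have h4 : ENNReal.ofReal ‖T ^ n‖ < ENNReal.ofReal (ρ ^ n) := by
      rwa [ofReal_norm, enorm_eq_nnnorm]
    exact ((ENNReal.ofReal_lt_ofReal_iff (by positivity)).1 h4).le
  refine ⟨1 + ∑ i ∈ Finset.range (N + 1), ‖T ^ i‖ / ρ ^ i, ?_, fun n => ?_⟩
  · have : 0 ≤ ∑ i ∈ Finset.range (N + 1), ‖T ^ i‖ / ρ ^ i :=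
      Finset.sum_nonneg fun i _ => by positivity
    linarith
  · have hs : 0 ≤ ∑ i ∈ Finset.range (N + 1), ‖T ^ i‖ / ρ ^ i :=
      Finset.sum_nonneg fun i _ => by positivity
    have hp : 0 < ρ ^ n := by positivity
    by_cases hn : n < N + 1
    · have h5 : ‖T ^ n‖ / ρ ^ n ≤ ∑ i ∈ Finset.range (N + 1), ‖T ^ i‖ / ρ ^ i :=
        Finset.single_le_sum (f := fun i => ‖T ^ i‖ / ρ ^ i) (fun i _ => by positivity)
          (Finset.mem_range.2 hn)
      rw [div_le_iff₀ hp] at h5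
      nlinarith
    · have := hbig n (by omega) (by omega)
      nlinarith

variable {X : Type*} [NormedAddCommGroup X] [NormedSpace ℂ X]

/-- Discrete variation of constants, valid for any sequence. -/
theorem eq_pow_add_sum (T : X →L[ℂ] X) (x : ℕ → X) (n : ℕ) :
    x n = (T ^ n) (x 0) + ∑ j ∈ Finset.range n, (T ^ (n - 1 - j)) (x (j + 1) - T (x j)) := by
  induction n with
  | zero => simp
  | succ n ih =>
    rw [Finset.sum_range_succ]
    have h1 : ∑ j ∈ Finset.range n, (T ^ (n + 1 - 1 - j)) (x (j + 1) - T (x j)) =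
        T (∑ j ∈ Finset.range n, (T ^ (n - 1 - j)) (x (j + 1) - T (x j))) := by
      rw [map_sum]
      refine Finset.sum_congr rfl fun j hj => ?_
      have := Finset.mem_range.1 hj
      rw [show n + 1 - 1 - j = (n - 1 - j) + 1 by omega, pow_succ']
      rfl
    have h2 : (T ^ (n + 1)) (x 0) = T ((T ^ n) (x 0)) := by rw [pow_succ']; rfl
    have h3 : T (x n) = T ((T ^ n) (x 0)) +
        T (∑ j ∈ Finset.range n, (T ^ (n - 1 - j)) (x (j + 1) - T (x j))) := by
      rw [← map_add, ← ih]
    rw [h1, h2, ← add_assoc, ← h3]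
    simp

/-- A sequence that follows the linear iteration `T` up to a quadratic error stays close to the
linear orbit as long as the latter grows at most like `ε s ^ n`, `ρ < s ^ 2`, and is small. -/
theorem exists_norm_sub_pow_le (T : X →L[ℂ] X) {C ρ s K d η : ℝ} (hC : 0 < C) (hρ : 0 < ρ)
    (hs : 0 < s) (hρs : ρ < s ^ 2) (hK : 0 < K) (hd : 0 < d) (hη : 0 < η) (hη1 : η ≤ 1)
    (hT : ∀ n, ‖T ^ n‖ ≤ C * ρ ^ n) :
    ∃ c > 0, ∀ x : ℕ → X,
      (∀ n a, 0 < a → a ≤ d → ‖x n‖ ≤ a → ‖x (n + 1) - T (x n)‖ ≤ K * a ^ 2) →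
      ∀ ε > 0, ∀ N, (∀ n ≤ N, ε * s ^ n ≤ c ∧ ‖(T ^ n) (x 0)‖ ≤ ε * s ^ n) →
        ∀ n ≤ N, ‖x n - (T ^ n) (x 0)‖ ≤ η * (ε * s ^ n) := by
  -- The orbit stays below `2 ε s ^ j`, so step `j` makes an error of at most `4 K ε² s ^ (2 j)`.
  -- Propagated by powers of `T`, these errors sum geometrically, as `ρ < s²`, to at most `D ε² s ^
  -- (2 n)`. While `ε s ^ n ≤ η / D` this is at most `η ε s ^ n`. The bound `d / 2` keeps `2 ε s ^
  -- j` in the range of the error hypothesis.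
  set D := 4 * K * C / (s ^ 2 - ρ) with hD
  have hsρ : 0 < s ^ 2 - ρ := sub_pos.2 hρs
  have hDpos : 0 < D := by positivity
  refine ⟨min (d / 2) (η / D), by positivity, fun x hx ε hε N hN n => ?_⟩
  induction n using Nat.strong_induction_on with
  | _ n ih =>
  intro hn
  have hxj : ∀ j < n, ‖x j‖ ≤ 2 * (ε * s ^ j) := by
    intro j hj
    have h1 := ih j hj (by omega)
    have h2 := (hN j (by omega)).2
    have h3 : ‖x j‖ ≤ ‖x j - (T ^ j) (x 0)‖ + ‖(T ^ j) (x 0)‖ := by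
      simpa using norm_add_le (x j - (T ^ j) (x 0)) ((T ^ j) (x 0))
    have h4 : η * (ε * s ^ j) ≤ 1 * (ε * s ^ j) := by gcongr
    linarith
  have hr : ∀ j ∈ Finset.range n, ‖(T ^ (n - 1 - j)) (x (j + 1) - T (x j))‖ ≤
      4 * K * C * ε ^ 2 * ((s ^ 2) ^ j * ρ ^ (n - 1 - j)) := by
    intro j hj
    have hj' := Finset.mem_range.1 hj
    have h1 := (hN j (by omega)).1.trans (min_le_left _ _)
    have h2 := hx j (2 * (ε * s ^ j)) (by positivity) (by linarith) (hxj j hj')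
    calc _ ≤ ‖T ^ (n - 1 - j)‖ * ‖x (j + 1) - T (x j)‖ := ContinuousLinearMap.le_opNorm _ _
      _ ≤ (C * ρ ^ (n - 1 - j)) * (K * (2 * (ε * s ^ j)) ^ 2) := by
        gcongr; exact hT _
      _ = _ := by rw [← pow_mul, mul_comm 2 j, pow_mul]; ring
  have hsum : ‖x n - (T ^ n) (x 0)‖ ≤ D * ε ^ 2 * (s ^ 2) ^ n := by
    have h1 := eq_pow_add_sum T x n
    rw [← sub_eq_iff_eq_add'] at h1
    rw [h1]
    refine (norm_sum_le_of_le _ hr).trans ?_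
    rw [← Finset.mul_sum]
    have h2 := (Commute.all (s ^ 2) ρ).geom_sum₂_mul n
    have h3 : ∑ j ∈ Finset.range n, (s ^ 2) ^ j * ρ ^ (n - 1 - j) ≤ (s ^ 2) ^ n / (s ^ 2 - ρ) := by
      rw [le_div_iff₀ hsρ, h2]
      have : 0 < ρ ^ n := by positivity
      linarith
    calc _ ≤ 4 * K * C * ε ^ 2 * ((s ^ 2) ^ n / (s ^ 2 - ρ)) := by gcongr
      _ = _ := by rw [hD]; ring
  refine hsum.trans ?_
  have h5 := (hN n hn).1.trans (min_le_right _ _)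
  rw [le_div_iff₀ hDpos] at h5
  calc D * ε ^ 2 * (s ^ 2) ^ n = (ε * s ^ n * D) * (ε * s ^ n) := by
        rw [← pow_mul, mul_comm 2 n, pow_mul]; ring
    _ ≤ _ := by gcongr

end Iteration

/-! ### Global existence for Lipschitz delay equations. -/

section Existence

variable {E : Type*} [NormedAddCommGroup E] [NormedSpace ℝ E]

/-- Integration gains a factor `1 / l` in the norm weighted by `exp (l t)`; for large `l` this makes
the Picard operator a contraction. -/
theorem norm_integral_le_exp {g : ℝ → E} {c l t : ℝ} (hl : 0 < l) (ht : 0 ≤ t) (hc : 0 ≤ c)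
    (hg : ∀ s ∈ Icc 0 t, ‖g s‖ ≤ c * Real.exp (l * s)) :
    ‖∫ s in (0 : ℝ)..t, g s‖ ≤ c / l * Real.exp (l * t) := by
  have hint : ∫ s in (0 : ℝ)..t, c * Real.exp (l * s) =
      c / l * Real.exp (l * t) - c / l * Real.exp (l * 0) := by
    apply intervalIntegral.integral_eq_sub_of_hasDerivAt (f := fun s => c / l * Real.exp (l * s))
    · intro s _
      have h1 : HasDerivAt (fun s => Real.exp (l * s)) (Real.exp (l * s) * (l * 1)) s :=
        ((hasDerivAt_id s).const_mul l).exp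
      refine (h1.const_mul (c / l)).congr_deriv ?_
      field_simp
    · exact (by fun_prop : Continuous fun s => c * Real.exp (l * s)).intervalIntegrable _ _
  have h := intervalIntegral.norm_integral_le_of_norm_le (μ := MeasureTheory.volume) ht
    (Eventually.of_forall fun s hs => hg s ⟨hs.1.le, hs.2⟩)
    ((by fun_prop : Continuous fun s => c * Real.exp (l * s)).intervalIntegrable _ _)
  refine h.trans ?_
  rw [hint]
  have : 0 ≤ c / l * Real.exp (l * 0) := by positivity
  linarith

/-- Delay equations with a globally Lipschitz right-hand side have global solutions. -/
theorem exists_isDDESolution [CompleteSpace E] {G : E → E → E} {K : NNReal}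
    (hG : LipschitzWith K fun p : E × E => G p.1 p.2) {τ : ℝ} (hτ : 0 ≤ τ) {φ : ℝ → E}
    (hφ : ContinuousOn φ (Icc (-τ) 0)) : ∃ x, IsDDESolution G τ φ x := by
  have hτ' : -τ ≤ 0 := neg_nonpos.2 hτ
  set ψ : ℝ → E := fun t => φ (projIcc (-τ) 0 hτ' t) with hψ
  have hψc : Continuous ψ :=
    (continuousOn_iff_continuous_domRestrict.1 hφ).comp continuous_projIcc
  obtain ⟨Ψ, hΨ⟩ : ∃ Ψ, ∀ t, ‖ψ t‖ ≤ Ψ := by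
    obtain ⟨Ψ, hΨ⟩ := isCompact_Icc.exists_bound_of_continuousOn hφ
    exact ⟨Ψ, fun t => hΨ _ (projIcc (-τ) 0 hτ' t).2⟩
  have hΨ0 : 0 ≤ Ψ := (norm_nonneg _).trans (hΨ 0)
  -- The solution is sought as `ψ + exp (l max t 0) y` with `y` bounded and continuous. With this
  -- `l` the contraction factor `K / l` is below `1 / 2`. The fixed point vanishes for `t ≤ 0`, so
  -- the history is attained.
  set l : ℝ := 2 * K + 1 with hl
  have hlpos : 0 < l := by positivity
  set X : BoundedContinuousFunction ℝ E → ℝ → E := fun y t =>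
    ψ t + Real.exp (l * max t 0) • y t with hX
  have hXc : ∀ y, Continuous (X y) := fun y => by fun_prop
  set g : BoundedContinuousFunction ℝ E → ℝ → E := fun y s => G (X y s) (X y (s - τ)) with hg
  have hgc : ∀ y, Continuous (g y) := fun y =>
    hG.continuous.comp ((hXc y).prodMk ((hXc y).comp (continuous_id.sub continuous_const)))
  have hXs : ∀ y s t, s ≤ t → 0 ≤ t → ‖X y s‖ ≤ Ψ + Real.exp (l * t) * ‖y‖ := by
    intro y s t hst ht
    refine (norm_add_le _ _).trans (add_le_add (hΨ s) ?_)
    rw [norm_smul, Real.norm_eq_abs, Real.abs_exp]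
    gcongr
    · exact max_le hst ht
    · exact y.norm_coe_le_norm s
  have hXd : ∀ y z s t, s ≤ t → 0 ≤ t → ‖X y s - X z s‖ ≤ Real.exp (l * t) * ‖y - z‖ := by
    intro y z s t hst ht
    have : X y s - X z s = Real.exp (l * max s 0) • (y - z) s := by
      simp only [hX, BoundedContinuousFunction.coe_sub, Pi.sub_apply, smul_sub]; abel
    rw [this, norm_smul, Real.norm_eq_abs, Real.abs_exp]
    gcongr
    · exact max_le hst ht
    · exact (y - z).norm_coe_le_norm s
  have hgs : ∀ y s, 0 ≤ s → ‖g y s‖ ≤ (‖G 0 0‖ + K * (Ψ + ‖y‖)) * Real.exp (l * s) := by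
    intro y s hs
    have h1 := hG.dist_le_mul (X y s, X y (s - τ)) (0, 0)
    rw [dist_eq_norm, dist_eq_norm, Prod.mk_sub_mk, sub_zero, sub_zero] at h1
    have h2 : ‖(X y s, X y (s - τ))‖ ≤ Ψ + Real.exp (l * s) * ‖y‖ :=
      max_le (hXs y s s le_rfl hs) (hXs y (s - τ) s (by linarith) hs)
    have h3 : ‖g y s‖ ≤ ‖g y s - G 0 0‖ + ‖G 0 0‖ := by
      simpa using norm_add_le (g y s - G 0 0) (G 0 0)
    have h4 : 1 ≤ Real.exp (l * s) := Real.one_le_exp (by positivity)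
    have h5 : ‖g y s - G 0 0‖ ≤ K * (Ψ + Real.exp (l * s) * ‖y‖) := h1.trans (by gcongr)
    have h6 : Ψ ≤ Ψ * Real.exp (l * s) := le_mul_of_one_le_right hΨ0 h4
    have h7 : ‖G 0 0‖ ≤ ‖G 0 0‖ * Real.exp (l * s) := le_mul_of_one_le_right (norm_nonneg _) h4
    calc ‖g y s‖ ≤ K * (Ψ * Real.exp (l * s) + Real.exp (l * s) * ‖y‖) +
          ‖G 0 0‖ * Real.exp (l * s) := h3.trans (add_le_add (h5.trans (by gcongr)) h7)
      _ = _ := by ring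
  have hgd : ∀ y z s, 0 ≤ s → ‖g y s - g z s‖ ≤ (K * ‖y - z‖) * Real.exp (l * s) := by
    intro y z s hs
    have h1 := hG.dist_le_mul (X y s, X y (s - τ)) (X z s, X z (s - τ))
    rw [dist_eq_norm, dist_eq_norm, Prod.mk_sub_mk] at h1
    have h2 : ‖(X y s - X z s, X y (s - τ) - X z (s - τ))‖ ≤ Real.exp (l * s) * ‖y - z‖ :=
      max_le (hXd y z s s le_rfl hs) (hXd y z (s - τ) s (by linarith) hs)
    calc ‖g y s - g z s‖ ≤ K * (Real.exp (l * s) * ‖y - z‖) := h1.trans (by gcongr)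
      _ = _ := by ring
  have hIc : ∀ y, Continuous fun t => ∫ s in (0 : ℝ)..max t 0, g y s := fun y =>
    (intervalIntegral.continuous_primitive (fun a b => (hgc y).intervalIntegrable a b) 0).comp
      (continuous_id.max continuous_const)
  have hexp : ∀ a : ℝ, Real.exp (-(l * a)) * Real.exp (l * a) = 1 := fun a => by
    rw [← Real.exp_add]; simp
  let Φ : BoundedContinuousFunction ℝ E → BoundedContinuousFunction ℝ E := fun y =>
    BoundedContinuousFunction.ofNormedAddCommGroup
      (fun t => Real.exp (-(l * max t 0)) • ∫ s in (0 : ℝ)..max t 0, g y s)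
      ((by fun_prop : Continuous fun t : ℝ => Real.exp (-(l * max t 0))).smul (hIc y))
      ((‖G 0 0‖ + K * (Ψ + ‖y‖)) / l) fun t => by
        rw [norm_smul, Real.norm_eq_abs, Real.abs_exp]
        have := norm_integral_le_exp hlpos (le_max_right t 0) (by positivity)
          fun s hs => hgs y s hs.1
        calc _ ≤ Real.exp (-(l * max t 0)) * ((‖G 0 0‖ + K * (Ψ + ‖y‖)) / l *
              Real.exp (l * max t 0)) := by gcongr
          _ = (‖G 0 0‖ + K * (Ψ + ‖y‖)) / l *
              (Real.exp (-(l * max t 0)) * Real.exp (l * max t 0)) := by ring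
          _ = _ := by rw [hexp, mul_one]
  have hΦ : ∀ y t, Φ y t = Real.exp (-(l * max t 0)) • ∫ s in (0 : ℝ)..max t 0, g y s :=
    fun _ _ => rfl
  have hcontr : ContractingWith (1 / 2) Φ := by
    refine ⟨by rw [← NNReal.coe_lt_coe]; norm_num, LipschitzWith.of_dist_le_mul fun y z => ?_⟩
    refine (BoundedContinuousFunction.dist_le (by positivity)).2 fun t => ?_
    rw [hΦ, hΦ, dist_eq_norm, ← smul_sub, ← intervalIntegral.integral_sub
      ((hgc y).intervalIntegrable _ _) ((hgc z).intervalIntegrable _ _), norm_smul,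
      Real.norm_eq_abs, Real.abs_exp]
    have := norm_integral_le_exp hlpos (le_max_right t 0) (by positivity)
      fun s hs => hgd y z s hs.1
    calc _ ≤ Real.exp (-(l * max t 0)) * ((K * ‖y - z‖) / l * Real.exp (l * max t 0)) := by
          gcongr
      _ = (K * ‖y - z‖) / l * (Real.exp (-(l * max t 0)) * Real.exp (l * max t 0)) := by ring
      _ = K / l * ‖y - z‖ := by rw [hexp]; ring
      _ ≤ (1 / 2 : NNReal) * dist y z := by
        rw [dist_eq_norm]
        gcongr
        rw [div_le_iff₀ hlpos, hl]
        push_cast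
        linarith
  set y := ContractingWith.fixedPoint Φ hcontr with hy
  have hfix : Φ y = y := hcontr.fixedPoint_isFixedPt
  have hXeq : ∀ t, X y t = ψ t + ∫ s in (0 : ℝ)..max t 0, g y s := by
    intro t
    have : X y t = ψ t + Real.exp (l * max t 0) • Φ y t := by rw [hfix]
    rw [this, hΦ, smul_smul, mul_comm, hexp, one_smul]
  refine ⟨X y, (hXc y).continuousOn, fun t ht => ?_, fun t ht => ?_⟩
  · rw [hXeq, max_eq_right ht.2, intervalIntegral.integral_same, add_zero, hψ]
    simp only
    rw [projIcc_of_mem hτ' ht]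
  · have h1 : HasDerivAt (fun t => ψ 0 + ∫ s in (0 : ℝ)..t, g y s) (g y t) t :=
      ((hgc y).integral_hasStrictDerivAt 0 t).hasDerivAt.const_add _
    refine h1.congr_of_eventuallyEq ?_
    filter_upwards [lt_mem_nhds ht] with s hs
    rw [hXeq, max_eq_left hs.le]
    congr 1
    simp only [hψ]
    rw [projIcc_of_right_le hτ' hs.le, projIcc_of_right_le hτ' le_rfl]

end Existence

/-! ### Comparison with the linearised equation over one delay interval. -/

section OneStep

variable {E V : Type*} [NormedAddCommGroup E] [NormedSpace ℝ E]
    [NormedAddCommGroup V] [NormedSpace ℂ V]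

/-- Second order Taylor estimate. -/
theorem exists_norm_sub_le_sq {F' : Type*} [NormedAddCommGroup F'] [NormedSpace ℝ F']
    {f : E → F'} {L : E →L[ℝ] F'} {x₀ : E} (hf : ContDiffAt ℝ 2 f x₀) (hL : HasFDerivAt f L x₀) :
    ∃ d > 0, ∃ K > 0, ∀ h, ‖h‖ ≤ d → ‖f (x₀ + h) - f x₀ - L h‖ ≤ K * ‖h‖ ^ 2 := by
  have h1 : ContDiffAt ℝ 1 (fderiv ℝ f) x₀ := hf.fderiv_right (by norm_num)
  obtain ⟨K, t, ht, hK⟩ := h1.exists_lipschitzOnWith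
  have h2 : ∀ᶠ x in 𝓝 x₀, DifferentiableAt ℝ f x := by
    filter_upwards [hf.eventually (by simp)] with x hx
    exact hx.differentiableAt (by norm_num)
  obtain ⟨d, hd, hball⟩ := Metric.nhds_basis_closedBall.mem_iff.1 (inter_mem ht h2)
  refine ⟨d, hd, K + 1, by positivity, fun h hh => ?_⟩
  have hsub : Metric.closedBall x₀ ‖h‖ ⊆ Metric.closedBall x₀ d :=
    Metric.closedBall_subset_closedBall hh
  have hmem : x₀ + h ∈ Metric.closedBall x₀ ‖h‖ := by simp
  have hmem0 : x₀ ∈ Metric.closedBall x₀ ‖h‖ := by simp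
  have key := (convex_closedBall x₀ ‖h‖).norm_image_sub_le_of_norm_hasFDerivWithin_le'
    (f := f) (f' := fderiv ℝ f) (φ := L) (C := K * ‖h‖)
    (fun x hx => ((hball (hsub hx)).2 : DifferentiableAt ℝ f x).hasFDerivAt.hasFDerivWithinAt)
    (fun x hx => by
      rw [← hL.fderiv]
      refine (hK.norm_sub_le (hball (hsub hx)).1 (hball (hsub hmem0)).1).trans ?_
      gcongr
      rwa [Metric.mem_closedBall, dist_eq_norm] at hx) hmem0 hmem
  rw [add_sub_cancel_left] at key
  refine key.trans ?_
  nlinarith [norm_nonneg h, sq_nonneg ‖h‖]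

/-- One delay interval: the solution is bounded by the history, and equals the solution of the
linearised equation up to a quadratic error. -/
theorem exists_one_step_bound (c : Complexification E V) [CompleteSpace V] {F : E → E → E} {e : E}
    {L : E × E →L[ℝ] E} (hF : ContDiffAt ℝ 2 (fun p : E × E => F p.1 p.2) (e, e))
    (hL : HasFDerivAt (fun p : E × E => F p.1 p.2) L (e, e)) (he : F e e = 0) {τ : ℝ} (hτ : 0 ≤ τ) :
    ∃ d > 0, ∃ K > 0, ∀ (y h : ℝ → E) (φ : C(Icc 0 τ, V)), ContinuousOn y (Icc 0 τ) →
      y 0 = h τ → (∀ t : Icc 0 τ, φ t = c.ι (h t)) → ∀ a, 0 < a → a ≤ d → ‖φ‖ ≤ a →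
      (∀ t ∈ Ico 0 τ, HasDerivWithinAt y (F (e + y t) (e + h t)) (Ici t) t) →
      ∀ t ∈ Icc 0 τ,
        ‖c.ι (y t) - delaySolution (c.map (L.comp (.inl ℝ E E))) (c.map (L.comp (.inr ℝ E E)))
          hτ φ t‖ ≤ K * a ^ 2 := by
  obtain ⟨d, hd, K, hK, hquad⟩ := exists_norm_sub_le_sq hF hL
  set A := c.map (L.comp (.inl ℝ E E)) with hA
  set B := c.map (L.comp (.inr ℝ E E)) with hB
  set l := ‖L‖ + K * d with hl
  have hl0 : 0 ≤ l := by positivity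
  -- `l` bounds `F` linearly near the equilibrium; the exponent `l + 1` gives the strict inequality
  -- required by the comparison theorem. A history of size `d / M` keeps the solution in the ball of
  -- radius `d` where the Taylor estimate holds.
  set M := Real.exp ((l + 1) * τ) with hM
  have hMpos : 0 < M := Real.exp_pos _
  have hM1 : 1 ≤ M := Real.one_le_exp (by positivity)
  have hgb : 0 ≤ gronwallBound 0 ‖A‖ (K * M ^ 2) τ :=
    gronwallBound_nonneg le_rfl (norm_nonneg _) (by positivity) hτ
  refine ⟨d / M, by positivity, gronwallBound 0 ‖A‖ (K * M ^ 2) τ + 1, by positivity, ?_⟩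
  intro y h φ hy hy0 hφ a ha had hφa hder
  rw [le_div_iff₀ hMpos, mul_comm] at had
  have hh : ∀ t ∈ Icc 0 τ, ‖h t‖ ≤ a := fun t ht => by
    rw [← c.norm_ι, ← hφ ⟨t, ht⟩]
    exact (φ.norm_coe_le_norm _).trans hφa
  have hquad' : ∀ p q : E, ‖(p, q)‖ ≤ d → ‖F (e + p) (e + q) - L (p, q)‖ ≤ K * ‖(p, q)‖ ^ 2 := by
    intro p q hpq
    simpa [he] using hquad (p, q) hpq
  have hFb : ∀ p q : E, ‖(p, q)‖ ≤ d → ‖F (e + p) (e + q)‖ ≤ l * ‖(p, q)‖ := by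
    intro p q hpq
    have h1 := hquad' p q hpq
    have h2 := L.le_opNorm (p, q)
    have h3 : ‖F (e + p) (e + q)‖ ≤ ‖F (e + p) (e + q) - L (p, q)‖ + ‖L (p, q)‖ := by
      simpa using norm_add_le (F (e + p) (e + q) - L (p, q)) (L (p, q))
    have h4 : K * ‖(p, q)‖ ^ 2 ≤ K * d * ‖(p, q)‖ := by
      rw [pow_two, ← mul_assoc]; gcongr
    rw [hl, add_mul]
    linarith
  have hBd : ∀ t ∈ Icc 0 τ, a * Real.exp ((l + 1) * t) ≤ M * a := fun t ht => by
    rw [mul_comm, hM]; gcongr; exact ht.2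
  have hab : ∀ t ∈ Icc 0 τ, a ≤ a * Real.exp ((l + 1) * t) := fun t ht =>
    le_mul_of_one_le_right ha.le (Real.one_le_exp (mul_nonneg (by positivity) ht.1))
  have hyb : ∀ ⦃t⦄, t ∈ Icc 0 τ → ‖y t‖ ≤ a * Real.exp ((l + 1) * t) := by
    refine image_norm_le_of_norm_deriv_right_lt_deriv_boundary hy hder
      (B' := fun t => a * (Real.exp ((l + 1) * t) * ((l + 1) * 1))) ?_ ?_ ?_
    · rw [mul_zero, Real.exp_zero, mul_one, hy0]; exact hh τ ⟨hτ, le_rfl⟩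
    · exact fun t => (((hasDerivAt_id t).const_mul (l + 1)).exp).const_mul a
    · intro t ht heq
      have ht' : t ∈ Icc 0 τ := ⟨ht.1, ht.2.le⟩
      have hn : ‖(y t, h t)‖ = a * Real.exp ((l + 1) * t) := by
        rw [Prod.norm_def]
        simp only
        rw [heq, max_eq_left ((hh t ht').trans (hab t ht'))]
      have := hFb (y t) (h t) (by rw [hn]; exact (hBd t ht').trans had)
      rw [hn] at this
      have hpos : 0 < a * Real.exp ((l + 1) * t) := by positivity
      refine this.trans_lt ?_
      nlinarith
  have hub : ∀ t ∈ Icc 0 τ, ‖(y t, h t)‖ ≤ M * a := fun t ht =>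
    max_le ((hyb ht).trans (hBd t ht)) (((hh t ht).trans (hab t ht)).trans (hBd t ht))
  set u := delaySolution A B hτ φ with hu
  have hcont : ContinuousOn (fun t => c.ι (y t) - u t) (Icc 0 τ) :=
    (c.ι.continuous.comp_continuousOn hy).sub (continuous_delaySolution A B hτ φ).continuousOn
  intro t ht
  -- The difference starts at `0` and is driven only by the Taylor remainder, which is of order
  -- `a²`.
  have key := norm_le_gronwallBound_of_norm_deriv_right_le (f := fun t => c.ι (y t) - u t)
    (f' := fun t => c.ι (F (e + y t) (e + h t)) - (A (u t) + B (φ (projIcc 0 τ hτ t))))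
    (δ := a ^ 2 * 0) (K := ‖A‖) (ε := a ^ 2 * (K * M ^ 2)) (a := 0) (b := τ) hcont
    (fun s hs => (c.ι.hasFDerivAt.comp_hasDerivWithinAt s (hder s hs)).sub
      (hasDerivAt_delaySolution A B hτ φ s).hasDerivWithinAt) ?_ ?_ t ht
  · rw [sub_zero, gronwallBound_mul] at key
    refine key.trans ?_
    rw [mul_comm]
    have := gronwallBound_mono le_rfl (by positivity : 0 ≤ K * M ^ 2) (norm_nonneg A) ht.2
    nlinarith [sq_nonneg a]
  · rw [mul_zero, hu, delaySolution_zero, hφ, hy0, sub_self, norm_zero]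
  · intro s hs
    have hs' : s ∈ Icc 0 τ := ⟨hs.1, hs.2.le⟩
    rw [projIcc_of_mem hτ hs', hφ, hB, c.map_ι]
    have h1 : c.ι (F (e + y s) (e + h s)) -
        (A (u s) + c.ι ((L.comp (.inr ℝ E E)) (h s))) =
        A (c.ι (y s) - u s) + c.ι (F (e + y s) (e + h s) - L (y s, h s)) := by
      have h2 : A (c.ι (y s)) = c.ι ((L.comp (.inl ℝ E E)) (y s)) := c.map_ι _ _
      have h3 : L (y s, h s) = (L.comp (.inl ℝ E E)) (y s) + (L.comp (.inr ℝ E E)) (h s) := by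
        simp only [ContinuousLinearMap.comp_apply, ContinuousLinearMap.inl_apply,
          ContinuousLinearMap.inr_apply]
        rw [← map_add]; simp
      rw [map_sub A, h2, map_sub c.ι, h3, map_add c.ι]
      abel
    rw [h1]
    refine (norm_add_le _ _).trans (add_le_add (A.le_opNorm _) ?_)
    rw [c.norm_ι]
    have h4 := hub s hs'
    calc _ ≤ K * ‖(y s, h s)‖ ^ 2 := hquad' _ _ (h4.trans had)
      _ ≤ K * (M * a) ^ 2 := by gcongr
      _ = _ := by ring

/-- The equation holds with the right derivative at time `0`, too. -/
theorem IsDDESolution.hasDerivWithinAt {F : E → E → E} {τ : ℝ} {φ x : ℝ → E} (hτ : 0 < τ)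
    (hx : IsDDESolution F τ φ x)
    (hF : ContinuousAt (fun p : E × E => F p.1 p.2) (x 0, x (0 - τ))) {t : ℝ} (ht : 0 ≤ t) :
    HasDerivWithinAt x (F (x t) (x (t - τ))) (Ici t) t := by
  rcases ht.eq_or_lt with rfl | ht
  · have hpos : ∀ᶠ t : ℝ in 𝓝[>] 0, 0 < t := self_mem_nhdsWithin
    refine hasDerivWithinAt_Ici_of_tendsto_deriv (s := Ioi 0)
      (fun t ht => (hx.2.2 t ht).differentiableAt.differentiableWithinAt) ?_
      self_mem_nhdsWithin ?_
    · exact (hx.1 0 (by simp [hτ.le])).mono (Ioi_subset_Ici (by linarith))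
    · have h1 : Tendsto x (𝓝[>] 0) (𝓝 (x 0)) :=
        (hx.1 0 (by simp [hτ.le])).mono (Ioi_subset_Ici (by linarith))
      have h2 : Tendsto (fun t => x (t - τ)) (𝓝[>] 0) (𝓝 (x (0 - τ))) := by
        refine (hx.1 (0 - τ) (by simp)).tendsto.comp (tendsto_nhdsWithin_iff.2 ⟨?_, ?_⟩)
        · exact ((continuous_id.sub continuous_const).tendsto 0).mono_left nhdsWithin_le_nhds
        · filter_upwards [hpos] with t ht
          rw [mem_Ici]; linarith
      refine Tendsto.congr' ?_ (hF.tendsto.comp (h1.prodMk_nhds h2))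
      filter_upwards [hpos] with t ht
      exact (hx.2.2 t ht).deriv.symm
  · exact (hx.2.2 t ht).hasDerivWithinAt

/-- The segments `x (n τ + ·)` of a solution follow the linear iteration by the monodromy operator
up to a quadratic error. -/
theorem exists_segments (c : Complexification E V) [CompleteSpace V] {F : E → E → E} {e : E}
    {L : E × E →L[ℝ] E} (hF : ContDiffAt ℝ 2 (fun p : E × E => F p.1 p.2) (e, e))
    (hL : HasFDerivAt (fun p : E × E => F p.1 p.2) L (e, e)) (he : F e e = 0) {τ : ℝ} (hτ : 0 < τ) :
    ∃ d > 0, ∃ K > 0, ∀ φ x, IsDDESolution F τ φ x → ∃ ξ : ℕ → C(Icc 0 τ, V),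
      (∀ n (t : Icc 0 τ), ξ n t = c.ι (x (t + (n - 1) * τ) - e)) ∧
      ∀ n a, 0 < a → a ≤ d → ‖ξ n‖ ≤ a →
        ‖ξ (n + 1) - monodromy (c.map (L.comp (.inl ℝ E E))) (c.map (L.comp (.inr ℝ E E)))
          hτ.le (ξ n)‖ ≤ K * a ^ 2 := by
  obtain ⟨d, hd, K, hK, hstep⟩ := exists_one_step_bound c hF hL he hτ.le
  have hcev : ∀ᶠ p in 𝓝 (e, e), ContinuousAt (fun p : E × E => F p.1 p.2) p := by
    filter_upwards [hF.eventually (by simp)] with p hp using hp.continuousAt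
  obtain ⟨d', hd', hball⟩ := Metric.nhds_basis_closedBall.mem_iff.1 hcev
  refine ⟨min d d', lt_min hd hd', K, hK, fun φ x hx => ?_⟩
  have hmaps : ∀ (n : ℕ) (t : ℝ), 0 ≤ t → t + ((n : ℝ) - 1) * τ ∈ Ici (-τ) := by
    intro n t ht
    have : (0 : ℝ) ≤ n * τ := by positivity
    rw [mem_Ici]; linarith
  have hcont : ∀ n : ℕ, ContinuousOn (fun t : ℝ => x (t + ((n : ℝ) - 1) * τ) - e) (Icc 0 τ) :=
    fun n => (hx.1.comp (by fun_prop) fun t ht => hmaps n t ht.1).sub continuousOn_const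
  -- The shift `n - 1` makes `ξ 0` the initial history.
  set ξ : ℕ → C(Icc 0 τ, V) := fun n =>
    ⟨fun t => c.ι (x (t + ((n : ℝ) - 1) * τ) - e),
      c.ι.continuous.comp (continuousOn_iff_continuous_domRestrict.1 (hcont n))⟩ with hξ
  have hξa : ∀ n (t : Icc 0 τ), ξ n t = c.ι (x (t + ((n : ℝ) - 1) * τ) - e) := fun _ _ => rfl
  refine ⟨ξ, hξa, fun n a ha had hna => ?_⟩
  have hnorm : ∀ t ∈ Icc 0 τ, ‖x (t + ((n : ℝ) - 1) * τ) - e‖ ≤ a := fun t ht => by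
    rw [← c.norm_ι, ← hξa n ⟨t, ht⟩]
    exact ((ξ n).norm_coe_le_norm _).trans hna
  have hright : ∀ t : ℝ, 0 ≤ t → HasDerivWithinAt x
      (F (x (t + n * τ)) (x (t + n * τ - τ))) (Ici (t + n * τ)) (t + n * τ) := by
    intro t ht
    -- At time `0` only the right derivative is available, and it needs continuity of `F` at `(x 0,
    -- x (-τ))`; this holds since a history smaller than `d'` keeps that point where `F` is
    -- continuous.
    rcases (show 0 ≤ t + n * τ by positivity).eq_or_lt with h0 | hpos
    · have hn0 : (n : ℝ) * τ = 0 := by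
        have : (0 : ℝ) ≤ n * τ := by positivity
        linarith
      refine hx.hasDerivWithinAt hτ (hball ?_) (by positivity)
      have h1 := hnorm τ ⟨hτ.le, le_rfl⟩
      have h2 := hnorm 0 ⟨le_rfl, hτ.le⟩
      rw [show τ + ((n : ℝ) - 1) * τ = 0 by linarith] at h1
      rw [show 0 + ((n : ℝ) - 1) * τ = 0 - τ by linarith] at h2
      rw [Metric.mem_closedBall, dist_eq_norm, Prod.mk_sub_mk]
      exact max_le (h1.trans (had.trans (min_le_right _ _)))
        (h2.trans (had.trans (min_le_right _ _)))
    · exact (hx.2.2 _ hpos).hasDerivWithinAt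
  have key := hstep (fun t => x (t + n * τ) - e) (fun t => x (t + ((n : ℝ) - 1) * τ) - e) (ξ n)
    ?_ ?_ (hξa n) a ha (had.trans (min_le_left _ _)) hna ?_
  · refine (ContinuousMap.norm_le _ (by positivity)).2 fun t => ?_
    have h1 := key t t.2
    rw [ContinuousMap.sub_apply, monodromy_apply, hξa]
    push_cast
    rw [add_sub_cancel_right]
    exact h1
  · have := hcont (n + 1)
    push_cast at this
    simpa only [add_sub_cancel_right] using this
  · show x (0 + n * τ) - e = x (τ + ((n : ℝ) - 1) * τ) - e
    congr 2
    ring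
  · intro t ht
    have h1 := hright t ht.1
    have h2 : HasDerivWithinAt (fun s : ℝ => s + n * τ) 1 (Ici t) t :=
      ((hasDerivAt_id t).add_const _).hasDerivWithinAt
    have h3 := (h1.scomp t h2 fun s hs => by
      have : t ≤ s := hs
      rw [mem_Ici]; linarith).sub_const e
    rw [one_smul] at h3
    simp only [add_sub_cancel]
    rw [show t + ((n : ℝ) - 1) * τ = t + n * τ - τ by ring]
    exact h3

end OneStep

/-! ### Linearised stability and instability. -/

section Linearization

theorem nontrivial_history {V : Type*} [NormedAddCommGroup V] [Nontrivial V] {τ : ℝ}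
    (hτ : 0 ≤ τ) : Nontrivial C(Icc 0 τ, V) := by
  obtain ⟨v, hv⟩ := exists_ne (0 : V)
  refine ⟨⟨ContinuousMap.const _ v, 0, fun h => hv ?_⟩⟩
  exact congrArg (fun f : C(Icc 0 τ, V) => f ⟨0, le_rfl, hτ⟩) h

variable {E V : Type*} [NormedAddCommGroup E] [NormedSpace ℝ E]
    [NormedAddCommGroup V] [NormedSpace ℂ V]

/-- The spectral radius is attained. The instability proof needs such a value of maximal modulus,
not merely one of modulus above `1`. -/
theorem exists_spectral_bound [CompleteSpace V] [Nontrivial V] (A B : V →L[ℂ] V) {τ : ℝ}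
    (hτ : 0 ≤ τ) : ∃ μ ∈ spectrum ℂ (monodromy A B hτ),
      (∀ ν ∈ spectrum ℂ (monodromy A B hτ), ‖ν‖ ≤ ‖μ‖) ∧
      ∀ ρ, ‖μ‖ < ρ → ∃ C > 0, ∀ n, ‖monodromy A B hτ ^ n‖ ≤ C * ρ ^ n := by
  have := nontrivial_history (V := V) hτ
  obtain ⟨μ, hμ, hr⟩ := spectrum.exists_nnnorm_eq_spectralRadius (monodromy A B hτ)
  refine ⟨μ, hμ, fun ν hν => ?_, fun ρ hρ => ?_⟩
  · have h1 : (‖ν‖₊ : ENNReal) ≤ spectralRadius ℂ (monodromy A B hτ) :=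
      le_iSup₂ (f := fun k (_ : k ∈ spectrum ℂ (monodromy A B hτ)) => (‖k‖₊ : ENNReal)) ν hν
    rw [← hr] at h1
    exact_mod_cast h1
  · have hρ0 : 0 < ρ := (norm_nonneg _).trans_lt hρ
    refine exists_norm_pow_le (monodromy A B hτ) hρ0 ?_
    rw [← hr, ← enorm_eq_nnnorm, ← ofReal_norm]
    exact (ENNReal.ofReal_lt_ofReal_iff hρ0).2 hρ

theorem exists_segment {τ : ℝ} (hτ : 0 < τ) {t : ℝ} (ht : 0 ≤ t) :
    ∃ s ∈ Icc 0 τ, t = s + (((⌊t / τ⌋₊ + 1 : ℕ) : ℝ) - 1) * τ := by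
  have h1 := Nat.floor_le (div_nonneg ht hτ.le)
  have h2 := Nat.lt_floor_add_one (t / τ)
  rw [le_div_iff₀ hτ] at h1
  rw [div_lt_iff₀ hτ] at h2
  refine ⟨t - ⌊t / τ⌋₊ * τ, ⟨by linarith, by linarith⟩, ?_⟩
  push_cast
  ring

/-- Linearised stability: a priori bound for all solutions with history close to the equilibrium. -/
theorem exists_forall_solution_small (c : Complexification E V) [FiniteDimensional ℂ V]
    [CompleteSpace V] [Nontrivial V] {F : E → E → E} {e : E}
    {L : E × E →L[ℝ] E} (hF : ContDiffAt ℝ 2 (fun p : E × E => F p.1 p.2) (e, e))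
    (hL : HasFDerivAt (fun p : E × E => F p.1 p.2) L (e, e)) (he : F e e = 0) {τ : ℝ} (hτ : 0 < τ)
    (hst : LinearlyStable F τ e) {ε : ℝ} (hε : 0 < ε) :
    ∃ δ > 0, ∀ φ : ℝ → E, IsNearHistory τ e δ φ → ∀ x, IsDDESolution F τ φ x →
      (∀ t, 0 ≤ t → ‖x t - e‖ < ε) ∧ Tendsto x atTop (𝓝 e) := by
  obtain ⟨d, hd, K, hK, hseg⟩ := exists_segments c hF hL he hτ
  set A := c.map (L.comp (.inl ℝ E E))
  set B := c.map (L.comp (.inr ℝ E E))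
  obtain ⟨μ, hμ, -, hpow⟩ := exists_spectral_bound A B hτ.le
  have hμ1 : ‖μ‖ < 1 := by
    by_cases h0 : μ = 0
    · rw [h0, norm_zero]; exact one_pos
    · obtain ⟨z, v, hzv, hexp⟩ := exists_eigenpair_of_mem_spectrum A B hτ.le h0 hμ
      have hre : z.re < 0 := hst z ((c.isCharacteristicRoot_iff hL z).2 ⟨v, hzv.1, hzv.2⟩)
      rw [← hexp, Complex.norm_exp, Real.exp_lt_one_iff, Complex.re_mul_ofReal]
      exact mul_neg_of_neg_of_pos hre hτ
  set ρ := (1 + ‖μ‖) / 2 with hρ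
  have hρ0 : 0 < ρ := by positivity
  have hρ1 : ρ < 1 := by linarith
  obtain ⟨C, hC, hT⟩ := hpow ρ (by linarith)
  -- Chosen below `1` with `s² - ρ = ((1 - ρ) / 2)² > 0`, so that quadratic errors decay at a
  -- controlled rate.
  set s := (1 + ρ) / 2 with hs
  have hs0 : 0 < s := by positivity
  have hs1 : s < 1 := by linarith
  have hρs : ρ < s ^ 2 := by nlinarith [sq_pos_of_pos (sub_pos.2 hρ1)]
  have hρs' : ρ ≤ s := by linarith
  obtain ⟨c₀, hc₀, hsh⟩ := exists_norm_sub_pow_le (monodromy A B hτ.le) hC hρ0 hs0 hρs hK hd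
    one_pos le_rfl hT
  set δ := min (c₀ / C) (ε / (4 * C)) with hδ
  have hδ0 : 0 < δ := by positivity
  have hδ1 : C * δ ≤ c₀ := by
    have : δ ≤ c₀ / C := min_le_left _ _
    rw [le_div_iff₀ hC] at this; linarith
  have hδ2 : 4 * C * δ ≤ ε := by
    have : δ ≤ ε / (4 * C) := min_le_right _ _
    rw [le_div_iff₀ (by positivity)] at this; linarith
  refine ⟨δ, hδ0, fun φ hφ x hx => ?_⟩
  obtain ⟨ξ, hξ, hstep⟩ := hseg φ x hx
  have hξ0 : ‖ξ 0‖ ≤ δ := by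
    refine (ContinuousMap.norm_le _ hδ0.le).2 fun t => ?_
    rw [hξ, c.norm_ι]
    have hm : (t : ℝ) + (((0 : ℕ) : ℝ) - 1) * τ ∈ Icc (-τ) 0 := by
      push_cast
      constructor <;> linarith [t.2.1, t.2.2]
    rw [hx.2.1 hm]
    exact (hφ.2 _ hm).le
  have hpow1 : ∀ n : ℕ, s ^ n ≤ 1 := fun n => pow_le_one₀ hs0.le hs1.le
  have hlin : ∀ n, ‖(monodromy A B hτ.le ^ n) (ξ 0)‖ ≤ C * δ * s ^ n := fun n => by
    calc _ ≤ ‖monodromy A B hτ.le ^ n‖ * ‖ξ 0‖ := ContinuousLinearMap.le_opNorm _ _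
      _ ≤ (C * s ^ n) * δ := by
        gcongr
        exact (hT n).trans (by gcongr)
      _ = _ := by ring
  have hξn : ∀ n, ‖ξ n‖ ≤ 2 * (C * δ) * s ^ n := by
    intro n
    have h1 := hsh ξ hstep (C * δ) (by positivity) n
      (fun m _ => ⟨(mul_le_of_le_one_right (by positivity) (hpow1 m)).trans hδ1, hlin m⟩) n le_rfl
    have h2 : ‖ξ n‖ ≤ ‖ξ n - (monodromy A B hτ.le ^ n) (ξ 0)‖ +
        ‖(monodromy A B hτ.le ^ n) (ξ 0)‖ := by
      simpa using norm_add_le (ξ n - (monodromy A B hτ.le ^ n) (ξ 0))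
        ((monodromy A B hτ.le ^ n) (ξ 0))
    linarith [hlin n]
  have hxt : ∀ t, 0 ≤ t → ‖x t - e‖ ≤ 2 * (C * δ) * s ^ (⌊t / τ⌋₊ + 1) := by
    intro t ht
    obtain ⟨r, hr, htr⟩ := exists_segment hτ ht
    have h1 := hξ (⌊t / τ⌋₊ + 1) ⟨r, hr⟩
    simp only at h1
    rw [← htr] at h1
    rw [← c.norm_ι, ← h1]
    exact ((ξ _).norm_coe_le_norm _).trans (hξn _)
  constructor
  · intro t ht
    refine (hxt t ht).trans_lt ?_
    have : 2 * (C * δ) * s ^ (⌊t / τ⌋₊ + 1) ≤ 2 * (C * δ) * 1 := by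
      gcongr; exact hpow1 _
    have : 0 < C * δ := by positivity
    linarith
  · rw [tendsto_iff_norm_sub_tendsto_zero]
    refine squeeze_zero' (Eventually.of_forall fun t => norm_nonneg _)
      ((eventually_ge_atTop 0).mono hxt) ?_
    rw [← mul_zero (2 * (C * δ))]
    refine Tendsto.const_mul _ ((tendsto_pow_atTop_nhds_zero_of_lt_one hs0.le hs1).comp ?_)
    exact (tendsto_add_atTop_nat 1).comp
      (tendsto_nat_floor_atTop.comp (tendsto_id.atTop_div_const hτ))

/-- The principle of linearised stability. -/
theorem LinearlyStable.locallyAsymptoticallyStable (c : Complexification E V)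
    [FiniteDimensional ℂ V] [CompleteSpace V] [Nontrivial V] [FiniteDimensional ℝ E]
    [CompleteSpace E] {F : E → E → E} {e : E}
    {L : E × E →L[ℝ] E} (hF : ContDiffAt ℝ 2 (fun p : E × E => F p.1 p.2) (e, e))
    (hL : HasFDerivAt (fun p : E × E => F p.1 p.2) L (e, e)) (he : F e e = 0) {τ : ℝ} (hτ : 0 < τ)
    (hst : LinearlyStable F τ e) : LocallyAsymptoticallyStable F τ e := by
  refine ⟨fun ε hε => ?_, ?_⟩
  swap
  · obtain ⟨δ, hδ, h⟩ := exists_forall_solution_small c hF hL he hτ hst one_pos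
    exact ⟨δ, hδ, fun φ hφ x hx => (h φ hφ x hx).2⟩
  obtain ⟨δ₁, hδ₁, h₁⟩ := exists_forall_solution_small c hF hL he hτ hst hε
  -- For existence, `F` is replaced by a globally Lipschitz `G` that agrees with it near the
  -- equilibrium. `G` has the same linearisation, so its solutions with small history stay where the
  -- two fields agree, and hence solve the original equation.
  obtain ⟨K, t, ht, hK⟩ := (hF.of_le (by norm_num)).exists_lipschitzOnWith
  obtain ⟨g, hg, hgF⟩ := hK.extend_finite_dimension
  obtain ⟨r, hr, hball⟩ := Metric.nhds_basis_closedBall.mem_iff.1 ht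
  set G : E → E → E := fun p q => g (p, q) with hG
  have hev : (fun p : E × E => G p.1 p.2) =ᶠ[𝓝 (e, e)] fun p : E × E => F p.1 p.2 := by
    filter_upwards [ht] with p hp using (hgF hp).symm
  have hGL : HasFDerivAt (fun p : E × E => G p.1 p.2) L (e, e) := hL.congr_of_eventuallyEq hev
  have hGst : LinearlyStable G τ e := fun z hz => hst z <|
    (c.isCharacteristicRoot_iff hL z).2 ((c.isCharacteristicRoot_iff hGL z).1 hz)
  obtain ⟨δ₂, hδ₂, h₂⟩ := exists_forall_solution_small c (hF.congr_of_eventuallyEq hev) hGL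
    (hev.eq_of_nhds.trans he) hτ hGst hr
  refine ⟨min δ₁ (min δ₂ r), by positivity, fun φ hφ => ⟨?_, fun x hx => (h₁ φ ⟨hφ.1, fun θ hθ =>
    (hφ.2 θ hθ).trans_le (min_le_left _ _)⟩ x hx).1⟩⟩
  obtain ⟨x, hx⟩ := exists_isDDESolution (G := G) hg hτ.le hφ.1
  have hsmall := (h₂ φ ⟨hφ.1, fun θ hθ => (hφ.2 θ hθ).trans_le
    ((min_le_right _ _).trans (min_le_left _ _))⟩ x hx).1
  have hsmall' : ∀ s, -τ ≤ s → ‖x s - e‖ < r := by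
    intro s hs
    rcases le_total 0 s with h0 | h0
    · exact hsmall s h0
    · rw [hx.2.1 ⟨hs, h0⟩]
      exact (hφ.2 s ⟨hs, h0⟩).trans_le ((min_le_right _ _).trans (min_le_right _ _))
  refine ⟨x, hx.1, hx.2.1, fun s hs => ?_⟩
  have hmem : (x s, x (s - τ)) ∈ t := hball <| by
    rw [Metric.mem_closedBall, dist_eq_norm, Prod.mk_sub_mk]
    exact max_le (hsmall' s (by linarith)).le (hsmall' (s - τ) (by linarith)).le
  have : F (x s) (x (s - τ)) = G (x s) (x (s - τ)) := hgF hmem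
  rw [this]
  exact hx.2.2 s hs

/-- The pointwise real part of a history, as a complex history. -/
noncomputable def Complexification.realPart (c : Complexification E V) {τ : ℝ}
    (φ : C(Icc 0 τ, V)) : C(Icc 0 τ, V) :=
  ⟨fun t => c.ι (c.re (φ t)), by fun_prop⟩

theorem Complexification.norm_realPart_le (c : Complexification E V) {τ : ℝ}
    (φ : C(Icc 0 τ, V)) : ‖c.realPart φ‖ ≤ ‖φ‖ :=
  (ContinuousMap.norm_le _ (norm_nonneg _)).2 fun t =>
    (c.norm_ι _).trans_le ((c.norm_re _).trans (φ.norm_coe_le_norm t))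

/-- The real part of `I • φ` is minus the imaginary part of `φ`. So either `φ` or `I • φ` has a real
part of at least half the norm. -/
theorem Complexification.norm_le_realPart_add (c : Complexification E V) {τ : ℝ}
    (φ : C(Icc 0 τ, V)) : ‖φ‖ ≤ ‖c.realPart φ‖ + ‖c.realPart (Complex.I • φ)‖ := by
  refine (ContinuousMap.norm_le _ (by positivity)).2 fun t => (c.norm_le_re_add_im _).trans ?_
  refine add_le_add ?_ ?_
  · rw [← c.norm_ι]; exact (c.realPart φ).norm_coe_le_norm t
  · have h := (c.realPart (Complex.I • φ)).norm_coe_le_norm t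
    have h2 : c.realPart (Complex.I • φ) t = c.ι (c.re (Complex.I • φ t)) := rfl
    rwa [h2, c.norm_ι, c.re_I_smul, norm_neg] at h

/-- The coefficients are real, so the real part of a solution is a solution. -/
theorem Complexification.monodromy_realPart [CompleteSpace V] (c : Complexification E V)
    (A B : E →L[ℝ] E) {τ : ℝ} (hτ : 0 ≤ τ) (φ : C(Icc 0 τ, V)) :
    monodromy (c.map A) (c.map B) hτ (c.realPart φ) =
      c.realPart (monodromy (c.map A) (c.map B) hτ φ) := by
  have hd := fun t => (c.ι.comp c.re).hasFDerivAt.comp_hasDerivAt t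
    (hasDerivAt_delaySolution (c.map A) (c.map B) hτ φ t)
  ext ⟨t, ht⟩
  refine delaySolution_eq (c.map A) (c.map B) hτ
    (fun t _ => (hd t).continuousAt.continuousWithinAt)
    (fun t _ => (hd t).hasDerivWithinAt.congr_deriv ?_) ?_ ht
  · have h1 : ∀ s, c.realPart φ s = c.ι (c.re (φ s)) := fun _ => rfl
    simp only [h1, ContinuousLinearMap.comp_apply, Function.comp_apply, map_add, c.map_ι, c.re_map]
  · rw [Function.comp_apply, delaySolution_zero]
    rfl

/-- The principle of linearised instability. -/
theorem not_lyapunovStable_of_isCharacteristicRoot (c : Complexification E V)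
    [FiniteDimensional ℂ V] [CompleteSpace V] [Nontrivial V] {F : E → E → E} {e : E}
    {L : E × E →L[ℝ] E} (hF : ContDiffAt ℝ 2 (fun p : E × E => F p.1 p.2) (e, e))
    (hL : HasFDerivAt (fun p : E × E => F p.1 p.2) L (e, e)) (he : F e e = 0) {τ : ℝ} (hτ : 0 < τ)
    {z : ℂ} (hz : IsCharacteristicRoot F τ e z) (hre : 0 < z.re) : ¬ LyapunovStable F τ e := by
  intro hstab
  obtain ⟨d, hd, K, hK, hseg⟩ := exists_segments c hF hL he hτ
  set T := monodromy (c.map (L.comp (.inl ℝ E E))) (c.map (L.comp (.inr ℝ E E))) hτ.le with hTdef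
  have hw0 : ∀ (z : ℂ) (v : V), v ≠ 0 → expHistory τ z v ≠ 0 := by
    intro z v hv h0
    have h1 : expHistory τ z v ⟨0, le_rfl, hτ.le⟩ = 0 := by rw [h0]; rfl
    apply hv
    simpa [expHistory] using h1
  -- The given root only serves to show `r > 1`. The orbit is started along an eigenvector of
  -- maximal modulus, since then the powers of `T` are bounded with the base `(r + r²) / 2`, which
  -- lies strictly between `r` and `r²`.
  obtain ⟨μ, hμ, hμmax, hpow⟩ := exists_spectral_bound (c.map (L.comp (.inl ℝ E E)))
    (c.map (L.comp (.inr ℝ E E))) hτ.le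
  set r := ‖μ‖ with hr
  have hr1 : 1 < r := by
    obtain ⟨v, hv, hzv⟩ := (c.isCharacteristicRoot_iff hL z).1 hz
    have h1 := monodromy_expHistory _ _ hτ.le (⟨hv, hzv⟩ : IsDelayEigenpair _ _ τ z v)
    have h2 : Complex.exp (z * τ) ∈ spectrum ℂ T := by
      rw [spectrum.mem_iff, ContinuousLinearMap.isUnit_iff_bijective]
      intro hbij
      apply hw0 z v hv
      apply hbij.1
      rw [map_zero, sub_apply, h1, Algebra.algebraMap_eq_smul_one]
      exact sub_self _
    refine lt_of_lt_of_le ?_ (hμmax _ h2)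
    rw [Complex.norm_exp, Real.one_lt_exp_iff, Complex.re_mul_ofReal]
    exact mul_pos hre hτ
  have hr0 : 0 < r := by linarith
  have hμ0 : μ ≠ 0 := norm_pos_iff.1 hr0
  obtain ⟨z', v, hzv, hexp⟩ := exists_eigenpair_of_mem_spectrum _ _ hτ.le hμ0 hμ
  set w := expHistory τ z' v with hw
  have hTw : T w = μ • w := by rw [hTdef, monodromy_expHistory _ _ hτ.le hzv, hexp]
  have hwpos : 0 < ‖w‖ := norm_pos_iff.2 (hw0 z' v hzv.1)
  obtain ⟨C, hC, hT⟩ := hpow ((r + r ^ 2) / 2) (by nlinarith)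
  obtain ⟨c₀, hc₀, hsh⟩ := exists_norm_sub_pow_le T (s := r) (η := 1 / 4) hC (by positivity) hr0
    (by nlinarith) hK hd (by norm_num) (by norm_num) hT
  obtain ⟨δ, hδ, hst⟩ := hstab (c₀ / (4 * r)) (by positivity)
  -- Initial amplitude. `N` is the last step with `ε r ^ N ≤ c₀`, so `ε r ^ N > c₀ / r`. The real
  -- linear orbit then has size at least `ε r ^ N / 2` and the error is at most half of that, so the
  -- solution exceeds `c₀ / (4 r)`, the radius used for stability. As `ε r ≤ c₀`, `N` is positive
  -- and segment `N` lies in nonnegative time.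
  set ε := min (δ / 2) (c₀ / r) with hε
  have hε0 : 0 < ε := by positivity
  have hεδ : ε < δ := (min_le_left _ _).trans_lt (by linarith)
  have hεc : ε * r ≤ c₀ := (le_div_iff₀ hr0).1 (min_le_right _ _)
  obtain ⟨N, hN1, hN2⟩ := exists_nat_pow_near
    (show 1 ≤ c₀ / ε by rw [le_div_iff₀ hε0]; nlinarith) hr1
  rw [le_div_iff₀ hε0] at hN1
  rw [div_lt_iff₀ hε0] at hN2
  have hN0 : N ≠ 0 := by
    rintro rfl
    simp only [zero_add, pow_one] at hN2
    linarith
  have hTpow : ∀ (u : C(Icc 0 τ, V)), T u = μ • u → ∀ n, (T ^ n) (c.realPart u) =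
      c.realPart (μ ^ n • u) := by
    intro u hu n
    induction n with
    | zero => simp
    | succ n ih =>
      rw [pow_succ', mul_apply_eq_comp, ih, hTdef, c.monodromy_realPart,
        ← hTdef, map_smul, hu, smul_smul, ← pow_succ]
  -- Histories must be real, and the real part of the eigenvector may have rotated to a small one at
  -- step `N`; multiplication by `I` repairs this.
  obtain ⟨u, hu, hunorm, hubig⟩ : ∃ u : C(Icc 0 τ, V), T u = μ • u ∧ ‖u‖ = ε ∧
      ε * r ^ N / 2 ≤ ‖c.realPart (μ ^ N • u)‖ := by
    set u : C(Icc 0 τ, V) := ((ε / ‖w‖ : ℝ) : ℂ) • w with hu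
    have hTu : T u = μ • u := by rw [hu, map_smul, hTw, smul_comm]
    have hun : ‖u‖ = ε := by
      rw [hu, norm_smul, Complex.norm_real, Real.norm_eq_abs, abs_of_pos (by positivity)]
      field_simp
    have h1 := c.norm_le_realPart_add (μ ^ N • u)
    rw [norm_smul, norm_pow, hun, ← hr, smul_comm Complex.I] at h1
    by_cases hcase : ε * r ^ N / 2 ≤ ‖c.realPart (μ ^ N • u)‖
    · exact ⟨u, hTu, hun, hcase⟩
    · refine ⟨Complex.I • u, by rw [map_smul, hTu, smul_comm], ?_, ?_⟩
      · rw [norm_smul, Complex.norm_I, one_mul, hun]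
      · linarith
  have hhist : IsNearHistory τ e δ fun θ => e + c.re (u (projIcc 0 τ hτ.le (θ + τ))) := by
    refine ⟨?_, fun θ _ => ?_⟩
    · have := continuous_extend hτ.le u
      fun_prop
    · rw [add_sub_cancel_left]
      exact ((c.norm_re _).trans (u.norm_coe_le_norm _)).trans_lt (hunorm.trans_lt hεδ)
  obtain ⟨⟨x, hx⟩, hall⟩ := hst _ hhist
  have hxsmall := hall x hx
  obtain ⟨ξ, hξ, hstep⟩ := hseg _ x hx
  have hξ0 : ξ 0 = c.realPart u := by
    ext t
    rw [hξ]
    have hm : (t : ℝ) + (((0 : ℕ) : ℝ) - 1) * τ ∈ Icc (-τ) 0 := by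
      push_cast
      constructor <;> linarith [t.2.1, t.2.2]
    rw [hx.2.1 hm]
    simp only
    rw [add_sub_cancel_left, show (t : ℝ) + (((0 : ℕ) : ℝ) - 1) * τ + τ = t by push_cast; ring,
      projIcc_val]
    rfl
  have hlin : ∀ n, ‖(T ^ n) (ξ 0)‖ ≤ ε * r ^ n := fun n => by
    rw [hξ0, hTpow u hu]
    refine (c.norm_realPart_le _).trans_eq ?_
    rw [norm_smul, norm_pow, hunorm, mul_comm]
  have hcmp := hsh ξ hstep ε hε0 N (fun n hn => ⟨?_, hlin n⟩) N le_rfl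
  · have h1 : ‖ξ N‖ ≤ c₀ / (4 * r) := by
      refine (ContinuousMap.norm_le _ (by positivity)).2 fun t => ?_
      rw [hξ, c.norm_ι]
      refine (hxsmall _ ?_).le
      have : (1 : ℝ) ≤ N := by exact_mod_cast Nat.one_le_iff_ne_zero.2 hN0
      have := t.2.1
      nlinarith
    have h2 : ‖(T ^ N) (ξ 0)‖ ≤ ‖ξ N‖ + ‖ξ N - (T ^ N) (ξ 0)‖ := by
      simpa using norm_sub_le (ξ N) (ξ N - (T ^ N) (ξ 0))
    have h3 : ε * r ^ N / 2 ≤ ‖(T ^ N) (ξ 0)‖ := by rw [hξ0, hTpow u hu]; exact hubig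
    have h4 : ε * r ^ N / 4 ≤ c₀ / (4 * r) := by linarith
    rw [le_div_iff₀ (by positivity)] at h4
    rw [pow_succ] at hN2
    linarith
  · calc ε * r ^ n ≤ ε * r ^ N := by gcongr; exact hr1.le
      _ ≤ c₀ := by linarith

end Linearization

/-! ### Characteristic equations as scalar determinants. -/

section LinearAlgebra

/-- The characteristic equation of a planar delay equation. -/
theorem isCharacteristicRoot_prod_iff {F : ℝ × ℝ → ℝ × ℝ → ℝ × ℝ} {τ : ℝ} {e : ℝ × ℝ}
    {L : (ℝ × ℝ) × (ℝ × ℝ) →L[ℝ] ℝ × ℝ}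
    (hF : HasFDerivAt (fun p : (ℝ × ℝ) × (ℝ × ℝ) => F p.1 p.2) L (e, e))
    {a₁ a₂ a₃ a₄ b₁ b₂ b₃ b₄ : ℝ}
    (hL : ∀ x y : ℝ × ℝ, L (x, y) = (a₁ * x.1 + a₂ * x.2 + (b₁ * y.1 + b₂ * y.2),
      a₃ * x.1 + a₄ * x.2 + (b₃ * y.1 + b₄ * y.2))) (z : ℂ) :
    IsCharacteristicRoot F τ e z ↔
      (z - a₁ - Complex.exp (-z * τ) * b₁) * (z - a₄ - Complex.exp (-z * τ) * b₄) -
        (a₂ + Complex.exp (-z * τ) * b₂) * (a₃ + Complex.exp (-z * τ) * b₃) = 0 := by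
  rw [Complexification.realProd.isCharacteristicRoot_iff hF]
  set s := Complex.exp (-z * τ)
  have hmap : ∀ (A : ℝ × ℝ →L[ℝ] ℝ × ℝ) (m₁ m₂ m₃ m₄ : ℝ),
      (∀ x, A x = (m₁ * x.1 + m₂ * x.2, m₃ * x.1 + m₄ * x.2)) → ∀ v : ℂ × ℂ,
      Complexification.realProd.map A v = (m₁ * v.1 + m₂ * v.2, m₃ * v.1 + m₄ * v.2) := by
    intro A m₁ m₂ m₃ m₄ hA v
    rw [Complexification.map_apply, hA, hA]
    ext : 1 <;> apply Complex.ext <;> simp [Complexification.realProd]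
  have hA := hmap (L.comp (.inl ℝ (ℝ × ℝ) (ℝ × ℝ))) a₁ a₂ a₃ a₄ fun x => by simp [hL]
  have hB := hmap (L.comp (.inr ℝ (ℝ × ℝ) (ℝ × ℝ))) b₁ b₂ b₃ b₄ fun x => by simp [hL]
  have hdet := Matrix.exists_mulVec_eq_zero_iff
    (M := !![z - a₁ - s * b₁, -(a₂ + s * b₂); -(a₃ + s * b₃), z - a₄ - s * b₄])
  rw [Matrix.det_fin_two_of, neg_mul_neg] at hdet
  rw [← hdet]
  constructor
  · rintro ⟨v, hv, h⟩
    rw [hA, hB] at h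
    have h1 := congrArg Prod.fst h
    have h2 := congrArg Prod.snd h
    simp at h1 h2
    refine ⟨![v.1, v.2], fun h0 => hv ?_, ?_⟩
    · ext : 1
      · exact congrFun h0 0
      · exact congrFun h0 1
    · ext i
      fin_cases i
      · simp [Matrix.mulVec, dotProduct]
        linear_combination h1
      · simp [Matrix.mulVec, dotProduct]
        linear_combination h2
  · rintro ⟨v, hv, h⟩
    refine ⟨(v 0, v 1), fun h0 => hv ?_, ?_⟩
    · ext i
      fin_cases i
      · exact congrArg Prod.fst h0
      · exact congrArg Prod.snd h0
    · have h1 := congrFun h 0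
      have h2 := congrFun h 1
      simp [Matrix.mulVec, dotProduct] at h1 h2
      rw [hA, hB]
      ext : 1
      · simp; linear_combination h1
      · simp; linear_combination h2

/-- The characteristic equation of a scalar delay equation. -/
theorem isCharacteristicRoot_real_iff {F : ℝ → ℝ → ℝ} {τ e : ℝ} {L : ℝ × ℝ →L[ℝ] ℝ}
    (hF : HasFDerivAt (fun p : ℝ × ℝ => F p.1 p.2) L (e, e)) {a b : ℝ}
    (hL : ∀ x y : ℝ, L (x, y) = a * x + b * y) (z : ℂ) :
    IsCharacteristicRoot F τ e z ↔ z - a - Complex.exp (-z * τ) * b = 0 := by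
  rw [Complexification.real.isCharacteristicRoot_iff hF]
  have hmap : ∀ (A : ℝ →L[ℝ] ℝ) (m : ℝ), (∀ x, A x = m * x) → ∀ v : ℂ,
      Complexification.real.map A v = m * v := by
    intro A m hA v
    rw [Complexification.map_apply, hA, hA]
    apply Complex.ext <;> simp [Complexification.real]
  have hA := hmap (L.comp (.inl ℝ ℝ ℝ)) a fun x => by simp [hL]
  have hB := hmap (L.comp (.inr ℝ ℝ ℝ)) b fun x => by simp [hL]
  simp only [hA, hB, smul_eq_mul]
  constructor
  · rintro ⟨v, hv, h⟩
    apply mul_right_cancel₀ hv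
    linear_combination h
  · intro h
    exact ⟨1, one_ne_zero, by linear_combination h⟩

end LinearAlgebra

/-! ### Smoothness and linearisation of the fluid model. -/

section Model

theorem HasDerivAt.dropTailLoss {r : ℝ → ℝ} {r' t : ℝ} (hr : HasDerivAt r r' t) (C : ℝ) (B : ℕ) :
    HasDerivAt (fun t => dropTailLoss C B (r t)) (B / C ^ B * r t ^ (B - 1) * r') t := by
  unfold _root_.dropTailLoss
  refine ((hr.div_const C).fun_pow B).congr_deriv ?_
  rcases B with _ | B
  · simp
  · simp only [Nat.add_sub_cancel, div_pow, pow_succ C]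
    ring

/-- Derivative of the right-hand side for one set of flows along a curve through an equilibrium. -/
theorem HasDerivAt.windowRate {κ α β k τ W l₀ : ℝ} {w v l : ℝ → ℝ} {w' v' l' t : ℝ}
    (hw : HasDerivAt w w' t) (hv : HasDerivAt v v' t) (hl : HasDerivAt l l' t)
    (hW : 0 < W) (hwt : w t = W) (hvt : v t = W) (hlt : l t = l₀)
    (heq : α * W ^ (k - 1) * (1 - l₀) - β * W * l₀ = 0) :
    HasDerivAt (fun t => windowRate κ α β k τ (w t) (v t) (l t))
      (-κ * (-(α / τ) * (k - 2) * W ^ (k - 1) * (1 - l₀) * w' +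
        (α * W ^ (k - 1) + β * W) * (W / τ * l'))) t := by
  unfold _root_.windowRate
  have hp : HasDerivAt (fun t => w t ^ (k - 1)) (w' * (k - 1) * w t ^ (k - 1 - 1)) t :=
    hw.rpow_const (Or.inl (by rw [hwt]; exact hW.ne'))
  have h := ((hv.div_const τ).const_mul κ).fun_mul (((hp.const_mul α).fun_mul (hl.const_sub 1)).fun_sub
    ((hw.const_mul β).fun_mul hl))
  refine h.congr_deriv ?_
  -- The bracket vanishes at the equilibrium, so the delayed factor in front contributes nothing.
  -- The equilibrium equation then trades `β l₀` for `α W ^ (k - 2) (1 - l₀)`, turning `k - 1` into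
  -- `k - 2`.
  rw [hwt, hvt, hlt, heq]
  have hpow : W * W ^ (k - 1 - 1) = W ^ (k - 1) := by
    rw [Real.rpow_sub_one hW.ne' (k - 1)]
    field_simp
  linear_combination (κ / τ * α * (1 - l₀) * w' * (k - 1)) * hpow + κ / τ * w' * heq

theorem ContDiffAt.windowRate {P : Type*} [NormedAddCommGroup P] [NormedSpace ℝ P]
    {κ α β k τ : ℝ} {w v l : P → ℝ} {p : P} {n : WithTop ℕ∞} (hw : ContDiffAt ℝ n w p)
    (hv : ContDiffAt ℝ n v p) (hl : ContDiffAt ℝ n l p) (h0 : w p ≠ 0) :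
    ContDiffAt ℝ n (fun p => windowRate κ α β k τ (w p) (v p) (l p)) p := by
  unfold _root_.windowRate
  have := hw.rpow_const_of_ne (p := k - 1) h0
  exact (contDiffAt_const.mul (hv.div_const τ)).mul
    (((contDiffAt_const.mul this).mul (contDiffAt_const.sub hl)).sub
      ((contDiffAt_const.mul hw).mul hl))

theorem ContDiffAt.dropTailLoss {P : Type*} [NormedAddCommGroup P] [NormedSpace ℝ P]
    {r : P → ℝ} {p : P} {n : WithTop ℕ∞} (hr : ContDiffAt ℝ n r p) (C : ℝ) (B : ℕ) :
    ContDiffAt ℝ n (fun p => dropTailLoss C B (r p)) p :=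
  (hr.div_const C).pow B

theorem ContDiffAt.twoFlowRate {P : Type*} [NormedAddCommGroup P] [NormedSpace ℝ P]
    {κ α β k : ℝ} {N : Network} {T : Topology3} {w₁ w₂ v₁ v₂ : P → ℝ} {p : P} {n : WithTop ℕ∞}
    (hw₁ : ContDiffAt ℝ n w₁ p) (hw₂ : ContDiffAt ℝ n w₂ p)
    (hv₁ : ContDiffAt ℝ n v₁ p) (hv₂ : ContDiffAt ℝ n v₂ p) (h₁ : w₁ p ≠ 0) (h₂ : w₂ p ≠ 0) :
    ContDiffAt ℝ n (fun p => twoFlowRate κ α β k N T (w₁ p) (w₂ p) (v₁ p) (v₂ p)) p := by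
  have hr : ContDiffAt ℝ n (fun p => N.rate (v₁ p) (v₂ p)) p :=
    (hv₁.div_const _).add (hv₂.div_const _)
  refine ContDiffAt.prodMk (hw₁.windowRate hv₁ ?_ h₁) (hw₂.windowRate hv₂ ?_ h₂)
  · cases T
    · exact hr.dropTailLoss _ _
    · exact (hr.dropTailLoss _ _).add (hr.dropTailLoss _ _)
    · exact ((hv₁.div_const _).dropTailLoss _ _).add (hr.dropTailLoss _ _)
  · cases T
    · exact hr.dropTailLoss _ _
    · exact (hr.dropTailLoss _ _).add (hr.dropTailLoss _ _)
    · exact ((hv₂.div_const _).dropTailLoss _ _).add (hr.dropTailLoss _ _)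

theorem mul_edge_deriv {τ C W w' : ℝ} (hτ : 0 < τ) (hC : 0 < C) {B : ℕ} (hB : 0 < B) :
    W / τ * (B / C ^ B * (W / τ) ^ (B - 1) * (w' / τ)) = B / τ * (W / (C * τ)) ^ B * w' := by
  obtain ⟨b, rfl⟩ := Nat.exists_eq_succ_of_ne_zero hB.ne'
  simp only [Nat.succ_eq_add_one, Nat.add_sub_cancel, div_pow, mul_pow, pow_succ]
  field_simp

/-- Stated with the factor `W₁ / n.τ₁` with which the derivative of the loss enters the linearised
window equation; the two terms give `N₁` and `P₁`. -/
theorem Network.hasDerivAt_loss₁ {n : Network} (hn : n.Positive) (T : Topology3) {v₁ v₂ : ℝ → ℝ}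
    {v₁' v₂' t W₁ W₂ : ℝ} (hv₁ : HasDerivAt v₁ v₁' t) (hv₂ : HasDerivAt v₂ v₂' t)
    (h₁ : v₁ t = W₁) (h₂ : v₂ t = W₂) :
    ∃ l', HasDerivAt (fun t => n.loss₁ T (v₁ t) (v₂ t)) l' t ∧ W₁ / n.τ₁ * l' =
      (edgeTerm T n.C₁ n.τ₁ n.B₁ W₁ + W₁ / n.τ₁ ^ 2 * n.sharedSlope T (n.rate W₁ W₂)) * v₁' +
      W₁ / (n.τ₁ * n.τ₂) * n.sharedSlope T (n.rate W₁ W₂) * v₂' := by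
  have hr : HasDerivAt (fun t => n.rate (v₁ t) (v₂ t)) (v₁' / n.τ₁ + v₂' / n.τ₂) t :=
    (hv₁.div_const _).fun_add (hv₂.div_const _)
  have hτ₁ := hn.τ₁
  have hτ₂ := hn.τ₂
  cases T
  · refine ⟨_, hr.dropTailLoss n.C n.B, ?_⟩
    rw [h₁, h₂, edgeTerm, sharedSlope]
    field_simp
    ring
  · refine ⟨_, (hr.dropTailLoss n.C₁ n.B₁).fun_add (hr.dropTailLoss n.C₂ n.B₂), ?_⟩
    rw [h₁, h₂, edgeTerm, sharedSlope]
    field_simp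
    ring
  · refine ⟨_, ((hv₁.div_const n.τ₁).dropTailLoss n.C₁ n.B₁).fun_add (hr.dropTailLoss n.C n.B), ?_⟩
    rw [h₁, h₂, edgeTerm, sharedSlope, mul_add, mul_edge_deriv hn.τ₁ hn.C₁ hn.B₁]
    generalize (W₁ / (n.C₁ * n.τ₁)) ^ n.B₁ = q
    field_simp
    ring

theorem Network.hasDerivAt_loss₂ {n : Network} (hn : n.Positive) (T : Topology3) {v₁ v₂ : ℝ → ℝ}
    {v₁' v₂' t W₁ W₂ : ℝ} (hv₁ : HasDerivAt v₁ v₁' t) (hv₂ : HasDerivAt v₂ v₂' t)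
    (h₁ : v₁ t = W₁) (h₂ : v₂ t = W₂) :
    ∃ l', HasDerivAt (fun t => n.loss₂ T (v₁ t) (v₂ t)) l' t ∧ W₂ / n.τ₂ * l' =
      (edgeTerm T n.C₂ n.τ₂ n.B₂ W₂ + W₂ / n.τ₂ ^ 2 * n.sharedSlope T (n.rate W₁ W₂)) * v₂' +
      W₂ / (n.τ₁ * n.τ₂) * n.sharedSlope T (n.rate W₁ W₂) * v₁' := by
  have hr : HasDerivAt (fun t => n.rate (v₁ t) (v₂ t)) (v₁' / n.τ₁ + v₂' / n.τ₂) t :=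
    (hv₁.div_const _).fun_add (hv₂.div_const _)
  have hτ₁ := hn.τ₁
  have hτ₂ := hn.τ₂
  cases T
  · refine ⟨_, hr.dropTailLoss n.C n.B, ?_⟩
    rw [h₁, h₂, edgeTerm, sharedSlope]
    field_simp
    ring
  · refine ⟨_, (hr.dropTailLoss n.C₁ n.B₁).fun_add (hr.dropTailLoss n.C₂ n.B₂), ?_⟩
    rw [h₁, h₂, edgeTerm, sharedSlope]
    field_simp
    ring
  · refine ⟨_, ((hv₂.div_const n.τ₂).dropTailLoss n.C₂ n.B₂).fun_add (hr.dropTailLoss n.C n.B), ?_⟩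
    rw [h₁, h₂, edgeTerm, sharedSlope, mul_add, mul_edge_deriv hn.τ₂ hn.C₂ hn.B₂]
    generalize (W₂ / (n.C₂ * n.τ₂)) ^ n.B₂ = q
    field_simp
    ring

theorem equilibrium_of_windowRate_eq_zero {κ α β k τ W l : ℝ} (hκ : 0 < κ) (hτ : 0 < τ) (hW : 0 < W)
    (h : windowRate κ α β k τ W W l = 0) : α * W ^ (k - 1) * (1 - l) - β * W * l = 0 := by
  rw [windowRate, mul_eq_zero] at h
  exact h.resolve_left (by positivity)

/-- Derivative of the two-flow model along a curve through an equilibrium. -/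
theorem HasDerivAt.twoFlowRate {κ α β k : ℝ} {n : Network} (hn : n.Positive) {T : Topology3}
    {w₁ w₂ v₁ v₂ : ℝ → ℝ} {w₁' w₂' v₁' v₂' t W₁ W₂ : ℝ}
    (hw₁ : HasDerivAt w₁ w₁' t) (hw₂ : HasDerivAt w₂ w₂' t)
    (hv₁ : HasDerivAt v₁ v₁' t) (hv₂ : HasDerivAt v₂ v₂' t) (hW₁ : 0 < W₁) (hW₂ : 0 < W₂)
    (h₁ : w₁ t = W₁) (h₂ : w₂ t = W₂) (h₃ : v₁ t = W₁) (h₄ : v₂ t = W₂) (hκ : 0 < κ)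
    (heq : twoFlowRate κ α β k n T W₁ W₂ W₁ W₂ = 0) :
    HasDerivAt (fun t => twoFlowRate κ α β k n T (w₁ t) (w₂ t) (v₁ t) (v₂ t))
      (-κ * ((n.coeffs α β k T W₁ W₂).M₁ * w₁' + (n.coeffs α β k T W₁ W₂).N₁ * v₁' +
        (n.coeffs α β k T W₁ W₂).P₁ * v₂'),
      -κ * ((n.coeffs α β k T W₁ W₂).M₂ * w₂' + (n.coeffs α β k T W₁ W₂).N₂ * v₂' +
        (n.coeffs α β k T W₁ W₂).P₂ * v₁')) t := by
  have e₁ := equilibrium_of_windowRate_eq_zero hκ hn.τ₁ hW₁ (congrArg Prod.fst heq)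
  have e₂ := equilibrium_of_windowRate_eq_zero hκ hn.τ₂ hW₂ (congrArg Prod.snd heq)
  obtain ⟨l₁, hl₁, hl₁'⟩ := Network.hasDerivAt_loss₁ hn T hv₁ hv₂ h₃ h₄
  obtain ⟨l₂, hl₂, hl₂'⟩ := Network.hasDerivAt_loss₂ hn T hv₁ hv₂ h₃ h₄
  refine HasDerivAt.prodMk ((hw₁.windowRate hv₁ hl₁ hW₁ h₁ h₃ (by rw [h₃, h₄]) e₁).congr_deriv ?_)
    ((hw₂.windowRate hv₂ hl₂ hW₂ h₂ h₄ (by rw [h₃, h₄]) e₂).congr_deriv ?_)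
  · rw [hl₁']
    simp only [Network.coeffs]
    ring
  · rw [hl₂']
    simp only [Network.coeffs]
    ring

/-- The derivative is determined by the derivatives along lines. -/
theorem ContDiffAt.exists_hasFDerivAt_apply_eq {P Q : Type*} [NormedAddCommGroup P]
    [NormedSpace ℝ P] [NormedAddCommGroup Q] [NormedSpace ℝ Q] {f : P → Q} {p : P}
    (hf : ContDiffAt ℝ 2 f p) {f' : P → Q}
    (h : ∀ v, HasDerivAt (fun t : ℝ => f (p + t • v)) (f' v) 0) :
    ∃ L : P →L[ℝ] Q, HasFDerivAt f L p ∧ ∀ v, L v = f' v := by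
  have hd := (hf.differentiableAt (by norm_num)).hasFDerivAt
  exact ⟨_, hd, fun v => (hd.hasLineDerivAt v).unique (h v)⟩

theorem hasDerivAt_line (a b : ℝ) : HasDerivAt (fun t : ℝ => a + t * b) b 0 := by
  simpa using ((hasDerivAt_id (0 : ℝ)).mul_const b).const_add a

end Model

/-! ### Crossing analysis for Scenario 2. -/

namespace LinCoeffs

open ComplexConjugate

/-- The angle in the formula for the critical value of `κ`. -/
noncomputable def θ (f : LinCoeffs) : ℝ :=
  Real.arccos ((f.A ^ 2 * (f.d - f.a * f.b) - f.c * f.d) / (f.b ^ 2 * f.A ^ 2 + f.d ^ 2))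

variable {f : LinCoeffs}

/-- A positive root `x` makes the discriminant the square `(2 x - D)²`, so `A²` is well defined as
the larger root. The last identity says that the quadratic has derivative `√disc` there. -/
theorem Condition1.A_spec (h : f.Condition1) :
    0 < f.A ∧ (f.A ^ 2) ^ 2 - f.D * f.A ^ 2 + (f.c ^ 2 - f.d ^ 2) = 0 ∧ 0 ≤ f.disc ∧
      2 * f.A ^ 2 - f.D = √f.disc := by
  obtain ⟨x, ⟨hx, hxr⟩, -⟩ := h
  have hdisc : f.disc = (2 * x - f.D) ^ 2 := by
    rw [disc]; linear_combination -4 * hxr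
  have h0 : 0 ≤ f.disc := hdisc ▸ sq_nonneg _
  have hle : 2 * x - f.D ≤ √f.disc := by rw [hdisc]; exact Real.le_sqrt_of_sq_le le_rfl
  have hpos : 0 < f.D / 2 + √f.disc / 2 := by linarith
  have hA2 : f.A ^ 2 = f.D / 2 + √f.disc / 2 := Real.sq_sqrt hpos.le
  refine ⟨Real.sqrt_pos.2 hpos, ?_, h0, by rw [hA2]; ring⟩
  have hs := Real.sq_sqrt h0
  rw [hA2]
  unfold disc at *
  linear_combination hs / 4

/-- Positivity of the sine of the crossing angle. Suppose it fails, so `A² ≤ x₀` with `x₀ = c - a d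
/ b`. If `a < b`, the quadratic is negative at `x₀`, whereas it is nonnegative from its larger root
`A²` onwards. If `b ≤ a`, then `d < c`, so the other root is positive too; uniqueness makes the root
double, `A⁴ = c² - d²`, whence `c - A² < d` and `b (c - A²) < a d`, against the assumption. -/
theorem Condition1.crossing_im_pos (h : f.Condition1) (ha : 0 < f.a) (hb : 0 < f.b) (hc : 0 < f.c)
    (hd : 0 < f.d) : 0 < f.b * f.A ^ 2 + f.a * f.d - f.b * f.c := by
  obtain ⟨hA, hroot, -, hsq⟩ := h.A_spec
  have hD : f.D ≤ 2 * f.A ^ 2 := by have := Real.sqrt_nonneg f.disc; linarith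
  set X := f.A ^ 2 with hX
  have hXpos : 0 < X := by positivity
  by_contra hcon
  push Not at hcon
  have hbX : 0 < f.b * X := by positivity
  rcases lt_or_ge f.a f.b with hab | hab
  · obtain ⟨x₀, hx₀⟩ : ∃ x₀, x₀ = f.c - f.a * f.d / f.b := ⟨_, rfl⟩
    have hbx : f.b * x₀ = f.b * f.c - f.a * f.d := by rw [hx₀]; field_simp
    have h1 : X ≤ x₀ := by
      have : f.b * X ≤ f.b * x₀ := by linarith
      exact le_of_mul_le_mul_left this hb
    have h2 : 0 ≤ (x₀ - X) * (x₀ + X - f.D) := mul_nonneg (by linarith) (by linarith)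
    have h3 : f.b ^ 2 * ((x₀ - X) * (x₀ + X - f.D)) =
        (f.a ^ 2 - f.b ^ 2) * (f.d ^ 2 + f.b ^ 2 * x₀) := by
      have h4 : (x₀ - X) * (x₀ + X - f.D) = x₀ ^ 2 - f.D * x₀ + (f.c ^ 2 - f.d ^ 2) := by
        linear_combination -hroot
      rw [h4, D]
      linear_combination (f.b * x₀ - f.b * f.c - f.a * f.d) * hbx
    have h5 : (f.a ^ 2 - f.b ^ 2) * (f.d ^ 2 + f.b ^ 2 * x₀) < 0 := by
      apply mul_neg_of_neg_of_pos
      · nlinarith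
      · have : 0 < f.b ^ 2 * x₀ := by
          have : 0 < x₀ := by linarith
          positivity
        positivity
    have h6 : 0 ≤ f.b ^ 2 * ((x₀ - X) * (x₀ + X - f.D)) := by positivity
    linarith
  · have hcd : f.d < f.c := by
      by_contra hle
      push Not at hle
      nlinarith [mul_le_mul hab hle hc.le ha.le]
    obtain ⟨x, -, huniq⟩ := h
    have hprod : X * (f.D - X) = f.c ^ 2 - f.d ^ 2 := by linear_combination -hroot
    have h1 : 0 < X * (f.D - X) := by rw [hprod]; nlinarith
    have h2 : 0 < f.D - X := pos_of_mul_pos_right h1 hXpos.le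
    have h3 : f.D - X = X :=
      (huniq _ ⟨h2, by linear_combination -hprod⟩).trans (huniq X ⟨hXpos, hroot⟩).symm
    rw [h3] at hprod
    have hXc : X < f.c := by nlinarith
    have h4 : f.c - X < f.d := by nlinarith
    have h5 : f.b * (f.c - X) < f.b * f.d := by gcongr
    have h6 : f.b * f.d ≤ f.a * f.d := by gcongr
    linarith

variable (f) in
/-- The polynomials of the characteristic quasipolynomial. -/
noncomputable def polyP (s : ℂ) : ℂ := s ^ 2 + f.a * s + f.c

variable (f) in
noncomputable def polyQ (s : ℂ) : ℂ := f.b * s + f.d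

/-- Rescaling by `κ` removes it from the polynomials and leaves it only in the delay `κ τ`, so a
threshold in the delay is one in `κ`. -/
theorem charFun_eq {κ : ℝ} (hκ : 0 < κ) (τ : ℝ) (z : ℂ) :
    f.charFun κ τ z = κ ^ 2 * quasiPoly f.polyP f.polyQ (κ * τ) (z / κ) := by
  have hκ' : (κ : ℂ) ≠ 0 := by exact_mod_cast hκ.ne'
  have : -(z / κ) * ((κ * τ : ℝ) : ℂ) = -z * τ := by
    push_cast; field_simp
  rw [quasiPoly, this, charFun, polyP, polyQ]
  field_simp
  ring

theorem normSq_polyP (y : ℝ) :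
    ‖f.polyP (y * Complex.I)‖ ^ 2 = (f.c - y ^ 2) ^ 2 + (f.a * y) ^ 2 := by
  rw [← Complex.normSq_eq_norm_sq, polyP, Complex.normSq_apply]
  simp [pow_two]
  ring

theorem normSq_polyQ (y : ℝ) :
    ‖f.polyQ (y * Complex.I)‖ ^ 2 = f.d ^ 2 + (f.b * y) ^ 2 := by
  rw [← Complex.normSq_eq_norm_sq, polyQ, Complex.normSq_apply]
  simp [pow_two]

/-- Cosine and sine of the crossing angle. -/
theorem Condition1.θ_spec (h : f.Condition1) (ha : 0 < f.a) (hb : 0 < f.b) (hc : 0 < f.c)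
    (hd : 0 < f.d) : ∃ r σ : ℝ, 0 < σ ∧ r ^ 2 + σ ^ 2 = 1 ∧ f.d * r + f.b * f.A * σ = f.A ^ 2 - f.c ∧
      f.b * f.A * r - f.d * σ = -f.a * f.A ∧ Real.cos f.θ = r ∧ Real.sin f.θ = σ := by
  obtain ⟨hA, hroot, -, -⟩ := h.A_spec
  have him := h.crossing_im_pos ha hb hc hd
  have hn : 0 < f.b ^ 2 * f.A ^ 2 + f.d ^ 2 := by positivity
  set r := (f.A ^ 2 * (f.d - f.a * f.b) - f.c * f.d) / (f.b ^ 2 * f.A ^ 2 + f.d ^ 2) with hr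
  -- `r` and `σ` solve the real and imaginary parts of `p (i A) + q (i A) (r - i σ) = 0`. That they
  -- lie on the unit circle is the quadratic equation for `A²`.
  set σ := f.A * (f.b * f.A ^ 2 + f.a * f.d - f.b * f.c) / (f.b ^ 2 * f.A ^ 2 + f.d ^ 2) with hσ
  have hσ0 : 0 < σ := by positivity
  have e1 : f.d * r + f.b * f.A * σ = f.A ^ 2 - f.c := by
    rw [hr, hσ]; field_simp; ring
  have e2 : f.b * f.A * r - f.d * σ = -f.a * f.A := by
    rw [hr, hσ]; field_simp; ring
  have e3 : r ^ 2 + σ ^ 2 = 1 := by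
    have h1 : (f.b ^ 2 * f.A ^ 2 + f.d ^ 2) * (r ^ 2 + σ ^ 2) = f.b ^ 2 * f.A ^ 2 + f.d ^ 2 := by
      have h2 : (f.b ^ 2 * f.A ^ 2 + f.d ^ 2) * (r ^ 2 + σ ^ 2) =
          (f.d * r + f.b * f.A * σ) ^ 2 + (f.b * f.A * r - f.d * σ) ^ 2 := by ring
      rw [h2, e1, e2]
      unfold D at hroot
      linear_combination hroot
    exact mul_left_cancel₀ hn.ne' (by rw [h1, mul_one])
  have hr1 : -1 ≤ r := by nlinarith
  have hr2 : r ≤ 1 := by nlinarith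
  refine ⟨r, σ, hσ0, e3, e1, e2, Real.cos_arccos hr1 hr2, ?_⟩
  rw [θ, Real.sin_arccos, ← hr, show 1 - r ^ 2 = σ ^ 2 by linarith, Real.sqrt_sq hσ0.le]

theorem exp_θ {r σ : ℝ} (hr : Real.cos f.θ = r)
    (hσ : Real.sin f.θ = σ) : Complex.exp (-(f.θ * Complex.I)) = r - σ * Complex.I := by
  rw [← neg_mul, ← Complex.ofReal_neg, Complex.exp_mul_I, ← Complex.ofReal_cos,
    ← Complex.ofReal_sin, Real.cos_neg, Real.sin_neg, hr, hσ]
  push_cast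
  ring

/-- Equality of moduli on the axis is the quadratic of `Condition1` in `y²`, which fixes `y`.
Without delay the function is `s² + (a + b) s + (c + d)`, with positive coefficients. -/
theorem Condition1.hasSingleCrossing (h : f.Condition1) (ha : 0 < f.a) (hb : 0 < f.b)
    (hc : 0 < f.c) (hd : 0 < f.d) :
    HasSingleCrossing f.polyP f.polyQ (1 + f.a + f.b + f.c + f.d) f.A f.θ where
  differentiable_p := by unfold polyP; fun_prop
  differentiable_q := by unfold polyQ; fun_prop
  conj_p s := by simp [polyP]
  conj_q s := by simp [polyQ]
  bound s _ hle := by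
    by_contra hcon
    push Not at hcon
    have h1 : 1 ≤ ‖s‖ := by linarith
    have h2 : ‖f.polyQ s‖ ≤ f.b * ‖s‖ + f.d := by
      refine (norm_add_le _ _).trans_eq ?_
      rw [norm_mul, Complex.norm_real, Complex.norm_real, Real.norm_of_nonneg hb.le,
        Real.norm_of_nonneg hd.le]
    have h3 : ‖s‖ ^ 2 ≤ ‖f.polyP s‖ + (f.a * ‖s‖ + f.c) := by
      have h4 : s ^ 2 = f.polyP s - (f.a * s + f.c) := by rw [polyP]; ring
      rw [← norm_pow, h4]
      refine (norm_sub_le _ _).trans (add_le_add le_rfl ((norm_add_le _ _).trans_eq ?_))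
      rw [norm_mul, Complex.norm_real, Complex.norm_real, Real.norm_of_nonneg ha.le,
        Real.norm_of_nonneg hc.le]
    nlinarith
  zero_delay s hs h0 := by
    rw [polyP, polyQ] at h0
    have hre := congrArg Complex.re h0
    have him := congrArg Complex.im h0
    simp [pow_two] at hre him
    have h1 : s.im * (2 * s.re + f.a + f.b) = 0 := by linear_combination him
    have h2 : s.im = 0 := (mul_eq_zero.1 h1).resolve_right (by linarith)
    rw [h2] at hre
    have h3 := mul_nonneg hs hs
    have h4 := mul_nonneg ha.le hs
    have h5 := mul_nonneg hb.le hs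
    linarith
  axis τ y hy h0 := by
    rcases hy.eq_or_lt with rfl | hy
    · exfalso
      simp [quasiPoly, polyP, polyQ] at h0
      have : f.c + f.d = 0 := by exact_mod_cast h0
      linarith
    · have h1 : ‖f.polyP (y * Complex.I)‖ ^ 2 = ‖f.polyQ (y * Complex.I)‖ ^ 2 := by
        have h2 : f.polyP (y * Complex.I) =
            -(f.polyQ (y * Complex.I) * Complex.exp (((-(y * τ) : ℝ) : ℂ) * Complex.I)) := by
          have : -(y * Complex.I) * (τ : ℂ) = ((-(y * τ) : ℝ) : ℂ) * Complex.I := by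
            push_cast; ring
          rw [← this]
          rw [quasiPoly] at h0
          linear_combination h0
        rw [h2, norm_neg, norm_mul, Complex.norm_exp_ofReal_mul_I, mul_one]
      rw [normSq_polyP, normSq_polyQ] at h1
      obtain ⟨hA, hroot, -, -⟩ := h.A_spec
      obtain ⟨x, -, huniq⟩ := h
      have h3 : y ^ 2 = f.A ^ 2 := by
        rw [huniq (y ^ 2) ⟨by positivity, by unfold D; linear_combination h1⟩,
          huniq (f.A ^ 2) ⟨by positivity, hroot⟩]
      exact (sq_eq_sq₀ hy.le hA.le).1 h3
  A_pos := h.A_spec.1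
  θ_pos := by
    obtain ⟨r, σ, hσ, hrσ, -, -, hcos, -⟩ := h.θ_spec ha hb hc hd
    refine lt_of_le_of_ne (Real.arccos_nonneg _) fun h0 => ?_
    rw [← h0, Real.cos_zero] at hcos
    subst hcos
    nlinarith
  θ_lt := by
    have := Real.arccos_le_pi
      ((f.A ^ 2 * (f.d - f.a * f.b) - f.c * f.d) / (f.b ^ 2 * f.A ^ 2 + f.d ^ 2))
    have := Real.pi_pos
    rw [θ]; linarith
  q_ne h0 := by
    have h1 := normSq_polyQ (f := f) f.A
    rw [h0, norm_zero] at h1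
    have : 0 < f.d ^ 2 + (f.b * f.A) ^ 2 := by positivity
    nlinarith
  root := by
    obtain ⟨r, σ, -, -, e1, e2, hcos, hsin⟩ := h.θ_spec ha hb hc hd
    rw [exp_θ hcos hsin, polyP, polyQ]
    apply Complex.ext
    · simp [pow_two]
      linear_combination e1
    · simp [pow_two]
      linear_combination e2

/-- The quantity equals `A² (2 A² - D) = A² √disc`: the crossing is transversal because the root of
the quadratic is simple. -/
theorem Condition1.transversal (h : f.Condition1) (ha : 0 < f.a) (hb : 0 < f.b)
    (hc : 0 < f.c) (hd : 0 < f.d) (hdisc : f.disc ≠ 0) :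
    0 < (-(f.A * Complex.I) * f.polyP (f.A * Complex.I) * conj ((2 * (f.A * Complex.I) + f.a) +
      f.b * Complex.exp (-(f.θ * Complex.I)))).re := by
  obtain ⟨r, σ, -, hrσ, e1, e2, hcos, hsin⟩ := h.θ_spec ha hb hc hd
  obtain ⟨hA, hroot, hnn, hsq⟩ := h.A_spec
  have hpos : 0 < √f.disc := Real.sqrt_pos.2 (lt_of_le_of_ne hnn hdisc.symm)
  have key : (-(f.A * Complex.I) * f.polyP (f.A * Complex.I) * conj ((2 * (f.A * Complex.I) + f.a) +
      f.b * Complex.exp (-(f.θ * Complex.I)))).re = f.A ^ 2 * (2 * f.A ^ 2 - f.D) := by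
    rw [exp_θ hcos hsin, polyP]
    simp [pow_two]
    unfold D
    linear_combination (-f.b ^ 2 * f.A ^ 2) * hrσ + (f.A * f.b * σ) * e1 + (f.A * f.b * r) * e2
  rw [key, hsq]
  positivity

theorem hasDerivAt_polyP (s : ℂ) : HasDerivAt f.polyP (2 * s + f.a) s := by
  have := (((hasDerivAt_id s).fun_pow 2).fun_add ((hasDerivAt_id s).const_mul (f.a : ℂ))).add_const
    (f.c : ℂ)
  exact this.congr_deriv (by simp)

theorem hasDerivAt_polyQ (s : ℂ) : HasDerivAt f.polyQ f.b s := by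
  have := ((hasDerivAt_id s).const_mul (f.b : ℂ)).add_const (f.d : ℂ)
  exact this.congr_deriv (by simp)

theorem lt_κc_iff {κ τ : ℝ} (hA : 0 < f.A) (hτ : 0 < τ) :
    κ < f.κc τ ↔ κ * τ < f.θ / f.A := by
  have : f.κc τ = f.θ / f.A / τ := by
    rw [κc, θ]; field_simp
  rw [this, lt_div_iff₀ hτ]

theorem κc_lt_iff {κ τ : ℝ} (hA : 0 < f.A) (hτ : 0 < τ) :
    f.κc τ < κ ↔ f.θ / f.A < κ * τ := by
  have : f.κc τ = f.θ / f.A / τ := by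
    rw [κc, θ]; field_simp
  rw [this, div_lt_iff₀ hτ]

theorem Condition1.re_neg_of_charFun_eq_zero (h : f.Condition1) (ha : 0 < f.a) (hb : 0 < f.b)
    (hc : 0 < f.c) (hd : 0 < f.d) {κ τ : ℝ} (hκ : 0 < κ) (hτ : 0 < τ) (hlt : κ < f.κc τ) {z : ℂ}
    (hz : f.charFun κ τ z = 0) : z.re < 0 := by
  have H := h.hasSingleCrossing ha hb hc hd
  rw [charFun_eq hκ, mul_eq_zero, or_iff_right (by simpa using hκ.ne')] at hz
  have := H.re_neg_of_lt (by positivity) ((lt_κc_iff H.A_pos hτ).1 hlt) hz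
  rw [Complex.div_ofReal_re, div_lt_iff₀ hκ, zero_mul] at this
  exact this

theorem Condition1.charFun_crossing (h : f.Condition1) (ha : 0 < f.a) (hb : 0 < f.b)
    (hc : 0 < f.c) (hd : 0 < f.d) {κ τ : ℝ} (hκ : 0 < κ) (hτ : 0 < τ) (heq : κ = f.κc τ) :
    f.charFun κ τ (Complex.I * (κ * f.A : ℝ)) = 0 := by
  have H := h.hasSingleCrossing ha hb hc hd
  have hκ' : (κ : ℂ) ≠ 0 := by exact_mod_cast hκ.ne'
  have h1 : κ * τ = f.θ / f.A := le_antisymm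
    (not_lt.1 fun hlt => ((κc_lt_iff H.A_pos hτ).2 hlt).ne' heq)
    (not_lt.1 fun hlt => ((lt_κc_iff H.A_pos hτ).2 hlt).ne heq)
  have h2 : Complex.I * (κ * f.A : ℝ) / κ = f.A * Complex.I := by
    push_cast; field_simp
  rw [charFun_eq hκ, h2, h1, H.quasiPoly_crossing, mul_zero]

theorem Condition1.exists_charFun_eq_zero (h : f.Condition1) (ha : 0 < f.a) (hb : 0 < f.b)
    (hc : 0 < f.c) (hd : 0 < f.d) (hdisc : f.disc ≠ 0) {κ τ : ℝ} (hκ : 0 < κ) (hτ : 0 < τ)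
    (hlt : f.κc τ < κ) : ∃ z : ℂ, 0 < z.re ∧ f.charFun κ τ z = 0 := by
  have H := h.hasSingleCrossing ha hb hc hd
  have hκ' : (κ : ℂ) ≠ 0 := by exact_mod_cast hκ.ne'
  obtain ⟨s, hs, hr⟩ := H.exists_re_pos_of_lt (hasDerivAt_polyP _) (hasDerivAt_polyQ _)
    (h.transversal ha hb hc hd hdisc) ((κc_lt_iff H.A_pos hτ).1 hlt)
  refine ⟨κ * s, by rw [Complex.re_ofReal_mul]; positivity, ?_⟩
  rw [charFun_eq hκ, mul_div_cancel_left₀ _ hκ', hr, mul_zero]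

end LinCoeffs

/-! ### The scalar quasipolynomial of Scenario 1. -/

section SingleDelay

/-- The quasipolynomials `s + m + b exp (-s h)` with `0 < m < b`. -/
theorem hasSingleCrossing_linear {m b : ℝ} (hm : 0 < m) (hmb : m < b) :
    HasSingleCrossing (fun s => s + m) (fun _ => b) (b + m) (√(b ^ 2 - m ^ 2))
      (Real.arccos (-m / b)) := by
  have hb : 0 < b := hm.trans hmb
  have hpos : 0 < b ^ 2 - m ^ 2 := by nlinarith
  have hA := Real.sqrt_pos.2 hpos
  have hA2 := Real.sq_sqrt hpos.le
  have hr1 : -1 ≤ -m / b := by rw [le_div_iff₀ hb]; linarith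
  have hr2 : -m / b ≤ 1 := by rw [div_le_iff₀ hb]; linarith
  have hcos := Real.cos_arccos hr1 hr2
  have hsin : Real.sin (Real.arccos (-m / b)) = √(b ^ 2 - m ^ 2) / b := by
    rw [Real.sin_arccos, show 1 - (-m / b) ^ 2 = (b ^ 2 - m ^ 2) / b ^ 2 by field_simp,
      Real.sqrt_div hpos.le, Real.sqrt_sq hb.le]
  set A := √(b ^ 2 - m ^ 2)
  exact
  { differentiable_p := by fun_prop
    differentiable_q := by fun_prop
    conj_p := fun s => by simp
    conj_q := fun s => by simp
    bound := fun s _ hle => by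
      have h1 : ‖s‖ ≤ ‖s + m‖ + ‖(m : ℂ)‖ := by simpa using norm_sub_le (s + m) (m : ℂ)
      rw [Complex.norm_real, Real.norm_of_nonneg hb.le] at hle
      rw [Complex.norm_real, Real.norm_of_nonneg hm.le] at h1
      linarith
    zero_delay := fun s hs h0 => by
      have := congrArg Complex.re h0
      simp at this
      linarith
    axis := fun h y hy h0 => by
      have h1 : (y * Complex.I + m : ℂ) = -(b * Complex.exp (((-(y * h) : ℝ) : ℂ) * Complex.I)) := by
        have : -(y * Complex.I) * (h : ℂ) = ((-(y * h) : ℝ) : ℂ) * Complex.I := by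
          push_cast; ring
        rw [← this]
        rw [quasiPoly] at h0
        linear_combination h0
      have h2 := congrArg (fun z => ‖z‖ ^ 2) h1
      simp only [norm_neg, norm_mul, Complex.norm_exp_ofReal_mul_I, mul_one] at h2
      rw [← Complex.normSq_eq_norm_sq, Complex.normSq_apply, Complex.norm_real,
        Real.norm_of_nonneg hb.le] at h2
      simp at h2
      exact (sq_eq_sq₀ hy hA.le).1 (by rw [hA2]; linarith)
    A_pos := hA
    θ_pos := by
      refine lt_of_le_of_ne (Real.arccos_nonneg _) fun h0 => ?_
      rw [← h0, Real.cos_zero, eq_div_iff hb.ne'] at hcos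
      linarith
    θ_lt := by
      have := Real.arccos_le_pi (-m / b)
      have := Real.pi_pos
      linarith
    q_ne := by exact_mod_cast hb.ne'
    root := by
      rw [← neg_mul, ← Complex.ofReal_neg, Complex.exp_mul_I, ← Complex.ofReal_cos,
        ← Complex.ofReal_sin, Real.cos_neg, Real.sin_neg, hcos, hsin]
      have : (b : ℂ) ≠ 0 := by exact_mod_cast hb.ne'
      push_cast
      field_simp
      ring }

/-- A root with `Re s ≥ 0` would satisfy `|s + m| ≤ b ≤ m`, hence `s = 0`, but `m + b > 0`. -/
theorem re_neg_of_linear_of_le {m b h : ℝ} (hb : 0 < b) (hbm : b ≤ m) (hh : 0 ≤ h) {s : ℂ}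
    (h0 : quasiPoly (fun s => s + m) (fun _ => b) h s = 0) : s.re < 0 := by
  by_contra hcon
  push Not at hcon
  have h1 : s + m = -(b * Complex.exp (-s * h)) := eq_neg_of_add_eq_zero_left h0
  have h2 : ‖s + m‖ ≤ b := by
    rw [h1, norm_neg, norm_mul, Complex.norm_exp, Complex.norm_real, Real.norm_of_nonneg hb.le]
    apply mul_le_of_le_one_right hb.le
    rw [Real.exp_le_one_iff, Complex.re_mul_ofReal, Complex.neg_re]
    nlinarith
  have h3 : (s.re + m) * (s.re + m) + s.im * s.im ≤ b ^ 2 := by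
    have h4 := Complex.normSq_eq_norm_sq (s + m)
    rw [Complex.normSq_apply] at h4
    simp at h4
    rw [h4]
    gcongr
  have hre : s.re = 0 := by nlinarith [mul_self_nonneg s.im]
  have him : s.im = 0 := by
    rw [hre] at h3
    nlinarith [mul_self_nonneg s.im]
  have hs : s = 0 := Complex.ext hre him
  rw [hs] at h1
  have h5 := congrArg Complex.re h1
  simp at h5
  linarith

/-- The characteristic function of `u'(t) = -γ (m u(t) + b u(t - τ))`. -/
theorem linear_eq_quasiPoly {γ τ m b : ℝ} (hγ : 0 < γ) (z : ℂ) :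
    z + γ * m + γ * b * Complex.exp (-z * τ) =
      γ * quasiPoly (fun s => s + m) (fun _ => b) (γ * τ) (z / γ) := by
  have hγ' : (γ : ℂ) ≠ 0 := by exact_mod_cast hγ.ne'
  have : -(z / γ) * ((γ * τ : ℝ) : ℂ) = -z * τ := by
    push_cast; field_simp
  rw [quasiPoly, this]
  field_simp

/-- The condition is asked for only when `m < b`: the antisymmetric mode of Case III may have its
delayed coefficient below `m`, where it is stable for every delay. -/
theorem re_neg_of_single_delay {γ τ m b : ℝ} (hγ : 0 < γ) (hτ : 0 < τ) (hm : 0 < m) (hb : 0 < b)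
    (hlt : m < b → γ * τ * √(b ^ 2 - m ^ 2) < Real.arccos (-m / b)) {z : ℂ}
    (hz : z + γ * m + γ * b * Complex.exp (-z * τ) = 0) : z.re < 0 := by
  rw [linear_eq_quasiPoly hγ, mul_eq_zero, or_iff_right (by exact_mod_cast hγ.ne')] at hz
  have : (z / γ).re < 0 := by
    rcases lt_or_ge m b with hmb | hmb
    · have H := hasSingleCrossing_linear hm hmb
      exact H.re_neg_of_lt (by positivity) ((lt_div_iff₀ H.A_pos).2 (hlt hmb)) hz
    · exact re_neg_of_linear_of_le hb hmb (by positivity) hz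
  rwa [Complex.div_ofReal_re, div_lt_iff₀ hγ, zero_mul] at this

/-- At `m = b` the arccosine is `π` while the other side is `0`, so this borderline case is always
on the stable side. -/
theorem lt_of_arccos_le {γ m b : ℝ} (hmb : m ≤ b) (hb : 0 < b)
    (h : Real.arccos (-m / b) ≤ γ * √(b ^ 2 - m ^ 2)) : m < b := by
  refine lt_of_le_of_ne hmb ?_
  rintro rfl
  rw [sub_self, Real.sqrt_zero, mul_zero, neg_div, div_self hb.ne', Real.arccos_neg_one] at h
  linarith [Real.pi_pos]

theorem exists_re_nonneg_single_delay {γ τ m b : ℝ} (hγ : 0 < γ) (hm : 0 < m)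
    (hmb : m ≤ b) (heq : Real.arccos (-m / b) = γ * τ * √(b ^ 2 - m ^ 2)) :
    ∃ z : ℂ, 0 ≤ z.re ∧ z + γ * m + γ * b * Complex.exp (-z * τ) = 0 := by
  have H := hasSingleCrossing_linear hm (lt_of_arccos_le hmb (hm.trans_le hmb) heq.le)
  have h1 : Real.arccos (-m / b) / √(b ^ 2 - m ^ 2) = γ * τ := by
    rw [heq, mul_div_cancel_right₀ _ H.A_pos.ne']
  have hγ' : (γ : ℂ) ≠ 0 := by exact_mod_cast hγ.ne'
  refine ⟨γ * ((√(b ^ 2 - m ^ 2) : ℝ) * Complex.I), by simp, ?_⟩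
  rw [linear_eq_quasiPoly hγ, mul_div_cancel_left₀ _ hγ', ← h1, H.quasiPoly_crossing, mul_zero]

theorem exists_re_pos_single_delay {γ τ m b : ℝ} (hγ : 0 < γ) (hm : 0 < m)
    (hmb : m ≤ b) (hlt : Real.arccos (-m / b) < γ * τ * √(b ^ 2 - m ^ 2)) :
    ∃ z : ℂ, 0 < z.re ∧ z + γ * m + γ * b * Complex.exp (-z * τ) = 0 := by
  have H := hasSingleCrossing_linear hm (lt_of_arccos_le hmb (hm.trans_le hmb) hlt.le)
  obtain ⟨s, hs, h0⟩ := H.exists_re_pos_of_lt (h := γ * τ) (p' := 1) (q' := 0)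
    -- Transversality is automatic: the real part of `-i A (i A + m)` is `A²`.
    ((hasDerivAt_id _).add_const _) (hasDerivAt_const _ _) (by
      have := H.A_pos
      simp
      nlinarith) ((div_lt_iff₀ H.A_pos).2 hlt)
  have hγ' : (γ : ℂ) ≠ 0 := by exact_mod_cast hγ.ne'
  refine ⟨γ * s, by rw [Complex.re_ofReal_mul]; positivity, ?_⟩
  rw [linear_eq_quasiPoly hγ, mul_div_cancel_left₀ _ hγ', h0, mul_zero]

/-- Lowering the delayed coefficient lowers the left side and raises the right side, so the mode
with the largest coefficient decides. -/
theorem arccos_bound_mono {γ m b b' : ℝ} (hγ : 0 ≤ γ) (hm : 0 < m) (hb' : 0 < b') (hbb : b' ≤ b)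
    (h : γ * √(b ^ 2 - m ^ 2) < Real.arccos (-m / b)) :
    γ * √(b' ^ 2 - m ^ 2) < Real.arccos (-m / b') := by
  calc γ * √(b' ^ 2 - m ^ 2) ≤ γ * √(b ^ 2 - m ^ 2) := by gcongr
    _ < Real.arccos (-m / b) := h
    _ ≤ Real.arccos (-m / b') := Real.arccos_le_arccos (by
      rw [neg_div, neg_div, neg_le_neg_iff]
      gcongr)

end SingleDelay

/-! ### Stability in the two scenarios. -/

section Scenarios

theorem loss_lt_one {α β k W l : ℝ} (hα : 0 < α) (hβ : 0 < β) (hW : 0 < W) (hl : 0 < l)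
    (h : α * W ^ (k - 1) * (1 - l) - β * W * l = 0) : 0 < 1 - l := by
  have hp : 0 < α * W ^ (k - 1) := by positivity
  have h1 : 0 < β * W * l := by positivity
  exact pos_of_mul_pos_right (by linarith : 0 < α * W ^ (k - 1) * (1 - l)) hp.le

namespace Network

variable {n : Network}

theorem rate_pos (hn : n.Positive) {W₁ W₂ : ℝ} (h₁ : 0 < W₁) (h₂ : 0 < W₂) :
    0 < n.rate W₁ W₂ :=
  add_pos (div_pos h₁ hn.τ₁) (div_pos h₂ hn.τ₂)

theorem loss₁_pos (hn : n.Positive) (T : Topology3) {W₁ W₂ : ℝ} (h₁ : 0 < W₁) (h₂ : 0 < W₂) :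
    0 < n.loss₁ T W₁ W₂ := by
  have hr := rate_pos hn h₁ h₂
  have := hn.τ₁
  have := hn.C
  have := hn.C₁
  have := hn.C₂
  cases T <;> simp only [loss₁, dropTailLoss] <;> positivity

theorem loss₂_pos (hn : n.Positive) (T : Topology3) {W₁ W₂ : ℝ} (h₁ : 0 < W₁) (h₂ : 0 < W₂) :
    0 < n.loss₂ T W₁ W₂ := by
  have hr := rate_pos hn h₁ h₂
  have := hn.τ₂
  have := hn.C
  have := hn.C₁
  have := hn.C₂
  cases T <;> simp only [loss₂, dropTailLoss] <;> positivity

theorem sharedSlope_pos (hn : n.Positive) (T : Topology3) {S : ℝ} (hS : 0 < S) :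
    0 < n.sharedSlope T S := by
  have hB := hn.B
  have hB₁ := hn.B₁
  have hB₂ := hn.B₂
  have := hn.C
  have := hn.C₁
  have := hn.C₂
  cases T <;> simp only [sharedSlope] <;> positivity

theorem edgeTerm_nonneg (T : Topology3) {C τ W : ℝ} (hC : 0 < C) (hτ : 0 < τ) (hW : 0 < W) (B : ℕ) :
    0 ≤ edgeTerm T C τ B W := by
  cases T <;> simp only [edgeTerm] <;> positivity

/-- All coefficients `a`, `b`, `c`, `d` of the characteristic function are positive. -/
theorem coeffs_pos (hn : n.Positive) {α β k W₁ W₂ : ℝ} {T : Topology3} (hα : 0 < α) (hβ : 0 < β)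
    (hk : k < 2) (h₁ : 0 < W₁) (h₂ : 0 < W₂)
    (e₁ : α * W₁ ^ (k - 1) * (1 - n.loss₁ T W₁ W₂) - β * W₁ * n.loss₁ T W₁ W₂ = 0)
    (e₂ : α * W₂ ^ (k - 1) * (1 - n.loss₂ T W₁ W₂) - β * W₂ * n.loss₂ T W₁ W₂ = 0) :
    0 < (n.coeffs α β k T W₁ W₂).a ∧ 0 < (n.coeffs α β k T W₁ W₂).b ∧
      0 < (n.coeffs α β k T W₁ W₂).c ∧ 0 < (n.coeffs α β k T W₁ W₂).d := by
  have hτ₁ := hn.τ₁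
  have hτ₂ := hn.τ₂
  have hσ := sharedSlope_pos hn T (rate_pos hn h₁ h₂)
  have hE₁ := edgeTerm_nonneg T hn.C₁ hτ₁ h₁ n.B₁
  have hE₂ := edgeTerm_nonneg T hn.C₂ hτ₂ h₂ n.B₂
  have hl₁ := loss_lt_one hα hβ h₁ (loss₁_pos hn T h₁ h₂) e₁
  have hl₂ := loss_lt_one hα hβ h₂ (loss₂_pos hn T h₁ h₂) e₂
  have hk' : 0 < -(k - 2) := by linarith
  set f := n.coeffs α β k T W₁ W₂ with hf
  have hM₁ : 0 < f.M₁ := by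
    have : f.M₁ = α / n.τ₁ * -(k - 2) * W₁ ^ (k - 1) * (1 - n.loss₁ T W₁ W₂) := by
      simp only [hf, coeffs]; ring
    rw [this]; positivity
  have hM₂ : 0 < f.M₂ := by
    have : f.M₂ = α / n.τ₂ * -(k - 2) * W₂ ^ (k - 1) * (1 - n.loss₂ T W₁ W₂) := by
      simp only [hf, coeffs]; ring
    rw [this]; positivity
  have hN₁ : 0 < f.N₁ := by simp only [hf, coeffs]; positivity
  have hN₂ : 0 < f.N₂ := by simp only [hf, coeffs]; positivity
  -- The shared-router parts of `N₁` and `N₂` have product exactly `P₁ P₂`, and the edge terms only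
  -- add to it. Hence `d ≥ N₁ M₂ > 0`.
  have hPN : f.P₁ * f.P₂ ≤ f.N₁ * f.N₂ := by
    have hN₁' : (α * W₁ ^ (k - 1) + β * W₁) * (W₁ / n.τ₁ ^ 2 * n.sharedSlope T (n.rate W₁ W₂)) ≤
        f.N₁ := by
      simp only [hf, coeffs]; gcongr; linarith
    have hN₂' : (α * W₂ ^ (k - 1) + β * W₂) * (W₂ / n.τ₂ ^ 2 * n.sharedSlope T (n.rate W₁ W₂)) ≤
        f.N₂ := by
      simp only [hf, coeffs]; gcongr; linarith
    refine le_trans (le_of_eq ?_) (mul_le_mul hN₁' hN₂' (by positivity) hN₁.le)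
    simp only [hf, coeffs]
    field_simp
  refine ⟨by unfold LinCoeffs.a; positivity, hN₁, by unfold LinCoeffs.c; positivity, ?_⟩
  have : 0 < f.N₁ * f.M₂ := by positivity
  unfold LinCoeffs.d
  linarith

end Network

/-- The linearisation of Scenario 2. -/
theorem scenario2_hasFDerivAt {κ α β k : ℝ} (hκ : 0 < κ) {T : Topology3} {n : Network}
    (hn : n.Positive) {w₁ w₂ : ℝ} (h₁ : 0 < w₁) (h₂ : 0 < w₂)
    (heq : scenario2Field κ α β k n T (w₁, w₂) (w₁, w₂) = 0) :
    ContDiffAt ℝ 2 (fun p : (ℝ × ℝ) × (ℝ × ℝ) => scenario2Field κ α β k n T p.1 p.2)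
      ((w₁, w₂), (w₁, w₂)) ∧
    ∃ L : (ℝ × ℝ) × (ℝ × ℝ) →L[ℝ] ℝ × ℝ,
      HasFDerivAt (fun p : (ℝ × ℝ) × (ℝ × ℝ) => scenario2Field κ α β k n T p.1 p.2) L
        ((w₁, w₂), (w₁, w₂)) ∧
      ∀ x y : ℝ × ℝ, L (x, y) = (n.coeffs α β k T w₁ w₂).field κ x y := by
  have hs : ContDiffAt ℝ 2 (fun p : (ℝ × ℝ) × (ℝ × ℝ) => scenario2Field κ α β k n T p.1 p.2)
      ((w₁, w₂), (w₁, w₂)) := by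
    refine ContDiffAt.twoFlowRate (P := (ℝ × ℝ) × (ℝ × ℝ)) (w₁ := fun p => p.1.1) (w₂ := fun p => p.1.2)
      (v₁ := fun p => p.2.1) (v₂ := fun p => p.1.2) ?_ ?_ ?_ ?_ h₁.ne' h₂.ne' <;> fun_prop
  obtain ⟨L, hL, hLa⟩ := hs.exists_hasFDerivAt_apply_eq
    (f' := fun v => (n.coeffs α β k T w₁ w₂).field κ v.1 v.2) fun v => by
      refine (HasDerivAt.twoFlowRate hn (hasDerivAt_line w₁ v.1.1) (hasDerivAt_line w₂ v.1.2)
        (hasDerivAt_line w₁ v.2.1) (hasDerivAt_line w₂ v.1.2) h₁ h₂ (by simp) (by simp) (by simp)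
        (by simp) hκ heq).congr_deriv ?_
      rw [LinCoeffs.field]
      ext : 1 <;> simp only <;> ring
  exact ⟨hs, L, hL, fun x y => hLa (x, y)⟩

theorem scenario2_isCharacteristicRoot_iff {κ α β k : ℝ} (hκ : 0 < κ) {T : Topology3} {n : Network}
    (hn : n.Positive) {w₁ w₂ : ℝ} (h₁ : 0 < w₁) (h₂ : 0 < w₂)
    (heq : scenario2Field κ α β k n T (w₁, w₂) (w₁, w₂) = 0) (z : ℂ) :
    IsCharacteristicRoot (scenario2Field κ α β k n T) n.τ₁ (w₁, w₂) z ↔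
      (n.coeffs α β k T w₁ w₂).charFun κ n.τ₁ z = 0 := by
  obtain ⟨-, L, hL, hLa⟩ := scenario2_hasFDerivAt hκ hn h₁ h₂ heq
  set f := n.coeffs α β k T w₁ w₂
  rw [isCharacteristicRoot_prod_iff hL (a₁ := -κ * f.M₁) (a₂ := -κ * f.P₁) (a₃ := 0)
    (a₄ := -κ * (f.M₂ + f.N₂)) (b₁ := -κ * f.N₁) (b₂ := 0) (b₃ := -κ * f.P₂) (b₄ := 0) fun x y => by
      rw [hLa, LinCoeffs.field]
      ext : 1 <;> simp only <;> ring]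
  rw [LinCoeffs.charFun, LinCoeffs.a, LinCoeffs.b, LinCoeffs.c, LinCoeffs.d]
  push_cast
  constructor <;> intro h <;> linear_combination h

theorem scenario2_stability {κ α β k : ℝ} (hκ : 0 < κ) (hα : 0 < α) (hβ : 0 < β) (hk : k < 2)
    {T : Topology3} {n : Network} (hn : n.Positive) {w₁ w₂ : ℝ} (h₁ : 0 < w₁) (h₂ : 0 < w₂)
    (heq : scenario2Field κ α β k n T (w₁, w₂) (w₁, w₂) = 0)
    (hC : (n.coeffs α β k T w₁ w₂).Condition1) :
    (κ < (n.coeffs α β k T w₁ w₂).κc n.τ₁ →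
      LinearlyStable (scenario2Field κ α β k n T) n.τ₁ (w₁, w₂) ∧
      LocallyAsymptoticallyStable (scenario2Field κ α β k n T) n.τ₁ (w₁, w₂)) ∧
    (κ = (n.coeffs α β k T w₁ w₂).κc n.τ₁ →
      IsCharacteristicRoot (scenario2Field κ α β k n T) n.τ₁ (w₁, w₂)
        (Complex.I * (κ * (n.coeffs α β k T w₁ w₂).A : ℝ))) ∧
    ((n.coeffs α β k T w₁ w₂).disc ≠ 0 →
      (LinearlyStable (scenario2Field κ α β k n T) n.τ₁ (w₁, w₂) ↔
        κ < (n.coeffs α β k T w₁ w₂).κc n.τ₁) ∧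
      ((n.coeffs α β k T w₁ w₂).κc n.τ₁ < κ →
        ¬ LyapunovStable (scenario2Field κ α β k n T) n.τ₁ (w₁, w₂))) := by
  obtain ⟨hs, L, hL, -⟩ := scenario2_hasFDerivAt hκ hn h₁ h₂ heq
  have hchar := scenario2_isCharacteristicRoot_iff hκ hn h₁ h₂ heq
  obtain ⟨ha, hb, hc, hd⟩ := Network.coeffs_pos hn hα hβ hk h₁ h₂
    (equilibrium_of_windowRate_eq_zero hκ hn.τ₁ h₁ (congrArg Prod.fst heq))
    (equilibrium_of_windowRate_eq_zero hκ hn.τ₂ h₂ (congrArg Prod.snd heq))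
  have hlin : κ < (n.coeffs α β k T w₁ w₂).κc n.τ₁ →
      LinearlyStable (scenario2Field κ α β k n T) n.τ₁ (w₁, w₂) := fun hlt z hz =>
    hC.re_neg_of_charFun_eq_zero ha hb hc hd hκ hn.τ₁ hlt ((hchar z).1 hz)
  refine ⟨fun hlt => ⟨hlin hlt, (hlin hlt).locallyAsymptoticallyStable
    Complexification.realProd hs hL heq hn.τ₁⟩, fun hκc => (hchar _).2
      (hC.charFun_crossing ha hb hc hd hκ hn.τ₁ hκc), fun hdisc => ⟨⟨fun hst => ?_, hlin⟩,
      fun hlt => ?_⟩⟩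
  · by_contra hcon
    rcases (not_lt.1 hcon).eq_or_lt with h | h
    · have := hst _ ((hchar _).2 (hC.charFun_crossing ha hb hc hd hκ hn.τ₁ h.symm))
      simp at this
    · obtain ⟨z, hz, h0⟩ := hC.exists_charFun_eq_zero ha hb hc hd hdisc hκ hn.τ₁ h
      exact absurd (hst z ((hchar z).2 h0)) (not_lt.2 hz.le)
  · obtain ⟨z, hz, h0⟩ := hC.exists_charFun_eq_zero ha hb hc hd hdisc hκ hn.τ₁ hlt
    exact not_lyapunovStable_of_isCharacteristicRoot Complexification.realProd hs hL heq hn.τ₁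
      ((hchar z).2 h0) hz

/-- From the characteristic roots to the stability trichotomy with a single delay. -/
theorem single_delay_stability {E V : Type*} [NormedAddCommGroup E] [NormedSpace ℝ E]
    [FiniteDimensional ℝ E] [CompleteSpace E] [NormedAddCommGroup V] [NormedSpace ℂ V]
    [FiniteDimensional ℂ V] [CompleteSpace V] [Nontrivial V] (c : Complexification E V)
    {F : E → E → E} {e : E} {L : E × E →L[ℝ] E}
    (hF : ContDiffAt ℝ 2 (fun p : E × E => F p.1 p.2) (e, e))
    (hL : HasFDerivAt (fun p : E × E => F p.1 p.2) L (e, e)) (he : F e e = 0) {τ γ m b : ℝ}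
    (hτ : 0 < τ) (hγ : 0 < γ) (hm : 0 < m) (hmb : m ≤ b)
    (hroot : ∀ z : ℂ, z + γ * m + γ * b * Complex.exp (-z * τ) = 0 → IsCharacteristicRoot F τ e z)
    (hroot' : γ * τ * √(b ^ 2 - m ^ 2) < Real.arccos (-m / b) → LinearlyStable F τ e) :
    (LinearlyStable F τ e ↔ γ * τ * √(b ^ 2 - m ^ 2) < Real.arccos (-m / b)) ∧
      (γ * τ * √(b ^ 2 - m ^ 2) < Real.arccos (-m / b) → LocallyAsymptoticallyStable F τ e) ∧
      (Real.arccos (-m / b) < γ * τ * √(b ^ 2 - m ^ 2) → ¬ LyapunovStable F τ e) := by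
  refine ⟨⟨fun hst => ?_, hroot'⟩, fun hlt =>
    (hroot' hlt).locallyAsymptoticallyStable c hF hL he hτ, fun hlt => ?_⟩
  · by_contra hcon
    rcases (not_lt.1 hcon).eq_or_lt with h | h
    · obtain ⟨z, hz, h0⟩ := exists_re_nonneg_single_delay hγ hm hmb h
      exact absurd (hst z (hroot z h0)) (not_lt.2 hz)
    · obtain ⟨z, hz, h0⟩ := exists_re_pos_single_delay hγ hm hmb h
      exact absurd (hst z (hroot z h0)) (not_lt.2 hz.le)
  · obtain ⟨z, hz, h0⟩ := exists_re_pos_single_delay hγ hm hmb hlt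
    exact not_lyapunovStable_of_isCharacteristicRoot c hF hL he hτ (hroot z h0) hz

theorem singleDelayLhs_eq {κ α k τ w L : ℝ} {B : ℕ} (hτ : 0 < τ) :
    singleDelayLhs κ α k B w L =
      κ * α * w ^ (k - 1) / τ * τ * √((B : ℝ) ^ 2 - ((2 - k) * (1 - L)) ^ 2) := by
  rw [singleDelayLhs, div_mul_cancel₀ _ hτ.ne',
    show ((k - 2) * (1 - L)) ^ 2 = ((2 - k) * (1 - L)) ^ 2 by ring]

theorem singleDelayRhs_eq {k L : ℝ} {B : ℕ} :
    singleDelayRhs k B L = Real.arccos (-((2 - k) * (1 - L)) / B) := by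
  rw [singleDelayRhs, show -((2 - k) * (1 - L)) = (k - 2) * (1 - L) by ring]

/-- At equilibrium `(α w ^ (k - 1) + β w) L = α w ^ (k - 1)`, so the delayed coefficient is `γ B`
with `γ = κ α w ^ (k - 1) / τ`, and `m` enters only through `L`. -/
theorem singleFlow_stability {κ α β k : ℝ} (hκ : 0 < κ) (hα : 0 < α) (hβ : 0 < β) (hk : k < 2)
    {m B : ℕ} {τ C w : ℝ} (hm : 0 < m) (hB : 0 < B) (hτ : 0 < τ) (hC : 0 < C) (hw : 0 < w)
    (heq : singleFlowField κ α β k τ C B m w w = 0) {L : ℝ} (hL : L = m * (w / (C * τ)) ^ B)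
    (hLB : (2 - k) * (1 - L) ≤ B) :
    (LinearlyStable (singleFlowField κ α β k τ C B m) τ w ↔
      singleDelayLhs κ α k B w L < singleDelayRhs k B L) ∧
    (singleDelayLhs κ α k B w L < singleDelayRhs k B L →
      LocallyAsymptoticallyStable (singleFlowField κ α β k τ C B m) τ w) ∧
    (singleDelayRhs k B L < singleDelayLhs κ α k B w L →
      ¬ LyapunovStable (singleFlowField κ α β k τ C B m) τ w) := by
  have hloss : m * dropTailLoss C B (w / τ) = L := by
    rw [hL, dropTailLoss, div_div, mul_comm τ]
  have hLpos : 0 < L := by rw [hL]; positivity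
  have e := equilibrium_of_windowRate_eq_zero hκ hτ hw heq
  rw [hloss] at e
  have h1L := loss_lt_one hα hβ hw hLpos e
  have hs : ContDiffAt ℝ 2 (fun p : ℝ × ℝ => singleFlowField κ α β k τ C B m p.1 p.2) (w, w) :=
    ContDiffAt.windowRate (w := fun p : ℝ × ℝ => p.1) (v := fun p : ℝ × ℝ => p.2) contDiffAt_fst
      contDiffAt_snd (contDiffAt_const.mul ((contDiffAt_snd.div_const τ).dropTailLoss C B)) hw.ne'
  obtain ⟨γ, hγ⟩ : ∃ γ, γ = κ * α * w ^ (k - 1) / τ := ⟨_, rfl⟩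
  have hγpos : 0 < γ := by rw [hγ]; positivity
  obtain ⟨D, hD, hDa⟩ := hs.exists_hasFDerivAt_apply_eq
    (f' := fun v => -(γ * ((2 - k) * (1 - L))) * v.1 + -(γ * B) * v.2) fun v => by
      refine (HasDerivAt.windowRate (hasDerivAt_line w v.1) (hasDerivAt_line w v.2)
        ((((hasDerivAt_line w v.2).div_const τ).dropTailLoss C B).const_mul (m : ℝ)) hw (by simp)
        (by simp) (by simp [hloss]) e).congr_deriv ?_
      rw [zero_mul, add_zero]
      have h1 := mul_edge_deriv (W := w) (w' := v.2) hτ hC hB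
      rw [show w / τ * (m * (B / C ^ B * (w / τ) ^ (B - 1) * (v.2 / τ))) = B / τ * L * v.2 by
        rw [hL]; linear_combination m * h1, hγ]
      linear_combination -(-κ * (B / τ * v.2)) * e
  rw [singleDelayLhs_eq hτ, singleDelayRhs_eq, ← hγ]
  have hpos : 0 < (2 - k) * (1 - L) := mul_pos (by linarith) h1L
  have hchar := fun z => isCharacteristicRoot_real_iff (τ := τ) hD (fun x y => hDa (x, y)) z
  refine single_delay_stability Complexification.real hs hD heq hτ hγpos hpos hLB (fun z hz => ?_)
    fun hlt z hz => ?_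
  · rw [hchar]
    push_cast at hz ⊢
    linear_combination hz
  · rw [hchar] at hz
    refine re_neg_of_single_delay hγpos hτ hpos (by exact_mod_cast hB) (fun _ => hlt) (z := z) ?_
    push_cast at hz ⊢
    linear_combination hz

/-- Exchanging the two flows is a symmetry, so the determinant splits into a symmetric and an
antisymmetric mode with delayed coefficients `κ (N₁ + P₁) = γ B` and `κ (N₁ - P₁) = γ B / (1 + 2 ^
B)`. The symmetric mode has the larger coefficient and gives the stability condition. -/
theorem scenario1_stability {κ α β k : ℝ} (hκ : 0 < κ) (hα : 0 < α) (hβ : 0 < β) (hk : k < 2)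
    {B : ℕ} {τ C w : ℝ} (hB : 0 < B) (hτ : 0 < τ) (hC : 0 < C) (hw : 0 < w)
    (heq : scenario1Field κ α β k τ C B .caseIII (w, w) (w, w) = 0) {L : ℝ}
    (hL : L = (1 + 2 ^ B) * (w / (C * τ)) ^ B) (hLB : (2 - k) * (1 - L) ≤ B) :
    (LinearlyStable (scenario1Field κ α β k τ C B .caseIII) τ (w, w) ↔
      singleDelayLhs κ α k B w L < singleDelayRhs k B L) ∧
    (singleDelayLhs κ α k B w L < singleDelayRhs k B L →
      LocallyAsymptoticallyStable (scenario1Field κ α β k τ C B .caseIII) τ (w, w)) ∧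
    (singleDelayRhs k B L < singleDelayLhs κ α k B w L →
      ¬ LyapunovStable (scenario1Field κ α β k τ C B .caseIII) τ (w, w)) := by
  have hn : (uniformNetwork τ C B).Positive := ⟨hτ, hτ, hC, hC, hC, hB, hB, hB⟩
  set ρ := (w / (C * τ)) ^ B with hρ
  have hρpos : 0 < ρ := by positivity
  have hloss₁ : (uniformNetwork τ C B).loss₁ .caseIII w w = L := by
    rw [hL, hρ, Network.loss₁, Network.rate, uniformNetwork, dropTailLoss, dropTailLoss,
      show (w / τ + w / τ) / C = 2 * (w / (C * τ)) by field_simp; ring, mul_pow, div_div,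
      mul_comm τ]
    ring
  have hloss₂ : (uniformNetwork τ C B).loss₂ .caseIII w w = L := by
    rw [← hloss₁]; rfl
  have hLpos : 0 < L := by rw [hL]; positivity
  have e : α * w ^ (k - 1) * (1 - L) - β * w * L = 0 := by
    rw [← hloss₁]
    exact equilibrium_of_windowRate_eq_zero hκ hτ hw (congrArg Prod.fst heq)
  have h1L := loss_lt_one hα hβ hw hLpos e
  have hs : ContDiffAt ℝ 2 (fun p : (ℝ × ℝ) × (ℝ × ℝ) =>
      scenario1Field κ α β k τ C B .caseIII p.1 p.2) ((w, w), (w, w)) := by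
    refine ContDiffAt.twoFlowRate (P := (ℝ × ℝ) × (ℝ × ℝ)) (w₁ := fun p => p.1.1) (w₂ := fun p => p.1.2)
      (v₁ := fun p => p.2.1) (v₂ := fun p => p.2.2) ?_ ?_ ?_ ?_ hw.ne' hw.ne' <;> fun_prop
  obtain ⟨γ, hγ⟩ : ∃ γ, γ = κ * α * w ^ (k - 1) / τ := ⟨_, rfl⟩
  have hγpos : 0 < γ := by rw [hγ]; positivity
  set f := (uniformNetwork τ C B).coeffs α β k .caseIII w w with hf
  obtain ⟨b', hb'⟩ : ∃ b' : ℝ, b' = B / (1 + 2 ^ B) := ⟨_, rfl⟩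
  have hBpos : (0 : ℝ) < B := by exact_mod_cast hB
  have hb'pos : 0 < b' := by rw [hb']; positivity
  have hb'B : b' ≤ B := by
    rw [hb']
    exact div_le_self hBpos.le (by linarith [pow_pos (two_pos (α := ℝ)) B])
  have hM₁ : κ * f.M₁ = γ * ((2 - k) * (1 - L)) := by
    rw [hf, Network.coeffs, hloss₁, hγ]
    simp only [uniformNetwork]
    ring
  have hM₂ : f.M₂ = f.M₁ := by
    rw [hf, Network.coeffs, hloss₁, hloss₂]
    rfl
  have hN₂ : f.N₂ = f.N₁ := rfl
  have hP₂ : f.P₂ = f.P₁ := rfl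
  -- The equilibrium equation, solved for the factor common to `N₁` and `P₁`; it removes `β` from
  -- both modes.
  have hG : (α * w ^ (k - 1) + β * w) * ((1 + 2 ^ B) * ρ) = α * w ^ (k - 1) := by
    rw [← hL]; linear_combination -e
  have hslope : w / τ ^ 2 * (uniformNetwork τ C B).sharedSlope .caseIII
      ((uniformNetwork τ C B).rate w w) = B / τ * (2 ^ B * ρ) / 2 := by
    have h1 := mul_edge_deriv (W := 2 * w) (w' := 1) hτ hC hB
    have h2 : (2 * w / (C * τ)) ^ B = 2 ^ B * ρ := by rw [hρ, ← mul_pow]; ring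
    rw [h2] at h1
    rw [Network.sharedSlope, Network.rate]
    simp only [uniformNetwork]
    rw [show w / τ + w / τ = 2 * w / τ by ring]
    linear_combination h1 / 2
  have hN₁ : f.N₁ = (α * w ^ (k - 1) + β * w) * (B / τ * ρ + B / τ * (2 ^ B * ρ) / 2) := by
    rw [← hslope]; rfl
  have hP₁ : f.P₁ = (α * w ^ (k - 1) + β * w) * (B / τ * (2 ^ B * ρ) / 2) := by
    rw [← hslope, pow_two]; rfl
  have hsum : κ * (f.N₁ + f.P₁) = γ * B := by
    rw [hN₁, hP₁, hγ]
    linear_combination κ * (B / τ) * hG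
  have hdiff : κ * (f.N₁ - f.P₁) = γ * b' := by
    have h3 : b' * (1 + 2 ^ B) = B := by rw [hb']; exact div_mul_cancel₀ _ (by positivity)
    rw [hN₁, hP₁, hγ]
    linear_combination κ / τ * b' * hG - κ * (α * w ^ (k - 1) + β * w) * ρ / τ * h3
  obtain ⟨D, hD, hDa⟩ := hs.exists_hasFDerivAt_apply_eq
    (f' := fun v => (-κ * (f.M₁ * v.1.1 + f.N₁ * v.2.1 + f.P₁ * v.2.2),
      -κ * (f.M₂ * v.1.2 + f.N₂ * v.2.2 + f.P₂ * v.2.1))) fun v =>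
      HasDerivAt.twoFlowRate hn (hasDerivAt_line w v.1.1) (hasDerivAt_line w v.1.2)
        (hasDerivAt_line w v.2.1) (hasDerivAt_line w v.2.2) hw hw (by simp) (by simp) (by simp)
        (by simp) hκ heq
  have hchar : ∀ z : ℂ, IsCharacteristicRoot (scenario1Field κ α β k τ C B .caseIII) τ (w, w) z ↔
      z + γ * ((2 - k) * (1 - L) : ℝ) + γ * (B : ℝ) * Complex.exp (-z * τ) = 0 ∨
      z + γ * ((2 - k) * (1 - L) : ℝ) + γ * b' * Complex.exp (-z * τ) = 0 := by
    intro z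
    rw [isCharacteristicRoot_prod_iff hD (a₁ := -κ * f.M₁) (a₂ := 0) (a₃ := 0) (a₄ := -κ * f.M₁)
      (b₁ := -κ * f.N₁) (b₂ := -κ * f.P₁) (b₃ := -κ * f.P₁) (b₄ := -κ * f.N₁) fun x y => by
        rw [hDa, hM₂, hN₂, hP₂]
        ext : 1 <;> simp only <;> ring, ← mul_eq_zero]
    have c1 := congrArg Complex.ofReal hM₁
    have c2 := congrArg Complex.ofReal hsum
    have c3 := congrArg Complex.ofReal hdiff
    rw [Complex.ofReal_mul γ] at c1 c2 c3
    rw [← c1, ← c2, ← c3]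
    push_cast
    constructor <;> intro h <;> linear_combination h
  rw [singleDelayLhs_eq hτ, singleDelayRhs_eq, ← hγ]
  have hpos : 0 < (2 - k) * (1 - L) := mul_pos (by linarith) h1L
  refine single_delay_stability Complexification.realProd hs hD heq hτ hγpos hpos hLB
    (fun z hz => (hchar z).2 (Or.inl hz)) fun hlt z hz => ?_
  rcases (hchar z).1 hz with h | h
  · exact re_neg_of_single_delay hγpos hτ hpos hBpos (fun _ => hlt) h
  · exact re_neg_of_single_delay hγpos hτ hpos hb'pos
      (fun _ => arccos_bound_mono (by positivity) hpos hb'pos hb'B hlt) h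

end Scenarios

theorem mainTheorem1 (κ α β k : ℝ) (hκ : 0 < κ) (hα : 0 < α) (hβ : 0 < β) (hk : k < 2) :
    -- Scenario 2, Cases I, II, III
    (∀ (T : Topology3) (n : Network), n.Positive → ∀ w₁ w₂ : ℝ, 0 < w₁ → 0 < w₂ →
      scenario2Field κ α β k n T (w₁, w₂) (w₁, w₂) = 0 →
      -- the linearised system
      (∃ L : (ℝ × ℝ) × (ℝ × ℝ) →L[ℝ] ℝ × ℝ,
        HasFDerivAt (fun p : (ℝ × ℝ) × (ℝ × ℝ) => scenario2Field κ α β k n T p.1 p.2) L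
          ((w₁, w₂), (w₁, w₂)) ∧
        ∀ x y : ℝ × ℝ, L (x, y) = (n.coeffs α β k T w₁ w₂).field κ x y) ∧
      -- its characteristic equation
      (∀ z : ℂ, IsCharacteristicRoot (scenario2Field κ α β k n T) n.τ₁ (w₁, w₂) z ↔
        (n.coeffs α β k T w₁ w₂).charFun κ n.τ₁ z = 0) ∧
      -- the stability condition
      ((n.coeffs α β k T w₁ w₂).Condition1 →
        (κ < (n.coeffs α β k T w₁ w₂).κc n.τ₁ →
          LinearlyStable (scenario2Field κ α β k n T) n.τ₁ (w₁, w₂) ∧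
          LocallyAsymptoticallyStable (scenario2Field κ α β k n T) n.τ₁ (w₁, w₂)) ∧
        (κ = (n.coeffs α β k T w₁ w₂).κc n.τ₁ →
          IsCharacteristicRoot (scenario2Field κ α β k n T) n.τ₁ (w₁, w₂)
            (Complex.I * (κ * (n.coeffs α β k T w₁ w₂).A : ℝ))) ∧
        ((n.coeffs α β k T w₁ w₂).disc ≠ 0 →
          (LinearlyStable (scenario2Field κ α β k n T) n.τ₁ (w₁, w₂) ↔
            κ < (n.coeffs α β k T w₁ w₂).κc n.τ₁) ∧
          ((n.coeffs α β k T w₁ w₂).κc n.τ₁ < κ →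
            ¬ LyapunovStable (scenario2Field κ α β k n T) n.τ₁ (w₁, w₂))))) ∧
    -- Scenario 1, Case I (`m = 1`) and Case II (`m = 2`)
    (∀ (m B : ℕ) (τ C w : ℝ), m = 1 ∨ m = 2 → 0 < B → 0 < τ → 0 < C → 0 < w →
      singleFlowField κ α β k τ C B m w w = 0 →
      ∀ L : ℝ, L = m * (w / (C * τ)) ^ B → (2 - k) * (1 - L) ≤ B →
        (LinearlyStable (singleFlowField κ α β k τ C B m) τ w ↔
          singleDelayLhs κ α k B w L < singleDelayRhs k B L) ∧
        (singleDelayLhs κ α k B w L < singleDelayRhs k B L →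
          LocallyAsymptoticallyStable (singleFlowField κ α β k τ C B m) τ w) ∧
        (singleDelayRhs k B L < singleDelayLhs κ α k B w L →
          ¬ LyapunovStable (singleFlowField κ α β k τ C B m) τ w)) ∧
    -- Scenario 1, Case III
    (∀ (B : ℕ) (τ C w : ℝ), 0 < B → 0 < τ → 0 < C → 0 < w →
      scenario1Field κ α β k τ C B .caseIII (w, w) (w, w) = 0 →
      ∀ L : ℝ, L = (1 + 2 ^ B) * (w / (C * τ)) ^ B → (2 - k) * (1 - L) ≤ B →
        (LinearlyStable (scenario1Field κ α β k τ C B .caseIII) τ (w, w) ↔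
          singleDelayLhs κ α k B w L < singleDelayRhs k B L) ∧
        (singleDelayLhs κ α k B w L < singleDelayRhs k B L →
          LocallyAsymptoticallyStable (scenario1Field κ α β k τ C B .caseIII) τ (w, w)) ∧
        (singleDelayRhs k B L < singleDelayLhs κ α k B w L →
          ¬ LyapunovStable (scenario1Field κ α β k τ C B .caseIII) τ (w, w))) := by
  refine ⟨fun T n hn w₁ w₂ h₁ h₂ heq => ⟨(scenario2_hasFDerivAt hκ hn h₁ h₂ heq).2,
    scenario2_isCharacteristicRoot_iff hκ hn h₁ h₂ heq,
    scenario2_stability hκ hα hβ hk hn h₁ h₂ heq⟩, ?_, ?_⟩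
  · intro m B τ C w hm hB hτ hC hw heq L hL hLB
    exact singleFlow_stability hκ hα hβ hk (by omega) hB hτ hC hw heq hL hLB
  · intro B τ C w hB hτ hC hw heq L hL hLB
    exact scenario1_stability hκ hα hβ hk hB hτ hC hw heq hL hLB
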